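/- **Setting.** Let $X\subseteq\mathbb R$ be measurable and let $\Xi=(\xi_n)_{n\ge 0}$ be a time-homogeneous Markov chain on $X$ with transition kernel $P$. Let $\mathcal I$ be a set of probability measures on $X$, the admissible laws of $\xi_0$ (for instance a single law, or all point masses). "Almost surely" means: with probability one for every law of $\xi_0$ in $\mathcal I$. For $x\in X$ write $\mathbb P_x,\mathbb E_x$ for the chain started from $\xi_0=x$; put $\theta=\xi_1-\xi_0$, $\theta_+=\max(\theta,0)$, $\theta_-=\max(-\theta,0)$, $\mu(x)=\mathbb E_x[\theta]$, and $\tau_a=\min\{n\ge 0:|\xi_n|\le a\}$ ($=\infty$ if there is no such $n$). Below, $x$ always ranges over $X$. The chain is *recurrent* if there is a deterministic $r_0\ge0$ with $\liminf_n|\xi_n|\le r_0$ a.s.; *positive recurrent* if it is recurrent and, for all sufficiently large $a$, $\mathbb E_x[\tau_a]<\infty$ for every $x$; *null recurrent* if it is recurrent and, for all sufficiently large $a$, $\mathbb E_x[\tau_a]=\infty$ for every $x$ with $|x|>a$; *directional transient* if a.s. $\lim_n\xi_n\in\{-\infty,+\infty\}$; *oscillatory transient* if a.s. $\lim_n|\xi_n|=\infty$,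 $\liminf_n\xi_n=-\infty$ and $\limsup_n\xi_n=+\infty$. **Assumptions.** (N$'$) $\limsup_n|\xi_n|=+\infty$ a.s. (T$^{\rm in}$) There are constants $\beta\in(1,2)$, $\alpha>\beta$, $c>0$ and $x_0\ge 0$ with $$\lim_{y\to\infty}\sup_{x\ge x_0}\bigl|y^\beta\,\mathbb P_x[\theta_->y]-c\bigr|=\lim_{y\to\infty}\sup_{x\le -x_0}\bigl|y^\beta\,\mathbb P_x[\theta_+>y]-c\bigr|=0,$$ $$\sup_{x\ge x_0}\mathbb E_x[\theta_+^\alpha]<\infty,\qquad \sup_{x\le -x_0}\mathbb E_x[\theta_-^\alpha]<\infty.$$ (D$'$) There are constants $\gamma\ge 0$ and $b\in\mathbb R$ with $\lim_{x\to+\infty}x^\gamma\mu(x)=\lim_{x\to-\infty}\bigl(-|x|^\gamma\mu(x)\bigr)=b$. (T$^+_\delta$) With $\beta,c,x_0$ as in (T$^{\rm in}$) and some $\delta>0$, as $y\to\infty$, $$\sup_{x\ge x_0}\bigl|y^\beta\,\mathbb P_x[\theta_->y]-c\bigr|=O(y^{-\delta}),\qquad \sup_{x\le -x_0}\bigl|y^\beta\,\mathbb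 P_x[\theta_+>y]-c\bigr|=O(y^{-\delta}).$$ **Theorem.** Suppose that (N$'$), (T$^{\rm in}$) and (D$'$) hold. 1. If $\gamma>\beta-1$ and $\beta>3/2$, then $\Xi$ is null recurrent. 2. If $\gamma<\beta-1$ and $b<0$, then $\Xi$ is positive recurrent. 3. If $\gamma<\beta-1$ and $b>0$, then $\Xi$ is directional transient. 4. If $\gamma=\beta-1$ and $b+c\pi\cot(\pi\beta)<0$, then $\Xi$ is null recurrent. If in addition (T$^+_\delta$) holds for some $\delta>0$, then: 5. If $\gamma>\beta-1$ and $\beta<3/2$, then $\Xi$ is oscillatory transient. 6. If $\gamma=\beta-1$ and $b+c\pi\cot(\pi\beta)>0$, then $\Xi$ is oscillatory transient. -/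

import Mathlib

open MeasureTheory ProbabilityTheory Filter Topology
open scoped ENNReal

noncomputable section

namespace HeavyTailChain

/-- The law on path space of the time-homogeneous Markov chain `ξ₀, ξ₁, ξ₂, …` on `X ⊆ ℝ` with
transition kernel `P` and with `ξ₀` distributed as `ν` (Ionescu-Tulcea). The chain itself is the
coordinate process: a path is `ω : ℕ → X` and `ξₙ = ω n`. -/
def pathLaw {X : Set ℝ} (P : Kernel X X) [IsMarkovKernel P] (ν : Measure X) : Measure (ℕ → X) :=
  Kernel.trajMeasure (X := fun _ : ℕ => X) ν
    (fun n => P.comap (fun h : (Finset.Iic n) → X => h ⟨n, Finset.mem_Iic.2 le_rfl⟩)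
      (measurable_pi_apply _))

/-- The law `ℙ_x` of the chain started from `ξ₀ = x`. -/
def pathLawFrom {X : Set ℝ} (P : Kernel X X) [IsMarkovKernel P] (x : X) : Measure (ℕ → X) :=
  pathLaw P (Measure.dirac x)

/-- `AlmostSurely P I E`: the event `E` has probability one for the chain with kernel `P`,
whichever law from the collection `I` is taken as the law of `ξ₀`. -/
def AlmostSurely {X : Set ℝ} (P : Kernel X X) [IsMarkovKernel P] (I : Set (ProbabilityMeasure X))
    (E : (ℕ → X) → Prop) : Prop :=
  ∀ ν ∈ I, ∀ᵐ ω ∂(pathLaw P (ν : Measure X)), E ω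

/-- Probability, in one step from `x`, that the increment `θ = ξ₁ - x` has positive part
`θ₊ = max θ 0` larger than `y`. -/
def posTail {X : Set ℝ} (P : Kernel X X) (x : X) (y : ℝ) : ℝ :=
  (P x).real {z | y < max ((z : ℝ) - x) 0}

/-- Probability, in one step from `x`, that the increment `θ = ξ₁ - x` has negative part
`θ₋ = max (-θ) 0` larger than `y`. -/
def negTail {X : Set ℝ} (P : Kernel X X) (x : X) (y : ℝ) : ℝ :=
  (P x).real {z | y < max ((x : ℝ) - z) 0}

/-- The moment `𝔼_x[θ₊ ^ p]`, in `[0, ∞]`. -/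
def posMoment {X : Set ℝ} (P : Kernel X X) (p : ℝ) (x : X) : ℝ≥0∞ :=
  ∫⁻ z, ENNReal.ofReal (max ((z : ℝ) - x) 0 ^ p) ∂(P x)

/-- The moment `𝔼_x[θ₋ ^ p]`, in `[0, ∞]`. -/
def negMoment {X : Set ℝ} (P : Kernel X X) (p : ℝ) (x : X) : ℝ≥0∞ :=
  ∫⁻ z, ENNReal.ofReal (max ((x : ℝ) - z) 0 ^ p) ∂(P x)

/-- The one-step mean drift `μ(x) = 𝔼_x[θ]`. Only its values for large `|x|` are used, where the
tail assumption below makes `θ` integrable. -/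
def drift {X : Set ℝ} (P : Kernel X X) (x : X) : ℝ :=
  ∫ z, ((z : ℝ) - x) ∂(P x)

/-- Non-confinement: `limsup |ξₙ| = +∞` almost surely. -/
def NonConfined {X : Set ℝ} (P : Kernel X X) [IsMarkovKernel P]
    (I : Set (ProbabilityMeasure X)) : Prop :=
  AlmostSurely P I (fun ω => limsup (fun n => ((|(ω n : ℝ)| : ℝ) : EReal)) atTop = ⊤)

/-- Heavier inward tails. Uniform convergence says that the suprema over `x ≥ x₀` (respectively
`x ≤ -x₀`) of `|y ^ β * ℙ_x[θ₋ > y] - c|` (respectively `|y ^ β * ℙ_x[θ₊ > y] - c|`) tend to `0`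
as `y → ∞`. -/
structure InwardTails {X : Set ℝ} (P : Kernel X X) (α β c x₀ : ℝ) : Prop where
  one_lt_beta : 1 < β
  beta_lt_two : β < 2
  beta_lt_alpha : β < α
  c_pos : 0 < c
  x₀_nonneg : 0 ≤ x₀
  right_inward : TendstoUniformlyOn (fun (y : ℝ) (x : X) => y ^ β * negTail P x y)
    (fun _ => c) atTop {x : X | x₀ ≤ (x : ℝ)}
  left_inward : TendstoUniformlyOn (fun (y : ℝ) (x : X) => y ^ β * posTail P x y)
    (fun _ => c) atTop {x : X | (x : ℝ) ≤ -x₀}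
  right_outward : (⨆ x ∈ {x : X | x₀ ≤ (x : ℝ)}, posMoment P α x) < ∞
  left_outward : (⨆ x ∈ {x : X | (x : ℝ) ≤ -x₀}, negMoment P α x) < ∞

/-- Polynomial rate of convergence in the inward tail asymptotics: the same suprema are
`O(y ^ (-δ))` as `y → ∞`. -/
structure InwardTailRate {X : Set ℝ} (P : Kernel X X) (β c x₀ δ : ℝ) : Prop where
  delta_pos : 0 < δ
  right_rate : ∃ C : ℝ, ∀ᶠ y : ℝ in atTop, ∀ x : X, x₀ ≤ (x : ℝ) →
    |y ^ β * negTail P x y - c| ≤ C * y ^ (-δ)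
  left_rate : ∃ C : ℝ, ∀ᶠ y : ℝ in atTop, ∀ x : X, (x : ℝ) ≤ -x₀ →
    |y ^ β * posTail P x y - c| ≤ C * y ^ (-δ)

/-- Asymptotic drift: `x ^ γ * μ(x) → b` as `x → +∞`, and `-|x| ^ γ * μ(x) → b` as `x → -∞`,
where `x` runs through the state space `X`. -/
structure DriftAsymptotics {X : Set ℝ} (P : Kernel X X) (γ b : ℝ) : Prop where
  gamma_nonneg : 0 ≤ γ
  right : Tendsto (fun x : X => (x : ℝ) ^ γ * drift P x)
    (comap (fun x : X => (x : ℝ)) atTop) (𝓝 b)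
  left : Tendsto (fun x : X => -(|(x : ℝ)| ^ γ * drift P x))
    (comap (fun x : X => (x : ℝ)) atBot) (𝓝 b)

/-- The passage time `τ_a = min {n ≥ 0 : |ξₙ| ≤ a}`, equal to `∞` if there is no such `n`. -/
def passageTime {X : Set ℝ} (a : ℝ) (ω : ℕ → X) : ℝ≥0∞ :=
  ⨅ n ∈ {n : ℕ | |(ω n : ℝ)| ≤ a}, (n : ℝ≥0∞)

/-- `𝔼_x[τ_a]`, in `[0, ∞]`. -/
def meanPassageTime {X : Set ℝ} (P : Kernel X X) [IsMarkovKernel P] (a : ℝ) (x : X) : ℝ≥0∞ :=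
  ∫⁻ ω, passageTime a ω ∂(pathLawFrom P x)

/-- Recurrence: for some deterministic `r₀ ≥ 0`, almost surely `liminf |ξₙ| ≤ r₀`. -/
def Recurrent {X : Set ℝ} (P : Kernel X X) [IsMarkovKernel P]
    (I : Set (ProbabilityMeasure X)) : Prop :=
  ∃ r₀ : ℝ, 0 ≤ r₀ ∧
    AlmostSurely P I (fun ω => liminf (fun n => ((|(ω n : ℝ)| : ℝ) : EReal)) atTop ≤ (r₀ : EReal))

/-- Positive recurrence: recurrence, and `𝔼_x[τ_a] < ∞` for all large `a` and every `x`. -/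
def PositiveRecurrent {X : Set ℝ} (P : Kernel X X) [IsMarkovKernel P]
    (I : Set (ProbabilityMeasure X)) : Prop :=
  Recurrent P I ∧ ∀ᶠ a : ℝ in atTop, ∀ x : X, meanPassageTime P a x < ∞

/-- Null recurrence: recurrence, and `𝔼_x[τ_a] = ∞` for all large `a` and every `x` with
`|x| > a`. -/
def NullRecurrent {X : Set ℝ} (P : Kernel X X) [IsMarkovKernel P]
    (I : Set (ProbabilityMeasure X)) : Prop :=
  Recurrent P I ∧ ∀ᶠ a : ℝ in atTop, ∀ x : X, a < |(x : ℝ)| → meanPassageTime P a x = ∞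

/-- Directional transience: almost surely `ξₙ → +∞` or `ξₙ → -∞`. -/
def DirectionalTransient {X : Set ℝ} (P : Kernel X X) [IsMarkovKernel P]
    (I : Set (ProbabilityMeasure X)) : Prop :=
  AlmostSurely P I (fun ω =>
    Tendsto (fun n => (ω n : ℝ)) atTop atTop ∨ Tendsto (fun n => (ω n : ℝ)) atTop atBot)

/-- Oscillatory transience: almost surely `|ξₙ| → ∞` while `liminf ξₙ = -∞` and
`limsup ξₙ = +∞`. -/
def OscillatoryTransient {X : Set ℝ} (P : Kernel X X) [IsMarkovKernel P]
    (I : Set (ProbabilityMeasure X)) : Prop :=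
  AlmostSurely P I (fun ω =>
    Tendsto (fun n => |(ω n : ℝ)|) atTop atTop ∧
      liminf (fun n => ((ω n : ℝ) : EReal)) atTop = ⊥ ∧
      limsup (fun n => ((ω n : ℝ) : EReal)) atTop = ⊤)

end HeavyTailChain

end

/-! The proof is by Lyapunov functions. Orient a far state outwards, so that it sits at distance `r`
and the increment `η` has mean about `b r^(-γ)` and inward tail `c y^(-β)`. Jumps of size comparable
to `r` have probability of order `r^(-β)`, and the drift moves the position by a relative amount of
order `r^(-1-γ)`; the two balance when `γ = β - 1`.

In the balanced case the logarithm of the modulus changes in mean by `r^(-β) (b + c J + o(1))`.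
Writing the change after an inward jump `-u r` as `-u + (u + log|1 - u|)`, the first term belongs to
the drift, and `J` is the integral of `s^(-β)` against the derivative `s / (s - 1)` of the bracket,
a principal value equal to `π cot (π β)`. For `γ > β - 1` the drift is negligible, `b` becomes `0`,
and the sign of the cotangent, which changes at `β = 3/2`, decides.

When the constant is negative, `log⁺` is superharmonic far out (`posLog_superharmonic`), and with
non-confinement this gives recurrence (`recurrent_of_superharmonic`). Nullity comes from a single
jump: it reaches distance `Y` with probability of order `Y^(-β)`, and a bump of width `Y` shows that
the return then takes at least order `Y^β` steps. So `ℙ[τ > n]` is at least a multiple of `1/n`,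
which is not summable (`meanPassageTime_eq_top`).

When the constant is positive, `1 / (1 + log⁺)` is superharmonic (`inv_posLog_superharmonic`) and
the modulus diverges. The logarithm is very negative near the origin, so landings there must be
shown to be rare; this is the role of the polynomial rate. Neither direction is kept forever,
because a jump over the origin costs the one-sided logarithm `log r`, which beats every contribution
of order `r^(-β)` (`posLog_max_superharmonic`).

For `γ < β - 1` the drift dominates. If `b < 0`, a multiple of `|x|^(1+γ)` has drift at most `-1`
and Foster's criterion applies; if `b > 0`, a small negative power of the one-sided position is
superharmonic and the chain stays on one side. -/

noncomputable section

namespace HeavyTailChain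

/-! ### Path space: the Markov property and shifts -/

section PathLaw

variable {X : Set ℝ} (P : Kernel X X) [IsMarkovKernel P]

/-- The transition kernel from the past up to time `n` to the state at time `n + 1`. -/
abbrev stepKernel (n : ℕ) : Kernel ((Finset.Iic n) → X) X :=
  P.comap (fun h : (Finset.Iic n) → X => h ⟨n, Finset.mem_Iic.2 le_rfl⟩) (measurable_pi_apply _)

/-- The laws `ℙ_x` bundled as a kernel. -/
def pathKernel : Kernel X (ℕ → X) :=
  (Kernel.traj (X := fun _ : ℕ => X) (stepKernel P) 0).comap
    (MeasurableEquiv.piUnique (fun _ : Finset.Iic 0 => X)).symm (MeasurableEquiv.measurable _)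

instance : IsMarkovKernel (pathKernel P) := by
  unfold pathKernel; infer_instance

lemma pathLaw_eq_bind (ν : Measure X) : pathLaw P ν = ν.bind (pathKernel P) := by
  unfold pathLaw Kernel.trajMeasure pathKernel
  ext s hs
  rw [Measure.bind_apply hs (Kernel.aemeasurable _), Measure.bind_apply hs (Kernel.aemeasurable _)]
  erw [lintegral_map (Kernel.measurable_coe _ hs) (MeasurableEquiv.measurable _)]
  rfl

lemma pathLawFrom_eq (x : X) : pathLawFrom P x = pathKernel P x := by
  rw [pathLawFrom, pathLaw_eq_bind, Measure.dirac_bind (Kernel.measurable _)]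

instance (ν : Measure X) [IsProbabilityMeasure ν] : IsProbabilityMeasure (pathLaw P ν) := by
  rw [pathLaw_eq_bind]; infer_instance

instance (x : X) : IsProbabilityMeasure (pathLawFrom P x) := by
  rw [pathLawFrom_eq]; infer_instance

lemma measurable_pathLawFrom {s : Set (ℕ → X)} (hs : MeasurableSet s) :
    Measurable fun x => pathLawFrom P x s := by
  simp_rw [pathLawFrom_eq]
  exact Kernel.measurable_coe _ hs

lemma pathLaw_apply (ν : Measure X) {s : Set (ℕ → X)} (hs : MeasurableSet s) :
    pathLaw P ν s = ∫⁻ x, pathLawFrom P x s ∂ν := by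
  simp_rw [pathLaw_eq_bind, pathLawFrom_eq]
  rw [Measure.bind_apply hs (Kernel.aemeasurable _)]

lemma pathLawFrom_map_zero (x : X) :
    (pathLawFrom P x).map (fun ω : ℕ → X => ω 0) = Measure.dirac x := by
  rw [pathLawFrom_eq, pathKernel, Kernel.comap_apply]
  have h : (fun ω : ℕ → X => ω 0) =
      (fun h : (Finset.Iic 0) → X => h ⟨0, Finset.mem_Iic.2 le_rfl⟩) ∘
        (Preorder.frestrictLe (π := fun _ : ℕ => X) 0) := rfl
  rw [h, ← Measure.map_map (by fun_prop) (by fun_prop), Kernel.traj_map_frestrictLe_apply,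
    Kernel.partialTraj_self, Kernel.id_apply]
  exact Measure.map_dirac' (f := fun h : (Finset.Iic 0) → X => h ⟨0, Finset.mem_Iic.2 le_rfl⟩)
    (by fun_prop) _

lemma pathLaw_map_zero (ν : Measure X) :
    (pathLaw P ν).map (fun ω : ℕ → X => ω 0) = ν := by
  ext s hs
  rw [Measure.map_apply (by fun_prop) hs, pathLaw_apply P ν (hs.preimage (by fun_prop))]
  have : ∀ x, pathLawFrom P x ((fun ω : ℕ → X => ω 0) ⁻¹' s) = s.indicator 1 x := by
    intro x
    rw [← Measure.map_apply (by fun_prop) hs, pathLawFrom_map_zero, Measure.dirac_apply' _ hs]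
  simp_rw [this]
  rw [lintegral_indicator_one hs]

lemma ae_pathLawFrom_zero (x : X) : ∀ᵐ ω ∂(pathLawFrom P x), ω 0 = x := by
  have h : ∀ᵐ y ∂((pathLawFrom P x).map (fun ω : ℕ → X => ω 0)), y = x := by
    rw [pathLawFrom_map_zero]
    exact (ae_dirac_iff (measurableSet_singleton x)).2 rfl
  exact ae_of_ae_map (measurable_pi_apply 0).aemeasurable h

lemma pathLaw_compProd (ν : Measure X) [IsProbabilityMeasure ν] (n : ℕ) :
    ((pathLaw P ν).map (Preorder.frestrictLe (π := fun _ : ℕ => X) n)) ⊗ₘ (stepKernel P n) =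
      (pathLaw P ν).map
        (fun ω => (Preorder.frestrictLe (π := fun _ : ℕ => X) n ω, ω (n + 1))) :=
  Kernel.map_frestrictLe_trajMeasure_compProd_eq_map_trajMeasure

/-- The time shift on paths. -/
def shift (ω : ℕ → X) : ℕ → X := fun n => ω (n + 1)

@[fun_prop]
lemma measurable_shift : Measurable (shift (X := X)) := by
  unfold shift; fun_prop

@[simp] lemma shift_apply (ω : ℕ → X) (n : ℕ) : shift ω n = ω (n + 1) := rfl

lemma compProd_comap_map {A B C : Type*} [MeasurableSpace A] [MeasurableSpace B]
    [MeasurableSpace C] (m : Measure A) [SFinite m] (κ : Kernel B C) [IsMarkovKernel κ] {T : A → B}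
    (hT : Measurable T) :
    (m ⊗ₘ (κ.comap T hT)).map (Prod.map T id) = (m.map T) ⊗ₘ κ := by
  ext s hs
  rw [Measure.map_apply (by fun_prop) hs, Measure.compProd_apply (hs.preimage (by fun_prop)),
    Measure.compProd_apply hs, lintegral_map (Kernel.measurable_kernel_prodMk_left hs) hT]
  rfl

/-- Every finite set of times lies in an initial segment, so the initial segments determine all
finite-dimensional laws, and projective limits are unique. -/
lemma measure_path_ext {μ₁ μ₂ : Measure (ℕ → X)} [IsFiniteMeasure μ₁] [IsFiniteMeasure μ₂]
    (h : ∀ n, μ₁.map (Preorder.frestrictLe (π := fun _ : ℕ => X) n) =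
      μ₂.map (Preorder.frestrictLe (π := fun _ : ℕ => X) n)) : μ₁ = μ₂ := by
  have h2 : IsProjectiveLimit μ₂ (fun I : Finset ℕ => μ₂.map I.restrict) := fun I => rfl
  have h1 : IsProjectiveLimit μ₁ (fun I : Finset ℕ => μ₂.map I.restrict) := by
    intro I
    have hI := I.subset_Iic_sup_id
    have hr := Finset.measurable_restrict₂ (X := fun _ : ℕ => X) hI
    have hr' := Finset.measurable_restrict (X := fun _ : ℕ => X) (Finset.Iic (I.sup id))
    change μ₁.map I.restrict = μ₂.map I.restrict
    rw [← Finset.restrict₂_comp_restrict hI, ← Measure.map_map hr hr', ← Measure.map_map hr hr']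
    exact congrArg _ (h _)
  exact h1.unique h2

/-- Gluing a path up to time `n` with a state at time `n + 1`. -/
def glue (n : ℕ) (p : ((Finset.Iic n) → X) × X) : (Finset.Iic (n + 1)) → X :=
  fun i => if h : (i : ℕ) ≤ n then p.1 ⟨i, Finset.mem_Iic.2 h⟩ else p.2

lemma measurable_glue (n : ℕ) : Measurable (glue (X := X) n) := by
  refine measurable_pi_lambda _ fun i => ?_
  unfold glue
  split_ifs <;> fun_prop

lemma glue_frestrictLe (n : ℕ) (ω : ℕ → X) :
    glue n (Preorder.frestrictLe (π := fun _ : ℕ => X) n ω, ω (n + 1)) =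
      Preorder.frestrictLe (π := fun _ : ℕ => X) (n + 1) ω := by
  funext i
  have hi := Finset.mem_Iic.1 i.2
  unfold glue
  split_ifs with h
  · rfl
  · have : (i : ℕ) = n + 1 := by omega
    simp [Preorder.frestrictLe_apply, this]

/-- The Markov property at time one. -/
lemma pathLaw_map_shift (ν : Measure X) [IsProbabilityMeasure ν] :
    (pathLaw P ν).map shift = pathLaw P (ν.bind P) := by
  have : IsProbabilityMeasure ((pathLaw P ν).map shift) :=
    Measure.isProbabilityMeasure_map (by fun_prop)
  have hglue : ∀ (μ : Measure (ℕ → X)) (n : ℕ),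
      μ.map (Preorder.frestrictLe (π := fun _ : ℕ => X) (n + 1)) =
        (μ.map (fun ω => (Preorder.frestrictLe (π := fun _ : ℕ => X) n ω, ω (n + 1)))).map
          (glue n) := by
    intro μ n
    rw [Measure.map_map (measurable_glue n) (by fun_prop)]
    congr 1
    funext ω
    exact (glue_frestrictLe n ω).symm
  refine measure_path_ext fun n => ?_
  induction n with
  | zero =>
    have h0 : (Preorder.frestrictLe (π := fun _ : ℕ => X) 0) =
        (fun (y : X) (_ : Finset.Iic 0) => y) ∘ (fun ω : ℕ → X => ω 0) := by
      funext ω i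
      have : (i : ℕ) = 0 := by simpa using Finset.mem_Iic.1 i.2
      simp [Preorder.frestrictLe_apply, this]
    rw [h0, ← Measure.map_map (by fun_prop) (by fun_prop), ← Measure.map_map (by fun_prop)
      (by fun_prop), pathLaw_map_zero]
    refine congrArg _ ?_
    rw [Measure.map_map (by fun_prop) (by fun_prop)]
    have h1 := pathLaw_compProd P ν 0
    have h2 : ((fun ω : ℕ → X => ω 0) ∘ shift) = Prod.snd ∘
        (fun ω : ℕ → X => (Preorder.frestrictLe (π := fun _ : ℕ => X) 0 ω, ω (0 + 1))) := rfl
    rw [h2, ← Measure.map_map (by fun_prop) (by fun_prop), ← h1]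
    have h3 : Measure.map Prod.snd
        ((pathLaw P ν).map (Preorder.frestrictLe (π := fun _ : ℕ => X) 0) ⊗ₘ stepKernel P 0) =
        Measure.snd (Measure.map (Prod.map (fun h : (Finset.Iic 0) → X =>
          h ⟨0, Finset.mem_Iic.2 le_rfl⟩) id)
        ((pathLaw P ν).map (Preorder.frestrictLe (π := fun _ : ℕ => X) 0) ⊗ₘ stepKernel P 0)) := by
      rw [Measure.snd, Measure.map_map (by fun_prop) (by fun_prop)]
      rfl
    rw [h3, compProd_comap_map, Measure.map_map (by fun_prop) (by fun_prop), Measure.snd_compProd]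
    congr 1
    exact pathLaw_map_zero P ν
  | succ n ih =>
    rw [hglue, hglue]
    congr 1
    rw [← pathLaw_compProd P (ν.bind P) n, ← ih]
    have h1 := pathLaw_compProd P ν (n + 1)
    -- `T` forgets time `0` and renumbers. The transition depends on the last state only, so it
    -- factors through `T`; this is where time-homogeneity and the Markov property enter.
    let T : ((Finset.Iic (n + 1)) → X) → ((Finset.Iic n) → X) :=
      fun h i => h ⟨i + 1, Finset.mem_Iic.2 (Nat.succ_le_succ (Finset.mem_Iic.1 i.2))⟩
    have hT : Measurable T := by
      refine measurable_pi_lambda _ fun i => ?_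
      exact measurable_pi_apply _
    have hk : stepKernel P (n + 1) = (stepKernel P n).comap T hT := rfl
    have h2 : (fun ω : ℕ → X => (Preorder.frestrictLe (π := fun _ : ℕ => X) n ω, ω (n + 1))) ∘
        shift = Prod.map T id ∘
        (fun ω : ℕ → X => (Preorder.frestrictLe (π := fun _ : ℕ => X) (n + 1) ω,
          ω (n + 1 + 1))) := rfl
    rw [Measure.map_map (by fun_prop) (by fun_prop), h2,
      ← Measure.map_map (by fun_prop) (by fun_prop), ← h1, hk, compProd_comap_map,
      Measure.map_map (by fun_prop) (by fun_prop), Measure.map_map (by fun_prop) (by fun_prop)]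
    rfl

lemma pathLawFrom_shift_preimage (x : X) {s : Set (ℕ → X)} (hs : MeasurableSet s) :
    pathLawFrom P x (shift ⁻¹' s) = ∫⁻ z, pathLawFrom P z s ∂(P x) := by
  rw [← Measure.map_apply (by fun_prop) hs, pathLawFrom, pathLaw_map_shift,
    Measure.dirac_bind (Kernel.measurable P), pathLaw_apply P _ hs]

/-- An event which is null for every starting point is null after any deterministic time shift. -/
lemma ae_shift_iterate_notMem (ν : Measure X) [IsProbabilityMeasure ν] {s : Set (ℕ → X)}
    (hs : MeasurableSet s) (h : ∀ x, pathLawFrom P x s = 0) :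
    ∀ᵐ ω ∂(pathLaw P ν), ∀ N, shift^[N] ω ∉ s := by
  rw [ae_all_iff]
  intro N
  induction N generalizing ν with
  | zero =>
    rw [ae_iff]
    simp [pathLaw_apply P ν hs, h]
  | succ N ih =>
    have := ih (ν.bind P)
    rw [← pathLaw_map_shift] at this
    have := ae_of_ae_map (by fun_prop) this
    filter_upwards [this] with ω hω
    simpa [Function.iterate_succ] using hω

lemma shift_iterate_apply (ω : ℕ → X) (N n : ℕ) : shift^[N] ω n = ω (n + N) := by
  induction N generalizing ω with
  | zero => rfl
  | succ N ih => rw [Function.iterate_succ_apply, ih, shift_apply]; congr 1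

end PathLaw


/-! ### First-step analysis: maximal inequality, recurrence, passage times -/

section Criteria

variable {X : Set ℝ} (P : Kernel X X) [IsMarkovKernel P]

/-- Paths that visit `H` by time `n`, and stay in `C` before doing so. -/
def reach (C H : Set X) (n : ℕ) : Set (ℕ → X) :=
  {ω | ∃ k ≤ n, (∀ j < k, ω j ∈ C) ∧ ω k ∈ H}

variable {P}

lemma measurableSet_reach {C H : Set X} (hC : MeasurableSet C) (hH : MeasurableSet H) (n : ℕ) :
    MeasurableSet (reach C H n) := by
  have : reach C H n = ⋃ k ∈ Set.Iic n, ((⋂ j ∈ Set.Iio k, (fun ω : ℕ → X => ω j) ⁻¹' C) ∩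
      (fun ω : ℕ → X => ω k) ⁻¹' H) := by
    ext ω; simp [reach]; grind
  rw [this]
  refine MeasurableSet.biUnion (Set.to_countable _) fun k _ => MeasurableSet.inter ?_ ?_
  · exact MeasurableSet.biInter (Set.to_countable _) fun j _ => hC.preimage (measurable_pi_apply j)
  · exact hH.preimage (measurable_pi_apply k)

lemma reach_mono {C H : Set X} : Monotone (reach C H) :=
  fun _ _ hmn _ ⟨k, hk, h⟩ => ⟨k, hk.trans hmn, h⟩

/-- Induction on the horizon by conditioning on the first step. The error `κ` per step is what
allows functions that are only nearly superharmonic, as needed for lower bounds on passage times; `κ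
= 0` is the maximal inequality. -/
lemma pathLawFrom_reach_le {C H : Set X} (hC : MeasurableSet C) (hH : MeasurableSet H)
    {V : X → ℝ≥0∞} {κ : ℝ≥0∞} (hV : ∀ x ∈ C, ∫⁻ z, V z ∂(P x) ≤ V x + κ)
    (hVH : ∀ x ∈ H, 1 ≤ V x) (n : ℕ) (x : X) :
    pathLawFrom P x (reach C H n) ≤ V x + n * κ := by
  induction n generalizing x with
  | zero =>
    by_cases hx : x ∈ H
    · exact prob_le_one.trans ((hVH x hx).trans le_self_add)
    · have : pathLawFrom P x (reach C H 0) = 0 := by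
        rw [← nonpos_iff_eq_zero]
        refine (measure_mono_ae ?_).trans (measure_empty (μ := pathLawFrom P x)).le
        filter_upwards [ae_pathLawFrom_zero P x] with ω hω hr
        obtain ⟨k, hk, -, h⟩ := hr
        obtain rfl : k = 0 := by omega
        exact hx (hω ▸ h)
      simp [this]
  | succ n ih =>
    by_cases hx : x ∈ H
    · exact prob_le_one.trans ((hVH x hx).trans le_self_add)
    by_cases hxC : x ∈ C
    · calc pathLawFrom P x (reach C H (n + 1))
          ≤ pathLawFrom P x (shift ⁻¹' (reach C H n)) := by
            refine measure_mono_ae ?_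
            filter_upwards [ae_pathLawFrom_zero P x] with ω hω hr
            obtain ⟨k, hk, h1, h2⟩ := hr
            rcases k with _ | k
            · exact absurd (hω ▸ h2) hx
            · exact ⟨k, by omega, fun j hj => h1 (j + 1) (by omega), h2⟩
        _ = ∫⁻ z, pathLawFrom P z (reach C H n) ∂(P x) :=
            pathLawFrom_shift_preimage P x (measurableSet_reach hC hH n)
        _ ≤ ∫⁻ z, (V z + n * κ) ∂(P x) := lintegral_mono fun z => ih z
        _ = ∫⁻ z, V z ∂(P x) + n * κ := by
            rw [lintegral_add_right _ measurable_const]; simp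
        _ ≤ V x + κ + n * κ := by gcongr; exact hV x hxC
        _ = V x + (n + 1 : ℕ) * κ := by push_cast; ring
    · have : pathLawFrom P x (reach C H (n + 1)) = 0 := by
        rw [← nonpos_iff_eq_zero]
        refine (measure_mono_ae ?_).trans (measure_empty (μ := pathLawFrom P x)).le
        filter_upwards [ae_pathLawFrom_zero P x] with ω hω hr
        obtain ⟨k, hk, h1, h2⟩ := hr
        rcases k with _ | k
        · exact hx (hω ▸ h2)
        · exact hxC (hω ▸ h1 0 (by omega))
      simp [this]

/-- Maximal inequality for functions that are superharmonic on `C`. -/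
lemma pathLawFrom_iUnion_reach_le {C H : Set X} (hC : MeasurableSet C) (hH : MeasurableSet H)
    {V : X → ℝ≥0∞} (hV : ∀ x ∈ C, ∫⁻ z, V z ∂(P x) ≤ V x)
    (hVH : ∀ x ∈ H, 1 ≤ V x) (x : X) :
    pathLawFrom P x (⋃ n, reach C H n) ≤ V x := by
  rw [(reach_mono (C := C) (H := H)).measure_iUnion]
  refine iSup_le fun n => ?_
  simpa using pathLawFrom_reach_le (κ := 0) hC hH (by simpa using hV) hVH n x

/-- The event that the path stays in `C` while `V` is unbounded along it. -/
def escape (C : Set X) (V : X → ℝ≥0∞) : Set (ℕ → X) :=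
  {ω | (∀ n, ω n ∈ C) ∧ ∀ K : ℕ, ∃ n, (K : ℝ≥0∞) ≤ V (ω n)}

lemma measurableSet_escape {C : Set X} (hC : MeasurableSet C) {V : X → ℝ≥0∞} (hV : Measurable V) :
    MeasurableSet (escape C V) := by
  have : escape C V = (⋂ n, (fun ω : ℕ → X => ω n) ⁻¹' C) ∩
      ⋂ K : ℕ, ⋃ n, (fun ω : ℕ → X => V (ω n)) ⁻¹' Set.Ici (K : ℝ≥0∞) := by
    ext ω; simp [escape]
  rw [this]
  refine (MeasurableSet.iInter fun n => hC.preimage (measurable_pi_apply n)).inter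
    (MeasurableSet.iInter fun K => MeasurableSet.iUnion fun n =>
      measurableSet_Ici.preimage (hV.comp (measurable_pi_apply n)))

/-- By the maximal inequality for `V / K`, the level `K` is reached inside `C` with probability at
most `V x / K`; let `K → ∞`. This replaces convergence of nonnegative supermartingales. -/
lemma pathLawFrom_escape {C : Set X} (hC : MeasurableSet C) {V : X → ℝ≥0∞} (hVm : Measurable V)
    (hV : ∀ x ∈ C, ∫⁻ z, V z ∂(P x) ≤ V x) {x : X} (hx : V x ≠ ∞) :
    pathLawFrom P x (escape C V) = 0 := by
  have key : ∀ K : ℕ, 0 < K → pathLawFrom P x (escape C V) ≤ (K : ℝ≥0∞)⁻¹ * V x := by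
    intro K hK
    have hK0 : (K : ℝ≥0∞) ≠ 0 := by simpa using hK.ne'
    have hH : MeasurableSet {z : X | (K : ℝ≥0∞) ≤ V z} := measurableSet_le measurable_const hVm
    refine le_trans (measure_mono ?_) (pathLawFrom_iUnion_reach_le (P := P) hC hH
      (V := fun z => (K : ℝ≥0∞)⁻¹ * V z) ?_ ?_ x)
    · rintro ω ⟨h1, h2⟩
      obtain ⟨n, hn⟩ := h2 K
      exact Set.mem_iUnion.2 ⟨n, n, le_rfl, fun j _ => h1 j, hn⟩
    · intro z hz
      rw [lintegral_const_mul _ hVm]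
      gcongr
      exact hV z hz
    · intro z hz
      have hz : (K : ℝ≥0∞) ≤ V z := hz
      calc (1 : ℝ≥0∞) = (K : ℝ≥0∞)⁻¹ * K := (ENNReal.inv_mul_cancel hK0 (by simp)).symm
        _ ≤ _ := by gcongr
  have ht : Tendsto (fun K : ℕ => (K : ℝ≥0∞)⁻¹ * V x) atTop (𝓝 (0 * V x)) :=
    ENNReal.Tendsto.mul_const ENNReal.tendsto_inv_nat_nhds_zero (Or.inr hx)
  rw [zero_mul] at ht
  rw [← nonpos_iff_eq_zero]
  refine ge_of_tendsto ht ?_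
  filter_upwards [eventually_gt_atTop 0] with K hK using key K hK

variable {I : Set (ProbabilityMeasure X)}

lemma NonConfined.frequently (hN : NonConfined P I) {ν : ProbabilityMeasure X} (hν : ν ∈ I) :
    ∀ᵐ ω ∂(pathLaw P (ν : Measure X)), ∀ K : ℝ, ∃ᶠ n in atTop, K < |(ω n : ℝ)| := by
  filter_upwards [hN ν hν] with ω hω K
  have : (K : EReal) < limsup (fun n => ((|(ω n : ℝ)| : ℝ) : EReal)) atTop := by
    rw [hω]; exact EReal.coe_lt_top K
  exact (frequently_lt_of_lt_limsup (by isBoundedDefault) this).mono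
    fun n hn => EReal.coe_lt_coe_iff.1 hn

lemma measurableSet_abs_gt (a : ℝ) : MeasurableSet {x : X | a < |(x : ℝ)|} :=
  measurableSet_lt measurable_const (measurable_subtype_coe.abs)

/-- If `liminf |ξ|` exceeded `a`, then after some deterministic time the path would stay beyond `a`,
while non-confinement makes `V` unbounded along it. That is the event `escape`, which is null from
every starting point. -/
lemma recurrent_of_superharmonic (hN : NonConfined P I) {V : X → ℝ≥0∞} (hVm : Measurable V)
    (hfin : ∀ x, V x ≠ ∞) {a : ℝ} (ha : 0 ≤ a)
    (hV : ∀ x : X, a < |(x : ℝ)| → ∫⁻ z, V z ∂(P x) ≤ V x)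
    (hinf : ∀ K : ℕ, ∃ R : ℝ, ∀ x : X, R < |(x : ℝ)| → (K : ℝ≥0∞) ≤ V x) :
    Recurrent P I := by
  refine ⟨a, ha, fun ν hν => ?_⟩
  have hC : MeasurableSet {x : X | a < |(x : ℝ)|} := measurableSet_abs_gt a
  filter_upwards [hN.frequently hν, ae_shift_iterate_notMem P (ν : Measure X)
    (measurableSet_escape hC hVm) fun x => pathLawFrom_escape (P := P) hC hVm hV (hfin x)]
    with ω h1 h2
  by_contra! hlim
  have h3 : ∀ᶠ n in atTop, a < |(ω n : ℝ)| :=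
    (eventually_lt_of_lt_liminf hlim).mono fun n hn => EReal.coe_lt_coe_iff.1 hn
  obtain ⟨N, hN'⟩ := eventually_atTop.1 h3
  refine h2 N ⟨fun n => ?_, fun K => ?_⟩
  · rw [shift_iterate_apply]
    exact hN' _ (by omega)
  · obtain ⟨R, hR⟩ := hinf K
    obtain ⟨n, hn, hn'⟩ := (frequently_atTop.1 (h1 R)) N
    refine ⟨n - N, ?_⟩
    rw [shift_iterate_apply, Nat.sub_add_cancel hn]
    exact hR _ hn'

/-- Paths which avoid `[-a, a]` up to time `n`. -/
def survive (a : ℝ) (n : ℕ) : Set (ℕ → X) := {ω | ∀ j ≤ n, a < |(ω j : ℝ)|}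

lemma measurableSet_survive (a : ℝ) (n : ℕ) : MeasurableSet (survive (X := X) a n) := by
  have : survive (X := X) a n =
      ⋂ j ∈ Set.Iic n, (fun ω : ℕ → X => ω j) ⁻¹' {x : X | a < |(x : ℝ)|} := by
    ext ω; simp [survive]
  rw [this]
  exact MeasurableSet.biInter (Set.to_countable _) fun j _ =>
    (measurableSet_abs_gt a).preimage (measurable_pi_apply j)

lemma passageTime_eq_tsum (a : ℝ) (ω : ℕ → X) :
    passageTime a ω = ∑' n, (survive a n).indicator 1 ω := by
  classical
  by_cases h : ∃ n, |(ω n : ℝ)| ≤ a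
  · have hs : ∀ n, ω ∈ survive a n ↔ n < Nat.find h := by
      intro n
      constructor
      · intro hn
        by_contra! hle
        exact absurd (Nat.find_spec h) (not_le.2 (hn _ hle))
      · intro hn j hj
        exact not_le.1 (Nat.find_min h (lt_of_le_of_lt hj hn))
    have h1 : passageTime a ω = Nat.find h := by
      refine le_antisymm (iInf₂_le (Nat.find h) (Nat.find_spec h)) (le_iInf₂ fun n hn => ?_)
      exact_mod_cast Nat.find_min' h hn
    rw [h1, tsum_eq_sum (s := Finset.range (Nat.find h))]
    · rw [Finset.sum_congr rfl (g := fun _ => (1 : ℝ≥0∞))]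
      · simp
      · intro n hn
        rw [Set.indicator_of_mem ((hs n).2 (Finset.mem_range.1 hn))]; rfl
    · intro n hn
      rw [Set.indicator_of_notMem]
      rw [hs]; simpa using hn
  · push Not at h
    have h1 : passageTime a ω = ∞ := by
      refine iInf₂_eq_top.2 fun n hn => ?_
      exact absurd hn (not_le.2 (h n))
    have h2 : ∀ n, (survive a n).indicator (1 : (ℕ → X) → ℝ≥0∞) ω = 1 := by
      intro n
      rw [Set.indicator_of_mem]
      · rfl
      · exact fun j _ => h j
    simp_rw [h1, h2]
    rw [ENNReal.tsum_const_eq_top_of_ne_zero one_ne_zero]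

lemma meanPassageTime_eq_tsum (a : ℝ) (x : X) :
    meanPassageTime P a x = ∑' n, pathLawFrom P x (survive a n) := by
  unfold meanPassageTime
  simp_rw [passageTime_eq_tsum]
  rw [lintegral_tsum fun n =>
    (measurable_one.indicator (measurableSet_survive a n)).aemeasurable]
  congr 1; funext n
  rw [lintegral_indicator_one (measurableSet_survive a n)]

lemma pathLawFrom_survive_of_abs_le {a : ℝ} {x : X} (hx : |(x : ℝ)| ≤ a) (n : ℕ) :
    pathLawFrom P x (survive a n) = 0 := by
  rw [← nonpos_iff_eq_zero]
  refine (measure_mono_ae ?_).trans (measure_empty (μ := pathLawFrom P x)).le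
  filter_upwards [ae_pathLawFrom_zero P x] with ω hω hr
  have := hr 0 (by omega)
  rw [hω] at this
  exact absurd hx (not_le.2 this)

lemma pathLawFrom_survive_succ {a : ℝ} {x : X} (hx : a < |(x : ℝ)|) (n : ℕ) :
    pathLawFrom P x (survive a (n + 1)) = ∫⁻ z, pathLawFrom P z (survive a n) ∂(P x) := by
  rw [← pathLawFrom_shift_preimage P x (measurableSet_survive a n)]
  refine measure_congr ?_
  filter_upwards [ae_pathLawFrom_zero P x] with ω hω
  refine propext ⟨fun h j hj => h (j + 1) (by omega), fun h j hj => ?_⟩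
  rcases j with _ | j
  · rw [hω]; exact hx
  · exact h j (by omega)

/-- Foster's criterion. The partial sums of `∑ ℙ[τ > n]` are bounded by `V` by induction on the
first step, so no stopped process and no integrability question arise. -/
lemma meanPassageTime_le {a : ℝ} {V : X → ℝ≥0∞}
    (hV : ∀ x : X, a < |(x : ℝ)| → ∫⁻ z, V z ∂(P x) + 1 ≤ V x) (x : X) :
    meanPassageTime P a x ≤ V x := by
  have key : ∀ (N : ℕ) (x : X), ∑ n ∈ Finset.range N, pathLawFrom P x (survive a n) ≤ V x := by
    intro N
    induction N with
    | zero => simp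
    | succ N ih =>
      intro x
      by_cases hx : |(x : ℝ)| ≤ a
      · rw [Finset.sum_eq_zero fun n _ => pathLawFrom_survive_of_abs_le hx n]
        exact zero_le
      · rw [Finset.sum_range_succ']
        simp_rw [pathLawFrom_survive_succ (not_le.1 hx)]
        rw [← lintegral_finsetSum _ fun n _ =>
          measurable_pathLawFrom P (measurableSet_survive a n)]
        refine le_trans ?_ (hV x (not_le.1 hx))
        gcongr with z
        · exact ih z
        · exact prob_le_one
  rw [meanPassageTime_eq_tsum, ENNReal.tsum_eq_iSup_nat]
  exact iSup_le fun N => key N x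

lemma survive_eq_compl_reach (a : ℝ) (n : ℕ) :
    survive (X := X) a n = (reach Set.univ {x : X | |(x : ℝ)| ≤ a} n)ᶜ := by
  ext ω; simp [survive, reach]

/-- Before its first entrance into `[-a, a]` the path stays in `C`, so `pathLawFrom_reach_le` bounds
the probability of an entrance by time `n` by `V x + n κ`. -/
lemma half_le_pathLawFrom_survive {a : ℝ} {C : Set X} (hCm : MeasurableSet C)
    (hC : ∀ x : X, x ∉ C → |(x : ℝ)| ≤ a)
    {V : X → ℝ≥0∞} {κ : ℝ≥0∞} (hV : ∀ x ∈ C, ∫⁻ z, V z ∂(P x) ≤ V x + κ)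
    (hVH : ∀ x : X, |(x : ℝ)| ≤ a → 1 ≤ V x) {n : ℕ} {x : X} (hx : V x + n * κ ≤ 1 / 2) :
    1 / 2 ≤ pathLawFrom P x (survive a n) := by
  have hH : MeasurableSet {x : X | |(x : ℝ)| ≤ a} :=
    measurableSet_le (measurable_subtype_coe.abs) measurable_const
  have h1 := (pathLawFrom_reach_le (P := P) hCm hH hV hVH n x).trans hx
  have hsub : reach Set.univ {x : X | |(x : ℝ)| ≤ a} n ⊆ reach C {x : X | |(x : ℝ)| ≤ a} n := by
    classical
    rintro ω ⟨k, hk, -, h⟩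
    have hex : ∃ k, |(ω k : ℝ)| ≤ a := ⟨k, h⟩
    refine ⟨Nat.find hex, (Nat.find_min' hex h).trans hk, fun j hj => ?_, Nat.find_spec hex⟩
    by_contra hj'
    exact Nat.find_min hex hj (hC _ hj')
  rw [survive_eq_compl_reach, prob_compl_eq_one_sub (measurableSet_reach MeasurableSet.univ hH n)]
  have h2 := (measure_mono hsub).trans h1
  calc (1 / 2 : ℝ≥0∞) = 1 - 1 / 2 := by simp
    _ ≤ _ := tsub_le_tsub_left h2 1

/-- An event stable under the shift, which is unlikely for starting points of large modulus, does
not occur along a non-confined chain. -/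
lemma ae_notMem_of_unlikely (hN : NonConfined P I) {F : Set (ℕ → X)} (hF : MeasurableSet F)
    (hFs : ∀ ω ∈ F, shift ω ∈ F)
    (hsmall : ∀ ε : ℝ≥0∞, 0 < ε → ∃ R : ℝ, ∀ x : X, R < |(x : ℝ)| → pathLawFrom P x F ≤ ε) :
    AlmostSurely P I (fun ω => ω ∉ F) := by
  intro ν hν
  have key : ∀ ε : ℝ≥0∞, 0 < ε → pathLaw P (ν : Measure X) F ≤ ε := by
    intro ε hε
    obtain ⟨R, hR⟩ := hsmall ε hε
    let H : Set X := {x : X | R < |(x : ℝ)|}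
    have hH : MeasurableSet H := measurableSet_abs_gt R
    have hmeas : ∀ n, MeasurableSet (F ∩ reach Set.univ H n) := fun n =>
      hF.inter (measurableSet_reach MeasurableSet.univ hH n)
    -- At the first visit to `H` the bound `hR` applies; before it, stability of `F` under the shift
    -- carries the event one step further. Non-confinement then makes a visit to `H` almost sure.
    have hstep : ∀ (n : ℕ) (x : X), pathLawFrom P x (F ∩ reach Set.univ H n) ≤ ε := by
      intro n
      induction n with
      | zero =>
        intro x
        by_cases hx : x ∈ H
        · exact (measure_mono Set.inter_subset_left).trans (hR x hx)
        · refine le_trans (measure_mono_ae ?_)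
            ((measure_empty (μ := pathLawFrom P x)).le.trans zero_le)
          filter_upwards [ae_pathLawFrom_zero P x] with ω hω hr
          obtain ⟨-, k, hk, -, h⟩ := hr
          obtain rfl : k = 0 := by omega
          exact hx (hω ▸ h)
      | succ n ih =>
        intro x
        by_cases hx : x ∈ H
        · exact (measure_mono Set.inter_subset_left).trans (hR x hx)
        · calc pathLawFrom P x (F ∩ reach Set.univ H (n + 1))
              ≤ pathLawFrom P x (shift ⁻¹' (F ∩ reach Set.univ H n)) := by
                refine measure_mono_ae ?_
                filter_upwards [ae_pathLawFrom_zero P x] with ω hω hr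
                obtain ⟨hωF, k, hk, -, h⟩ := hr
                rcases k with _ | k
                · exact absurd (hω ▸ h) hx
                · exact ⟨hFs ω hωF, k, by omega, fun _ _ => trivial, h⟩
            _ = ∫⁻ z, pathLawFrom P z (F ∩ reach Set.univ H n) ∂(P x) :=
                pathLawFrom_shift_preimage P x (hmeas n)
            _ ≤ ∫⁻ _, ε ∂(P x) := lintegral_mono fun z => ih z
            _ = ε := by simp
    have hν' : ∀ n, pathLaw P (ν : Measure X) (F ∩ reach Set.univ H n) ≤ ε := by
      intro n
      rw [pathLaw_apply P _ (hmeas n)]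
      calc _ ≤ ∫⁻ _, ε ∂(ν : Measure X) := lintegral_mono fun z => hstep n z
        _ = ε := by simp
    have hmono : Monotone fun n => F ∩ reach Set.univ H n := fun m n hmn =>
      Set.inter_subset_inter_right _ (reach_mono hmn)
    calc pathLaw P (ν : Measure X) F
        ≤ pathLaw P (ν : Measure X) (⋃ n, F ∩ reach Set.univ H n) := by
          refine measure_mono_ae ?_
          filter_upwards [hN.frequently hν] with ω hω hωF
          obtain ⟨n, hn⟩ := (hω R).exists
          exact Set.mem_iUnion.2 ⟨n, hωF, n, le_rfl, fun _ _ => trivial, hn⟩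
      _ ≤ ε := by
          rw [hmono.measure_iUnion]
          exact iSup_le hν'
  have h0 : pathLaw P (ν : Measure X) F = 0 := by
    by_contra hne
    obtain ⟨ε, hε, hlt⟩ := ENNReal.lt_iff_exists_nnreal_btwn.1 (pos_iff_ne_zero.2 hne)
    exact absurd (key ε hε) (not_le.2 hlt)
  exact measure_eq_zero_iff_ae_notMem.1 h0

end Criteria


/-! ### Lyapunov criteria for each type of behaviour -/

section Classification

variable {X : Set ℝ} {P : Kernel X X} [IsMarkovKernel P] {I : Set (ProbabilityMeasure X)}

lemma positiveRecurrent_of_lyapunov (hN : NonConfined P I) {V : X → ℝ≥0∞} (hVm : Measurable V)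
    (hfin : ∀ x, V x ≠ ∞) {R₀ : ℝ}
    (hV : ∀ x : X, R₀ < |(x : ℝ)| → ∫⁻ z, V z ∂(P x) + 1 ≤ V x)
    (hinf : ∀ K : ℕ, ∃ R : ℝ, ∀ x : X, R < |(x : ℝ)| → (K : ℝ≥0∞) ≤ V x) :
    PositiveRecurrent P I := by
  refine ⟨recurrent_of_superharmonic hN hVm hfin (le_max_left 0 R₀) (fun x hx => ?_) hinf, ?_⟩
  · exact le_self_add.trans (hV x ((le_max_right _ _).trans_lt hx))
  · filter_upwards [eventually_ge_atTop R₀] with a ha x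
    exact (meanPassageTime_le (fun x hx => hV x (ha.trans_lt hx)) x).trans_lt (hfin x).lt_top

/-- One long jump suffices: a jump beyond `3 Y` has probability of order `Y^(-β)`, and from there
the slow growth `C Y^(-β)` of the bump keeps the chain away for `n ~ Y^β` steps with probability at
least `1/2`. Hence `ℙ[τ > n]` is at least a multiple of `1/n`. -/
lemma meanPassageTime_eq_top {β C R₀ : ℝ} (hβ : 0 < β) (hC : 0 < C)
    (hφ : ∀ x : X, R₀ < |(x : ℝ)| → ∀ Y : ℝ, 1 ≤ Y → Y ≤ |(x : ℝ)| →
      ∫⁻ z : X, ENNReal.ofReal (1 / (1 + ((z : ℝ) / Y) ^ 2)) ∂(P x) ≤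
        ENNReal.ofReal (1 / (1 + ((x : ℝ) / Y) ^ 2) + C * Y ^ (-β)))
    {x : X} {a : ℝ} (ha : R₀ ≤ a) (hxa : a < |(x : ℝ)|)
    {c' : ℝ} (hc' : 0 < c')
    (hjump : ∀ᶠ Y : ℝ in atTop, c' * Y ^ (-β) ≤ (P x).real {z : X | Y ≤ |(z : ℝ)|}) :
    meanPassageTime P a x = ∞ := by
  have hD : 0 < 7 * C := by positivity
  -- Twice the bump is at least `1` on `[-Y, Y]` and at most `1/5` beyond `3 Y`. With this `Y` the
  -- accumulated error is `2 n C Y^(-β) = 2/7`, and `1/5 + 2/7 < 1/2`.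
  let Y : ℕ → ℝ := fun n => (7 * C * n) ^ (1 / β)
  have hYt : Tendsto Y atTop atTop :=
    (tendsto_rpow_atTop (by positivity)).comp
      (Tendsto.const_mul_atTop hD tendsto_natCast_atTop_atTop)
  have hYpow : ∀ n : ℕ, (Y n) ^ (-β) = (7 * C * n)⁻¹ := by
    intro n
    have : (0 : ℝ) ≤ 7 * C * n := by positivity
    rw [← Real.rpow_mul this, show 1 / β * -β = -1 by field_simp, Real.rpow_neg_one]
  have hsurv : ∀ᶠ n : ℕ in atTop, ∀ z : X, 3 * Y n ≤ |(z : ℝ)| →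
      1 / 2 ≤ pathLawFrom P z (survive a n) := by
    filter_upwards [hYt.eventually_ge_atTop (max 1 a), eventually_gt_atTop 0] with n hn hn0 z hz
    have hY1 : 1 ≤ Y n := (le_max_left _ _).trans hn
    have hYa : a ≤ Y n := (le_max_right _ _).trans hn
    have hY0 : 0 < Y n := by linarith
    have hn0' : (0 : ℝ) < n := by exact_mod_cast hn0
    have hsub : survive (X := X) (Y n) n ⊆ survive a n := fun ω hω j hj => hYa.trans_lt (hω j hj)
    refine le_trans ?_ (measure_mono hsub)
    refine half_le_pathLawFrom_survive (C := {x : X | Y n < |(x : ℝ)|})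
      (V := fun z : X => ENNReal.ofReal (2 * (1 / (1 + ((z : ℝ) / Y n) ^ 2))))
      (κ := ENNReal.ofReal (2 * (C * (Y n) ^ (-β)))) (measurableSet_abs_gt _)
      (fun x hx => not_lt.1 hx) ?_ ?_ ?_
    · intro x hx
      have hx : Y n < |(x : ℝ)| := hx
      rw [← ENNReal.ofReal_add (by positivity) (by positivity), ← mul_add,
        ENNReal.ofReal_mul (by norm_num)]
      simp_rw [ENNReal.ofReal_mul (show (0 : ℝ) ≤ 2 by norm_num)]
      rw [lintegral_const_mul _ (by fun_prop)]
      gcongr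
      exact hφ x (ha.trans_lt (hYa.trans_lt hx)) _ hY1 hx.le
    · intro x hx
      rw [← ENNReal.ofReal_one]
      refine ENNReal.ofReal_le_ofReal ?_
      have : ((x : ℝ) / Y n) ^ 2 ≤ 1 := by
        rw [div_pow, div_le_one (by positivity)]
        exact sq_le_sq' (by linarith [neg_abs_le (x : ℝ)]) ((le_abs_self _).trans hx)
      rw [mul_one_div, le_div_iff₀ (by positivity)]
      linarith
    · rw [← ENNReal.ofReal_natCast, ← ENNReal.ofReal_mul (by positivity),
        ← ENNReal.ofReal_add (by positivity) (by positivity)]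
      have h9 : 9 ≤ ((z : ℝ) / Y n) ^ 2 := by
        rw [div_pow, le_div_iff₀ (by positivity), ← sq_abs (z : ℝ)]
        nlinarith
      have h10 : 1 / (1 + ((z : ℝ) / Y n) ^ 2) ≤ 1 / 10 := by
        apply one_div_le_one_div_of_le <;> linarith
      have h11 : (n : ℝ) * (2 * (C * (Y n) ^ (-β))) = 2 / 7 := by
        rw [hYpow]; field_simp
      rw [h11]
      calc ENNReal.ofReal _ ≤ ENNReal.ofReal (1 / 2) := ENNReal.ofReal_le_ofReal (by linarith)
        _ = 1 / 2 := by rw [ENNReal.ofReal_div_of_pos (by norm_num)]; simp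
  have h3Y : Tendsto (fun n => 3 * Y n) atTop atTop := hYt.const_mul_atTop (by norm_num)
  -- The index is `n + 1`: the first step is the long jump, the remaining `n` are spent away from
  -- the origin.
  have hlow : ∀ᶠ n : ℕ in atTop, c' * 3 ^ (-β) / (14 * C) * (1 / (n : ℝ)) ≤
      (pathLawFrom P x (survive a (n + 1))).toReal := by
    filter_upwards [hsurv, h3Y.eventually hjump, hYt.eventually_ge_atTop 0,
      eventually_gt_atTop 0] with n hn hj hY0 hn0
    rw [pathLawFrom_survive_succ hxa]
    have hn0' : (0 : ℝ) < n := by exact_mod_cast hn0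
    have hms : MeasurableSet {z : X | 3 * Y n ≤ |(z : ℝ)|} :=
      measurableSet_le measurable_const (measurable_subtype_coe.abs)
    have h1 : (1 / 2 : ℝ≥0∞) * P x {z : X | 3 * Y n ≤ |(z : ℝ)|} ≤
        ∫⁻ z, pathLawFrom P z (survive a n) ∂(P x) := by
      rw [← setLIntegral_const]
      exact (setLIntegral_mono' hms fun z hz => hn z hz).trans (setLIntegral_le_lintegral _ _)
    have h2 : ∫⁻ z, pathLawFrom P z (survive a n) ∂(P x) ≠ ∞ := by
      refine ne_top_of_le_ne_top ENNReal.one_ne_top ?_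
      calc _ ≤ ∫⁻ _, 1 ∂(P x) := lintegral_mono fun z => prob_le_one
        _ = 1 := by simp
    have h4 := ENNReal.toReal_mono h2 h1
    rw [ENNReal.toReal_mul] at h4
    refine le_trans ?_ h4
    have h5 : ((1 : ℝ≥0∞) / 2).toReal = 1 / 2 := by simp
    rw [h5]
    change _ ≤ 1 / 2 * (P x).real _
    refine le_trans (le_of_eq ?_) (mul_le_mul_of_nonneg_left hj (by norm_num))
    rw [Real.mul_rpow (by norm_num) hY0, hYpow]
    field_simp
    norm_num
  by_contra hne
  rw [meanPassageTime_eq_tsum] at hne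
  have hsum := ENNReal.summable_toReal hne
  have hsum1 := (summable_nat_add_iff 1).2 hsum
  have hk : 0 < c' * 3 ^ (-β) / (14 * C) := by positivity
  have : Summable fun n : ℕ => c' * 3 ^ (-β) / (14 * C) * (1 / (n : ℝ)) := by
    refine summable_of_isBigO_nat hsum1 (Asymptotics.IsBigO.of_bound 1 ?_)
    filter_upwards [hlow] with n hn
    rw [one_mul, Real.norm_of_nonneg (by positivity), Real.norm_of_nonneg ENNReal.toReal_nonneg]
    exact hn
  exact Real.not_summable_one_div_natCast ((summable_mul_left_iff hk.ne').1 this)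

/-- A chain started far out in the direction of `s` is unlikely to come back, if a positive
function that decreases to zero along `s` is superharmonic there. -/
lemma pathLawFrom_return_le {s : X → ℝ} (hs : Measurable s) {f : ℝ → ℝ} (hf : Antitone f)
    (hf0 : ∀ y, 0 < f y) (hlim : Tendsto f atTop (𝓝 0)) {R₀ : ℝ}
    (hP : ∀ x, R₀ < s x → ∫⁻ z, ENNReal.ofReal (f (s z)) ∂(P x) ≤ ENNReal.ofReal (f (s x)))
    {a : ℝ} (ha : R₀ ≤ a) {ε : ℝ≥0∞} (hε : 0 < ε) :
    ∃ R : ℝ, ∀ x, R < s x → pathLawFrom P x {ω | ∃ n, s (ω n) ≤ a} ≤ ε := by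
  have hbound : ∀ x, pathLawFrom P x {ω | ∃ n, s (ω n) ≤ a} ≤ ENNReal.ofReal (f (s x) / f a) := by
    intro x
    have hC : MeasurableSet {x | a < s x} := measurableSet_lt measurable_const hs
    have hH : MeasurableSet {x | s x ≤ a} := measurableSet_le hs measurable_const
    have hsub : {ω : ℕ → X | ∃ n, s (ω n) ≤ a} ⊆ ⋃ n, reach {x | a < s x} {x | s x ≤ a} n := by
      classical
      intro ω hω
      refine Set.mem_iUnion.2 ⟨Nat.find hω, Nat.find hω, le_rfl, fun j hj => ?_, Nat.find_spec hω⟩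
      exact not_le.1 (Nat.find_min hω hj)
    refine (measure_mono hsub).trans (pathLawFrom_iUnion_reach_le (P := P) hC hH
      (V := fun z => ENNReal.ofReal (f (s z) / f a)) (fun z hz => ?_) (fun z hz => ?_) x)
    · have hz : a < s z := hz
      simp_rw [div_eq_mul_inv]
      rw [ENNReal.ofReal_mul (hf0 _).le]
      simp_rw [fun y => ENNReal.ofReal_mul (q := (f a)⁻¹) (hf0 (s y)).le]
      rw [lintegral_mul_const _ (by exact (hf.measurable.comp hs).ennreal_ofReal)]
      gcongr
      exact hP z (ha.trans_lt hz)
    · rw [← ENNReal.ofReal_one]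
      refine ENNReal.ofReal_le_ofReal ?_
      rw [le_div_iff₀ (hf0 a), one_mul]
      exact hf hz
  have ht : Tendsto (fun y => ENNReal.ofReal (f y / f a)) atTop (𝓝 0) := by
    have := ENNReal.tendsto_ofReal (hlim.div_const (f a))
    simpa using this
  obtain ⟨R, hR⟩ := eventually_atTop.1 (ht.eventually (Iic_mem_nhds hε))
  exact ⟨R, fun x hx => (hbound x).trans (hR _ hx.le)⟩

/-- The chain does not diverge in the direction of `s`, if a function that increases to infinity
along `s` is superharmonic there. -/
lemma ae_not_tendsto_atTop {s : X → ℝ} (hs : Measurable s) {g : ℝ → ℝ} (hg : Monotone g)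
    (hlim : Tendsto g atTop atTop) {R₀ : ℝ}
    (hP : ∀ x, R₀ < s x → ∫⁻ z, ENNReal.ofReal (g (s z)) ∂(P x) ≤ ENNReal.ofReal (g (s x)))
    (ν : Measure X) [IsProbabilityMeasure ν] :
    ∀ᵐ ω ∂(pathLaw P ν), ¬ Tendsto (fun n => s (ω n)) atTop atTop := by
  have hC : MeasurableSet {x | R₀ < s x} := measurableSet_lt measurable_const hs
  have hVm : Measurable fun z => ENNReal.ofReal (g (s z)) :=
    (hg.measurable.comp hs).ennreal_ofReal
  filter_upwards [ae_shift_iterate_notMem P ν (measurableSet_escape hC hVm) fun x =>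
    pathLawFrom_escape (P := P) hC hVm hP ENNReal.ofReal_ne_top] with ω hω ht
  obtain ⟨N, hN⟩ := eventually_atTop.1 (ht.eventually_gt_atTop R₀)
  refine hω N ⟨fun n => ?_, fun K => ?_⟩
  · rw [shift_iterate_apply]; exact hN _ (by omega)
  · obtain ⟨n, hn, hn'⟩ := ((hlim.comp ht).eventually_ge_atTop (K : ℝ)).and
      (eventually_ge_atTop N) |>.exists
    refine ⟨n - N, ?_⟩
    rw [shift_iterate_apply, Nat.sub_add_cancel hn', ← ENNReal.ofReal_natCast]
    exact ENNReal.ofReal_le_ofReal hn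

lemma measurableSet_eventually_gt {s : X → ℝ} (hs : Measurable s) (a : ℝ) :
    MeasurableSet {ω : ℕ → X | ∃ N, ∀ n, N ≤ n → a < s (ω n)} := by
  have : {ω : ℕ → X | ∃ N, ∀ n, N ≤ n → a < s (ω n)} =
      ⋃ N, ⋂ n ∈ Set.Ici N, (fun ω : ℕ → X => s (ω n)) ⁻¹' Set.Ioi a := by
    ext ω; simp
  rw [this]
  exact MeasurableSet.iUnion fun N => MeasurableSet.biInter (Set.to_countable _) fun n _ =>
    measurableSet_Ioi.preimage (hs.comp (measurable_pi_apply n))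

lemma eventually_gt_of_shift {s : X → ℝ} {a : ℝ} {ω : ℕ → X}
    (h : ∃ N, ∀ n, N ≤ n → a < s (shift ω n)) : ∃ N, ∀ n, N ≤ n → a < s (ω n) := by
  obtain ⟨N, hN⟩ := h
  refine ⟨N + 1, fun n hn => ?_⟩
  have := hN (n - 1) (by omega)
  rwa [shift_apply, Nat.sub_add_cancel (by omega)] at this

/-- The event of settling neither above `a` nor below `-a` is stable under the shift. From a far
start on either side it requires a return to level `a` on that side, which is unlikely; so it is
null by `ae_notMem_of_unlikely`. -/
lemma directionalTransient_of_lyapunov (hN : NonConfined P I) {f : ℝ → ℝ} (hf : Antitone f)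
    (hf0 : ∀ y, 0 < f y) (hlim : Tendsto f atTop (𝓝 0)) {R₀ : ℝ}
    (hpos : ∀ x : X, R₀ < (x : ℝ) →
      ∫⁻ z : X, ENNReal.ofReal (f z) ∂(P x) ≤ ENNReal.ofReal (f x))
    (hneg : ∀ x : X, R₀ < -(x : ℝ) →
      ∫⁻ z : X, ENNReal.ofReal (f (-(z : ℝ))) ∂(P x) ≤ ENNReal.ofReal (f (-(x : ℝ)))) :
    DirectionalTransient P I := by
  have hm1 : Measurable fun x : X => (x : ℝ) := measurable_subtype_coe
  have hm2 : Measurable fun x : X => -(x : ℝ) := hm1.neg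
  have key : ∀ a : ℝ, R₀ ≤ a → AlmostSurely P I fun ω =>
      ω ∉ {ω : ℕ → X | ∃ N, ∀ n, N ≤ n → a < (ω n : ℝ)}ᶜ ∩
        {ω : ℕ → X | ∃ N, ∀ n, N ≤ n → a < -(ω n : ℝ)}ᶜ := by
    intro a ha
    refine ae_notMem_of_unlikely hN ((measurableSet_eventually_gt hm1 a).compl.inter
      (measurableSet_eventually_gt hm2 a).compl) ?_ ?_
    · rintro ω ⟨h1, h2⟩
      exact ⟨fun h => h1 (eventually_gt_of_shift (s := fun x : X => (x : ℝ)) h),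
        fun h => h2 (eventually_gt_of_shift (s := fun x : X => -(x : ℝ)) h)⟩
    · intro ε hε
      obtain ⟨R₁, hR₁⟩ := pathLawFrom_return_le hm1 hf hf0 hlim hpos ha hε
      obtain ⟨R₂, hR₂⟩ := pathLawFrom_return_le hm2 hf hf0 hlim hneg ha hε
      refine ⟨max R₁ R₂, fun x hx => ?_⟩
      rcases lt_abs.1 hx with h | h
      · refine (measure_mono ?_).trans (hR₁ x ((le_max_left _ _).trans_lt h))
        rintro ω ⟨h1, -⟩
        by_contra hcon
        simp only [Set.mem_ofPred_eq, not_exists, not_le] at hcon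
        exact h1 ⟨0, fun n _ => hcon n⟩
      · refine (measure_mono ?_).trans (hR₂ x ((le_max_right _ _).trans_lt h))
        rintro ω ⟨-, h1⟩
        by_contra hcon
        simp only [Set.mem_ofPred_eq, not_exists, not_le] at hcon
        exact h1 ⟨0, fun n _ => hcon n⟩
  intro ν hν
  have hall : ∀ᵐ ω ∂(pathLaw P (ν : Measure X)), ∀ k : ℕ,
      ω ∉ {ω : ℕ → X | ∃ N, ∀ n, N ≤ n → max R₀ 0 + k < (ω n : ℝ)}ᶜ ∩
        {ω : ℕ → X | ∃ N, ∀ n, N ≤ n → max R₀ 0 + k < -(ω n : ℝ)}ᶜ := by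
    rw [ae_all_iff]
    intro k
    exact key _ (by have := le_max_left R₀ 0; have : (0 : ℝ) ≤ k := k.cast_nonneg; linarith) ν hν
  filter_upwards [hall] with ω hω
  have hω' : ∀ k : ℕ, (∃ N, ∀ n, N ≤ n → max R₀ 0 + k < (ω n : ℝ)) ∨
      ∃ N, ∀ n, N ≤ n → max R₀ 0 + k < -(ω n : ℝ) := by
    intro k
    by_contra hcon
    rw [not_or] at hcon
    exact hω k hcon
  have hR : 0 ≤ max R₀ 0 := le_max_right _ _
  -- Level `0` fixes the side on which the path ends up; at every higher level the other side would
  -- contradict it.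
  rcases hω' 0 with ⟨N₀, hN₀⟩ | ⟨N₀, hN₀⟩
  · left
    refine tendsto_atTop.2 fun b => ?_
    obtain ⟨k, hk⟩ := exists_nat_ge b
    rcases hω' k with ⟨N, hN⟩ | ⟨N, hN⟩
    · filter_upwards [eventually_ge_atTop N] with n hn
      linarith [hN n hn]
    · have h1 := hN₀ (max N₀ N) (le_max_left _ _)
      have h2 := hN (max N₀ N) (le_max_right _ _)
      have : (0 : ℝ) ≤ k := k.cast_nonneg
      simp only [Nat.cast_zero] at h1
      linarith
  · right
    refine tendsto_atBot.2 fun b => ?_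
    obtain ⟨k, hk⟩ := exists_nat_ge (-b)
    rcases hω' k with ⟨N, hN⟩ | ⟨N, hN⟩
    · have h1 := hN₀ (max N₀ N) (le_max_left _ _)
      have h2 := hN (max N₀ N) (le_max_right _ _)
      have : (0 : ℝ) ≤ k := k.cast_nonneg
      simp only [Nat.cast_zero] at h1
      linarith
    · filter_upwards [eventually_ge_atTop N] with n hn
      linarith [hN n hn]

lemma liminf_eq_bot_of_frequently {u : ℕ → ℝ} (h : ∀ b : ℝ, ∃ᶠ n in atTop, u n ≤ b) :
    liminf (fun n => (u n : EReal)) atTop = ⊥ := by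
  refine (EReal.eq_bot_iff_forall_lt _).2 fun y => ?_
  refine lt_of_le_of_lt (liminf_le_of_frequently_le ((h (y - 1)).mono fun n hn =>
    EReal.coe_le_coe_iff.2 hn) (by isBoundedDefault)) ?_
  exact EReal.coe_lt_coe_iff.2 (by linarith)

lemma limsup_eq_top_of_frequently {u : ℕ → ℝ} (h : ∀ b : ℝ, ∃ᶠ n in atTop, b ≤ u n) :
    limsup (fun n => (u n : EReal)) atTop = ⊤ := by
  refine (EReal.eq_top_iff_forall_lt _).2 fun y => ?_
  refine lt_of_lt_of_le ?_ (le_limsup_of_frequently_le ((h (y + 1)).mono fun n hn =>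
    EReal.coe_le_coe_iff.2 hn) (by isBoundedDefault))
  exact EReal.coe_lt_coe_iff.2 (by linarith)

/-- The decreasing function of the modulus forces `|ξ| → ∞`; the increasing one-sided function
excludes divergence to either end. A path with divergent modulus that eventually avoided a half-line
would diverge in one direction. -/
lemma oscillatoryTransient_of_lyapunov (hN : NonConfined P I) {f g : ℝ → ℝ} (hf : Antitone f)
    (hf0 : ∀ y, 0 < f y) (hlim : Tendsto f atTop (𝓝 0)) (hg : Monotone g)
    (hglim : Tendsto g atTop atTop) {R₀ : ℝ}
    (habs : ∀ x : X, R₀ < |(x : ℝ)| →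
      ∫⁻ z : X, ENNReal.ofReal (f |(z : ℝ)|) ∂(P x) ≤ ENNReal.ofReal (f |(x : ℝ)|))
    (hpos : ∀ x : X, R₀ < (x : ℝ) →
      ∫⁻ z : X, ENNReal.ofReal (g z) ∂(P x) ≤ ENNReal.ofReal (g x))
    (hneg : ∀ x : X, R₀ < -(x : ℝ) →
      ∫⁻ z : X, ENNReal.ofReal (g (-(z : ℝ))) ∂(P x) ≤ ENNReal.ofReal (g (-(x : ℝ)))) :
    OscillatoryTransient P I := by
  have hm1 : Measurable fun x : X => (x : ℝ) := measurable_subtype_coe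
  have hm2 : Measurable fun x : X => -(x : ℝ) := hm1.neg
  have hm3 : Measurable fun x : X => |(x : ℝ)| := hm1.abs
  have key : ∀ a : ℝ, R₀ ≤ a → AlmostSurely P I fun ω =>
      ω ∉ {ω : ℕ → X | ∃ N, ∀ n, N ≤ n → a < |(ω n : ℝ)|}ᶜ := by
    intro a ha
    refine ae_notMem_of_unlikely hN (measurableSet_eventually_gt hm3 a).compl ?_ ?_
    · intro ω h1 h
      exact h1 (eventually_gt_of_shift (s := fun x : X => |(x : ℝ)|) h)
    · intro ε hε
      obtain ⟨R, hR⟩ := pathLawFrom_return_le hm3 hf hf0 hlim habs ha hε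
      refine ⟨R, fun x hx => (measure_mono ?_).trans (hR x hx)⟩
      intro ω h1
      by_contra hcon
      simp only [Set.mem_ofPred_eq, not_exists, not_le] at hcon
      exact h1 ⟨0, fun n _ => hcon n⟩
  intro ν hν
  have hall : ∀ᵐ ω ∂(pathLaw P (ν : Measure X)), ∀ k : ℕ,
      ω ∉ {ω : ℕ → X | ∃ N, ∀ n, N ≤ n → max R₀ 0 + k < |(ω n : ℝ)|}ᶜ := by
    rw [ae_all_iff]
    intro k
    exact key _ (by have := le_max_left R₀ 0; have : (0 : ℝ) ≤ k := k.cast_nonneg; linarith) ν hν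
  filter_upwards [hall, ae_not_tendsto_atTop hm1 hg hglim hpos (ν : Measure X),
    ae_not_tendsto_atTop hm2 hg hglim hneg (ν : Measure X)] with ω hω h1 h2
  have hR : 0 ≤ max R₀ 0 := le_max_right _ _
  have habs : Tendsto (fun n => |(ω n : ℝ)|) atTop atTop := by
    refine tendsto_atTop.2 fun b => ?_
    obtain ⟨k, hk⟩ := exists_nat_ge b
    obtain ⟨N, hN⟩ := not_not.1 (hω k)
    filter_upwards [eventually_ge_atTop N] with n hn
    linarith [hN n hn]
  refine ⟨habs, liminf_eq_bot_of_frequently fun b => ?_, limsup_eq_top_of_frequently fun b => ?_⟩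
  · by_contra hcon
    rw [not_frequently] at hcon
    refine h1 (tendsto_atTop.2 fun y => ?_)
    filter_upwards [hcon, habs.eventually_ge_atTop (max y (-b))] with n hn hn'
    rcases le_abs.1 hn' with h | h
    · exact (le_max_left _ _).trans h
    · exact absurd ((le_max_right y (-b)).trans h) (by linarith)
  · by_contra hcon
    rw [not_frequently] at hcon
    refine h2 (tendsto_atTop.2 fun y => ?_)
    filter_upwards [hcon, habs.eventually_ge_atTop (max y b)] with n hn hn'
    rcases le_abs.1 hn' with h | h
    · exact absurd ((le_max_right y b).trans h) (by linarith)
    · exact (le_max_left _ _).trans h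

end Classification


/-! ### Increments seen from far away: moments and scaling limits -/

section Increments

/-- The inward part of an increment, in units of `r`. -/
def inward (r η : ℝ) : ℝ := max (-η) 0 / r

@[fun_prop]
lemma measurable_inward (r : ℝ) : Measurable (inward r) := by
  unfold inward; fun_prop

lemma inward_nonneg {r : ℝ} (hr : 0 < r) (η : ℝ) : 0 ≤ inward r η :=
  div_nonneg (le_max_right _ _) hr.le

lemma inward_of_nonneg {r η : ℝ} (hη : 0 ≤ η) : inward r η = 0 := by
  simp [inward, hη]

lemma inward_of_nonpos {r η : ℝ} (hη : η ≤ 0) : inward r η = -η / r := by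
  simp [inward, hη]

lemma lt_inward_iff {r s : ℝ} (hr : 0 < r) (hs : 0 ≤ s) (η : ℝ) :
    s < inward r η ↔ η < -(s * r) := by
  have : 0 ≤ s * r := by positivity
  rw [inward, lt_div_iff₀ hr, lt_max_iff]
  constructor
  · rintro (h | h) <;> linarith
  · intro h; left; linarith

/-- The function `t ↦ min (t², |t|)`, which controls second order Taylor remainders. -/
def sqMin (t : ℝ) : ℝ := min (t ^ 2) |t|

@[fun_prop]
lemma measurable_sqMin : Measurable sqMin := by
  unfold sqMin; fun_prop

lemma sqMin_nonneg (t : ℝ) : 0 ≤ sqMin t := le_min (sq_nonneg t) (abs_nonneg t)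

variable (Q : Measure ℝ)

/-- The layer-cake formula. It turns expectations of functions of an inward jump into integrals of
the tail, which is all that is assumed about such jumps. -/
lemma lintegral_inward {r : ℝ} (hr : 0 < r) {g : ℝ → ℝ} (hg0 : ∀ s, 0 ≤ g s)
    (hg : ∀ t > 0, IntervalIntegrable g volume 0 t) :
    ∫⁻ η, ENNReal.ofReal (∫ s in (0 : ℝ)..inward r η, g s) ∂Q =
      ∫⁻ s in Set.Ioi 0, Q (Set.Iio (-(s * r))) * ENNReal.ofReal (g s) := by
  rw [lintegral_comp_eq_lintegral_meas_lt_mul Q (Eventually.of_forall (inward_nonneg hr))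
    (measurable_inward r).aemeasurable hg (Eventually.of_forall hg0)]
  refine setLIntegral_congr_fun measurableSet_Ioi fun s hs => ?_
  congr 2
  ext η
  exact lt_inward_iff hr (le_of_lt hs) η

variable [IsProbabilityMeasure Q]

lemma measurable_tail {r : ℝ} (hr : 0 < r) : Measurable fun s : ℝ => Q.real (Set.Iio (-(s * r))) := by
  refine Antitone.measurable fun s t hst => measureReal_mono (Set.Iio_subset_Iio ?_)
  have := mul_le_mul_of_nonneg_right hst hr.le
  linarith

lemma integral_inward {r : ℝ} (hr : 0 < r) {g : ℝ → ℝ} (hgm : Measurable g) (hg0 : ∀ s, 0 ≤ g s)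
    (hg : ∀ t > 0, IntervalIntegrable g volume 0 t)
    (hG : Measurable fun u => ∫ s in (0 : ℝ)..u, g s) :
    ∫ η, (∫ s in (0 : ℝ)..inward r η, g s) ∂Q =
      ∫ s in Set.Ioi 0, Q.real (Set.Iio (-(s * r))) * g s := by
  rw [integral_eq_lintegral_of_nonneg_ae
      (Eventually.of_forall fun η => intervalIntegral.integral_nonneg (inward_nonneg hr η)
        fun s _ => hg0 s) (hG.comp (measurable_inward r)).aestronglyMeasurable,
    integral_eq_lintegral_of_nonneg_ae
      (Eventually.of_forall fun s => mul_nonneg measureReal_nonneg (hg0 s))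
      ((measurable_tail Q hr).mul hgm).aestronglyMeasurable, lintegral_inward Q hr hg0 hg]
  congr 1
  refine lintegral_congr fun s => ?_
  rw [ENNReal.ofReal_mul measureReal_nonneg, ofReal_measureReal]

variable {Q}

/-- Integrability at `0` needs `β < 2` and at infinity `β > 1`. This is the dominating function for
all limits of inward expectations. -/
lemma integrableOn_rpow_neg_mul_min {β : ℝ} (h1 : 1 < β) (h2 : β < 2) :
    IntegrableOn (fun s : ℝ => s ^ (-β) * min s 1) (Set.Ioi 0) := by
  rw [← Set.Ioc_union_Ioi_eq_Ioi zero_le_one]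
  refine IntegrableOn.union ?_ ?_
  · have : IntegrableOn (fun s : ℝ => s ^ (1 - β)) (Set.Ioc 0 1) :=
      (intervalIntegrable_iff_integrableOn_Ioc_of_le zero_le_one).1
        (intervalIntegral.intervalIntegrable_rpow' (by linarith))
    refine this.congr_fun (fun s hs => ?_) measurableSet_Ioc
    dsimp only
    rw [min_eq_left hs.2, sub_eq_add_neg, add_comm, Real.rpow_add_one hs.1.ne']
  · refine (integrableOn_Ioi_rpow_of_lt (a := -β) (by linarith) zero_lt_one).congr_fun
      (fun s hs => ?_) measurableSet_Ioi
    dsimp only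
    rw [min_eq_right (le_of_lt hs), mul_one]

lemma intervalIntegrable_of_abs_le_min {g : ℝ → ℝ} (hgm : Measurable g) {C : ℝ}
    (hg : ∀ s > 0, |g s| ≤ C * min s 1) {t : ℝ} (ht : 0 < t) :
    IntervalIntegrable g volume 0 t := by
  rw [intervalIntegrable_iff_integrableOn_Ioc_of_le ht.le]
  refine Measure.integrableOn_of_bounded (M := |C|) (by simp) hgm.aestronglyMeasurable ?_
  refine (ae_restrict_iff' measurableSet_Ioc).2 (Eventually.of_forall fun s hs => ?_)
  refine (hg s hs.1).trans ((le_abs_self _).trans ?_)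
  rw [abs_mul, abs_of_nonneg (le_min hs.1.le zero_le_one)]
  exact mul_le_of_le_one_right (abs_nonneg _) (min_le_right _ _)

lemma abs_integral_le_of_abs_le_min {g : ℝ → ℝ} {C : ℝ}
    (hg : ∀ s > 0, |g s| ≤ C * min s 1) {u : ℝ} (hu : 0 ≤ u) :
    |∫ s in (0 : ℝ)..u, g s| ≤ |C| * u := by
  have := intervalIntegral.norm_integral_le_of_norm_le_const (a := 0) (b := u) (C := |C|) (f := g)
    (fun s hs => by
      rw [Set.uIoc_of_le hu] at hs
      refine (hg s hs.1).trans ((le_abs_self _).trans ?_)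
      rw [abs_mul, abs_of_nonneg (le_min hs.1.le zero_le_one)]
      exact mul_le_of_le_one_right (abs_nonneg _) (min_le_right _ _))
  simpa [abs_of_nonneg hu] using this

/-- The increments of a chain with heavier inward tails, seen from states `i` at distance `r i`
from the origin and oriented outwards. -/
structure InwardFamily {ι : Type*} (l : Filter ι) (Q : ι → Measure ℝ) (r : ι → ℝ)
    (α β c K M : ℝ) : Prop where
  one_lt : 1 < β
  lt_two : β < 2
  beta_lt : β < α
  alpha_le : α ≤ 2
  c_pos : 0 < c
  prob : ∀ i, IsProbabilityMeasure (Q i)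
  tendsto_r : Tendsto r l atTop
  tail_le : ∀ᶠ i in l, ∀ y > 0, (Q i).real (Set.Iio (-y)) ≤ K * y ^ (-β)
  tail_lim : ∀ s > 0, Tendsto (fun i => r i ^ β * (Q i).real (Set.Iio (-(s * r i)))) l
    (𝓝 (c * s ^ (-β)))
  moment : ∀ᶠ i in l, ∫⁻ η, ENNReal.ofReal (max η 0 ^ α) ∂(Q i) ≤ ENNReal.ofReal M

namespace InwardFamily

variable {ι : Type*} {l : Filter ι} {Q : ι → Measure ℝ} {r : ι → ℝ} {α β c K M : ℝ}

/-- The layer-cake integral of `s^(q-1) s^(-β)` converges at infinity because `q < β`, and the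
probability bound `1` serves on `(0, 1]`. The outward part is controlled by its moment of order `α >
q`. -/
lemma moment_bound (h : InwardFamily l Q r α β c K M) {q : ℝ} (hq1 : 1 ≤ q) (hqβ : q < β) :
    ∃ B : ℝ, 0 ≤ B ∧ ∀ᶠ i in l, Integrable (fun η => |η| ^ q) (Q i) ∧ ∫ η, |η| ^ q ∂(Q i) ≤ B := by
  have := h.prob
  have hβ1 := h.one_lt
  let D : ℝ≥0∞ := ∫⁻ s in Set.Ioi (1 : ℝ), ENNReal.ofReal (|K| * q * s ^ (q - 1 - β))
  have hD : D ≠ ∞ := by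
    have hi : IntegrableOn (fun s : ℝ => |K| * q * s ^ (q - 1 - β)) (Set.Ioi 1) :=
      (integrableOn_Ioi_rpow_of_lt (by linarith) zero_lt_one).const_mul _
    exact hi.lintegral_lt_top.ne
  let E : ℝ≥0∞ := ∫⁻ s in Set.Ioc (0 : ℝ) 1, ENNReal.ofReal q
  have hE : E ≠ ∞ := by simp [E]
  let T : ℝ≥0∞ := E + D + (1 + ENNReal.ofReal M)
  have hT : T ≠ ∞ := by simp [T, hD, hE]
  refine ⟨T.toReal, ENNReal.toReal_nonneg, ?_⟩
  filter_upwards [h.tail_le, h.moment] with i hi hm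
  have hneg : ∫⁻ η, ENNReal.ofReal (inward 1 η ^ q) ∂(Q i) ≤ E + D := by
    have h1 : ∀ η, inward 1 η ^ q = ∫ s in (0 : ℝ)..inward 1 η, q * s ^ (q - 1) := by
      intro η
      rw [intervalIntegral.integral_const_mul, integral_rpow (Or.inl (by linarith))]
      rw [sub_add_cancel, Real.zero_rpow (by linarith)]
      field_simp
      simp
    simp_rw [h1]
    have h2 := lintegral_comp_eq_lintegral_meas_lt_mul (Q i) (f := inward 1)
      (g := fun s => q * s ^ (q - 1)) (Eventually.of_forall (inward_nonneg one_pos))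
      (measurable_inward 1).aemeasurable
      (fun t ht => (intervalIntegral.intervalIntegrable_rpow' (by linarith)).const_mul _)
      ((ae_restrict_iff' measurableSet_Ioi).2 (Eventually.of_forall fun s hs =>
        mul_nonneg (by linarith) (Real.rpow_nonneg (le_of_lt hs) _)))
    rw [h2, ← Set.Ioc_union_Ioi_eq_Ioi zero_le_one]
    refine (lintegral_union_le _ _ _).trans (add_le_add ?_ ?_)
    · refine setLIntegral_mono' measurableSet_Ioc fun s hs => ?_
      refine (mul_le_mul' prob_le_one le_rfl).trans ?_
      rw [one_mul]
      refine ENNReal.ofReal_le_ofReal (mul_le_of_le_one_right (by linarith) ?_)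
      exact Real.rpow_le_one hs.1.le hs.2 (by linarith)
    · refine setLIntegral_mono' measurableSet_Ioi fun s hs => ?_
      have hs1 : (1 : ℝ) < s := hs
      have hs0 : 0 < s := by linarith
      have h3 : {η | s < inward 1 η} = Set.Iio (-s) := by
        ext η; simpa using lt_inward_iff one_pos hs0.le η
      rw [h3, ← ofReal_measureReal, ← ENNReal.ofReal_mul measureReal_nonneg]
      refine ENNReal.ofReal_le_ofReal ?_
      have h4 : (Q i).real (Set.Iio (-s)) ≤ |K| * s ^ (-β) :=
        (hi s hs0).trans (mul_le_mul_of_nonneg_right (le_abs_self K) (Real.rpow_nonneg hs0.le _))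
      calc (Q i).real (Set.Iio (-s)) * (q * s ^ (q - 1))
          ≤ |K| * s ^ (-β) * (q * s ^ (q - 1)) :=
            mul_le_mul_of_nonneg_right h4 (by positivity)
        _ = |K| * q * s ^ (q - 1 - β) := by
            rw [sub_eq_add_neg (q - 1) β, Real.rpow_add hs0]; ring
  have hpos : ∫⁻ η, ENNReal.ofReal (max η 0 ^ q) ∂(Q i) ≤ 1 + ENNReal.ofReal M := by
    calc ∫⁻ η, ENNReal.ofReal (max η 0 ^ q) ∂(Q i)
        ≤ ∫⁻ η, (1 + ENNReal.ofReal (max η 0 ^ α)) ∂(Q i) := by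
          refine lintegral_mono fun η => ?_
          rw [← ENNReal.ofReal_one, ← ENNReal.ofReal_add zero_le_one
            (Real.rpow_nonneg (le_max_right _ _) _)]
          refine ENNReal.ofReal_le_ofReal ?_
          have h0 : 0 ≤ max η 0 := le_max_right _ _
          rcases le_total (max η 0) 1 with h1 | h1
          · have := Real.rpow_le_one h0 h1 (show 0 ≤ q by linarith)
            have := Real.rpow_nonneg h0 α
            linarith
          · have := Real.rpow_le_rpow_of_exponent_le h1 (hqβ.le.trans h.beta_lt.le)
            linarith
      _ = 1 + ∫⁻ η, ENNReal.ofReal (max η 0 ^ α) ∂(Q i) := by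
          rw [lintegral_add_left measurable_const]; simp
      _ ≤ _ := by gcongr
  have habs : ∫⁻ η, ENNReal.ofReal (|η| ^ q) ∂(Q i) ≤ T := by
    calc ∫⁻ η, ENNReal.ofReal (|η| ^ q) ∂(Q i)
        ≤ ∫⁻ η, (ENNReal.ofReal (inward 1 η ^ q) + ENNReal.ofReal (max η 0 ^ q)) ∂(Q i) := by
          refine lintegral_mono fun η => ?_
          rcases le_total 0 η with h1 | h1
          · rw [abs_of_nonneg h1, max_eq_left h1]; exact le_add_self
          · rw [abs_of_nonpos h1, inward_of_nonpos h1, div_one]; exact le_self_add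
      _ = _ := lintegral_add_left (by fun_prop) _
      _ ≤ T := add_le_add hneg hpos
  have hint : Integrable (fun η => |η| ^ q) (Q i) := by
    refine ⟨(by fun_prop : Measurable _).aestronglyMeasurable, ?_⟩
    rw [hasFiniteIntegral_iff_ofReal (Eventually.of_forall fun η => by positivity)]
    exact habs.trans_lt hT.lt_top
  refine ⟨hint, ?_⟩
  rw [integral_eq_lintegral_of_nonneg_ae (Eventually.of_forall fun η => by positivity)
    (by fun_prop : Measurable _).aestronglyMeasurable]
  exact ENNReal.toReal_mono hT habs

lemma integrable (h : InwardFamily l Q r α β c K M) :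
    ∀ᶠ i in l, Integrable (fun η => η) (Q i) := by
  obtain ⟨B, -, hB⟩ := h.moment_bound le_rfl h.one_lt
  filter_upwards [hB] with i hi
  have := hi.1
  simp only [Real.rpow_one] at this
  exact (integrable_norm_iff (by fun_prop)).1 this

lemma integrable_outward (h : InwardFamily l Q r α β c K M) :
    ∀ᶠ i in l, Integrable (fun η => max η 0 ^ α) (Q i) ∧
      ∫ η, max η 0 ^ α ∂(Q i) ≤ max M 0 := by
  filter_upwards [h.moment] with i hi
  have h0 : ∀ η : ℝ, 0 ≤ max η 0 ^ α := fun η => Real.rpow_nonneg (le_max_right _ _) _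
  refine ⟨⟨(by fun_prop : Measurable _).aestronglyMeasurable, ?_⟩, ?_⟩
  · rw [hasFiniteIntegral_iff_ofReal (Eventually.of_forall h0)]
    exact hi.trans_lt ENNReal.ofReal_lt_top
  · rw [integral_eq_lintegral_of_nonneg_ae (Eventually.of_forall h0)
      (by fun_prop : Measurable _).aestronglyMeasurable]
    refine (ENNReal.toReal_mono ENNReal.ofReal_ne_top hi).trans ?_
    rw [ENNReal.toReal_ofReal']

lemma integrable_sqMin (h : InwardFamily l Q r α β c K M) :
    ∀ᶠ i in l, ∀ Y, 1 ≤ Y → Integrable (fun η => sqMin (η / Y)) (Q i) := by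
  filter_upwards [h.integrable] with i hi Y hY
  refine Integrable.mono' (hi.abs.div_const Y)
    (by fun_prop : Measurable _).aestronglyMeasurable (Eventually.of_forall fun η => ?_)
  rw [Real.norm_of_nonneg (sqMin_nonneg _)]
  refine (min_le_right _ _).trans_eq ?_
  rw [abs_div, abs_of_nonneg (by linarith : 0 ≤ Y)]

/-- Second order terms are of the critical order `Y^(-β)`, with a constant independent of both the
state and the scale. Scales `Y` other than `r` matter for bumps of width smaller than the distance
to the origin. -/
lemma sqMin_bound (h : InwardFamily l Q r α β c K M) :
    ∃ C : ℝ, 0 < C ∧ ∀ᶠ i in l, ∀ Y, 1 ≤ Y → ∫ η, sqMin (η / Y) ∂(Q i) ≤ C * Y ^ (-β) := by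
  have := h.prob
  have hβ1 := h.one_lt
  have hβ2 := h.lt_two
  set J : ℝ := ∫ s in Set.Ioi (0 : ℝ), s ^ (-β) * min s 1 with hJ
  have hJ0 : 0 ≤ J := setIntegral_nonneg measurableSet_Ioi fun s hs =>
    mul_nonneg (Real.rpow_nonneg (le_of_lt hs) _) (le_min (le_of_lt hs) zero_le_one)
  refine ⟨2 * (|K| * J) + max M 0 + 1, by positivity, ?_⟩
  filter_upwards [h.integrable, h.tail_le, h.integrable_outward, h.integrable_sqMin]
    with i hint htail hout hsm Y hY
  have hY0 : 0 < Y := by linarith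
  -- On the half-line the primitive of `min s 1` is at least half of `sqMin`; the outer `max` only
  -- makes `g` nonnegative everywhere, as the layer-cake formula requires.
  let g : ℝ → ℝ := fun s => max (min s 1) 0
  have hgm : Measurable g := by fun_prop
  have hgc : Continuous g := by fun_prop
  have hg0 : ∀ s, 0 ≤ g s := fun s => le_max_right _ _
  have hgs : ∀ s > 0, g s = min s 1 := fun s hs => max_eq_left (le_min hs.le zero_le_one)
  have hgi : ∀ t > 0, IntervalIntegrable g volume 0 t := fun t _ => hgc.intervalIntegrable _ _
  have hGc : Continuous fun u => ∫ s in (0 : ℝ)..u, g s :=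
    intervalIntegral.continuous_primitive (fun a b => hgc.intervalIntegrable a b) 0
  have hG : ∀ u, 0 ≤ u → sqMin u ≤ 2 * ∫ s in (0 : ℝ)..u, g s := by
    intro u hu
    have h01 : ∀ v, 0 ≤ v → v ≤ 1 → ∫ s in (0 : ℝ)..v, g s = v ^ 2 / 2 := by
      intro v hv hv1
      rw [intervalIntegral.integral_congr (g := fun s => s)]
      · simp
      · intro s hs
        rw [Set.uIcc_of_le hv] at hs
        simp only [g]
        rw [min_eq_left (hs.2.trans hv1), max_eq_left hs.1]
    rcases le_total u 1 with hu1 | hu1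
    · rw [h01 u hu hu1]
      exact (min_le_left _ _).trans (by linarith)
    · rw [← intervalIntegral.integral_add_adjacent_intervals (hgc.intervalIntegrable 0 1)
        (hgc.intervalIntegrable 1 u), h01 1 zero_le_one le_rfl]
      rw [intervalIntegral.integral_congr (a := 1) (g := fun s => 1)]
      · refine (min_le_right _ _).trans ?_
        rw [abs_of_nonneg hu]
        simp
        linarith
      · intro s hs
        rw [Set.uIcc_of_le hu1] at hs
        simp only [g]
        rw [min_eq_right hs.1, max_eq_left zero_le_one]
  have hGle : ∀ u, 0 ≤ u → |∫ s in (0 : ℝ)..u, g s| ≤ |(1 : ℝ)| * u := fun u hu =>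
    abs_integral_le_of_abs_le_min (C := 1)
      (fun s hs => by rw [hgs s hs, one_mul, abs_of_nonneg (le_min hs.le zero_le_one)]) hu
  have hinw : Integrable (fun η => inward Y η) (Q i) := by
    refine Integrable.mono' (hint.abs.div_const Y) (by fun_prop) (Eventually.of_forall fun η => ?_)
    rw [Real.norm_of_nonneg (inward_nonneg hY0 η), inward]
    gcongr
    exact max_le (neg_le_abs η) (abs_nonneg η)
  have hGint : Integrable (fun η => ∫ s in (0 : ℝ)..inward Y η, g s) (Q i) := by
    refine Integrable.mono' hinw (hGc.measurable.comp (measurable_inward Y)).aestronglyMeasurable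
      (Eventually.of_forall fun η => ?_)
    simpa using hGle _ (inward_nonneg hY0 η)
  have hpt : ∀ η, sqMin (η / Y) ≤
      2 * (∫ s in (0 : ℝ)..inward Y η, g s) + max η 0 ^ α / Y ^ α := by
    intro η
    rcases le_total 0 η with hη | hη
    · rw [inward_of_nonneg hη, intervalIntegral.integral_same, mul_zero, zero_add, max_eq_left hη,
        ← Real.div_rpow hη hY0.le]
      have ht : 0 ≤ η / Y := by positivity
      rcases le_total (η / Y) 1 with h1 | h1
      · refine (min_le_left _ _).trans ?_
        rcases ht.eq_or_lt with h0 | h0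
        · rw [← h0]; simp [Real.zero_rpow (by linarith [h.beta_lt] : α ≠ 0)]
        · rw [← Real.rpow_two]
          exact Real.rpow_le_rpow_of_exponent_ge h0 h1 h.alpha_le
      · refine (min_le_right _ _).trans ?_
        rw [abs_of_nonneg ht]
        exact Real.self_le_rpow_of_one_le h1 (by linarith [h.beta_lt])
    · have h1 := hG _ (inward_nonneg hY0 η)
      have h2 : sqMin (η / Y) = sqMin (inward Y η) := by
        rw [inward_of_nonpos hη, neg_div, sqMin, sqMin, neg_sq, abs_neg]
      rw [h2]
      have h3 : 0 ≤ max η 0 ^ α / Y ^ α :=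
        div_nonneg (Real.rpow_nonneg (le_max_right _ _) _) (Real.rpow_nonneg hY0.le _)
      linarith
  calc ∫ η, sqMin (η / Y) ∂(Q i)
      ≤ ∫ η, (2 * (∫ s in (0 : ℝ)..inward Y η, g s) + max η 0 ^ α / Y ^ α) ∂(Q i) :=
        integral_mono (hsm Y hY) ((hGint.const_mul 2).add (hout.1.div_const _)) hpt
    _ = 2 * (∫ s in Set.Ioi 0, (Q i).real (Set.Iio (-(s * Y))) * g s) +
          (∫ η, max η 0 ^ α ∂(Q i)) / Y ^ α := by
        rw [integral_add (hGint.const_mul 2) (hout.1.div_const _), integral_const_mul,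
          integral_div, integral_inward (Q i) hY0 hgm hg0 hgi hGc.measurable]
    _ ≤ 2 * (|K| * J * Y ^ (-β)) + max M 0 * Y ^ (-β) := by
        gcongr
        · have hb : IntegrableOn (fun s : ℝ => |K| * Y ^ (-β) * (s ^ (-β) * min s 1)) (Set.Ioi 0) :=
            (integrableOn_rpow_neg_mul_min hβ1 hβ2).const_mul _
          have hle : ∀ s ∈ Set.Ioi (0 : ℝ), (Q i).real (Set.Iio (-(s * Y))) * g s ≤
              |K| * Y ^ (-β) * (s ^ (-β) * min s 1) := by
            intro s hs
            have hs : 0 < s := hs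
            rw [hgs s hs]
            have h4 : (Q i).real (Set.Iio (-(s * Y))) ≤ |K| * (s * Y) ^ (-β) :=
              (htail _ (by positivity)).trans
                (mul_le_mul_of_nonneg_right (le_abs_self K) (by positivity))
            calc _ ≤ |K| * (s * Y) ^ (-β) * min s 1 :=
                  mul_le_mul_of_nonneg_right h4 (le_min hs.le zero_le_one)
              _ = _ := by rw [Real.mul_rpow hs.le hY0.le]; ring
          refine (setIntegral_mono_on ?_ hb measurableSet_Ioi hle).trans_eq ?_
          · refine Integrable.mono' hb
              ((measurable_tail (Q i) hY0).mul hgm).aestronglyMeasurable ?_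
            refine (ae_restrict_iff' measurableSet_Ioi).2 (Eventually.of_forall fun s hs => ?_)
            rw [Real.norm_of_nonneg (mul_nonneg measureReal_nonneg (hg0 s))]
            exact hle s hs
          · rw [integral_const_mul]; ring
        · rw [div_eq_mul_inv, ← Real.rpow_neg hY0.le]
          have h5 : Y ^ (-α) ≤ Y ^ (-β) :=
            Real.rpow_le_rpow_of_exponent_le hY (by linarith [h.beta_lt])
          exact mul_le_mul hout.2 h5 (by positivity) (le_max_right _ _)
    _ ≤ (2 * (|K| * J) + max M 0 + 1) * Y ^ (-β) := by
        have : 0 ≤ Y ^ (-β) := by positivity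
        linarith

/-- After the layer-cake formula this is dominated convergence: the rescaled tail tends pointwise to
`c s^(-β)` and stays below `|K| s^(-β)`. -/
lemma tendsto_integral_primitive_of_nonneg (h : InwardFamily l Q r α β c K M)
    [l.IsCountablyGenerated] {g : ℝ → ℝ} (hgm : Measurable g) {C : ℝ} (hg0 : ∀ s, 0 ≤ g s)
    (hgb : ∀ s, g s ≤ |C|) (hg : ∀ s > 0, g s ≤ C * min s 1) :
    Tendsto (fun i => r i ^ β * ∫ η, (∫ s in (0 : ℝ)..inward (r i) η, g s) ∂(Q i)) l
      (𝓝 (∫ s in Set.Ioi 0, c * s ^ (-β) * g s)) := by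
  have := h.prob
  have hgi : ∀ a b, IntervalIntegrable g volume a b := by
    intro a b
    rw [intervalIntegrable_iff]
    refine Measure.integrableOn_of_bounded (M := |C|) (by simp [Set.uIoc])
      hgm.aestronglyMeasurable (Eventually.of_forall fun s => ?_)
    rw [Real.norm_of_nonneg (hg0 s)]
    exact hgb s
  have hGc : Continuous fun u => ∫ s in (0 : ℝ)..u, g s :=
    intervalIntegral.continuous_primitive hgi 0
  have hlim : Tendsto (fun i => ∫ s in Set.Ioi 0,
      r i ^ β * (Q i).real (Set.Iio (-(s * r i))) * g s) l
      (𝓝 (∫ s in Set.Ioi 0, c * s ^ (-β) * g s)) := by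
    refine tendsto_integral_filter_of_dominated_convergence
      (fun s => |K| * C * (s ^ (-β) * min s 1)) ?_ ?_ ?_ ?_
    · filter_upwards [h.tendsto_r.eventually_gt_atTop 0] with i hr
      exact (((measurable_tail (Q i) hr).const_mul _).mul hgm).aestronglyMeasurable
    · filter_upwards [h.tendsto_r.eventually_gt_atTop 0, h.tail_le] with i hr htail
      refine (ae_restrict_iff' measurableSet_Ioi).2 (Eventually.of_forall fun s hs => ?_)
      have hs : 0 < s := hs
      rw [Real.norm_of_nonneg (mul_nonneg (mul_nonneg (by positivity) measureReal_nonneg) (hg0 s))]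
      have h4 : r i ^ β * (Q i).real (Set.Iio (-(s * r i))) ≤ |K| * s ^ (-β) := by
        calc _ ≤ r i ^ β * (|K| * (s * r i) ^ (-β)) := by
              gcongr
              exact (htail _ (by positivity)).trans
                (mul_le_mul_of_nonneg_right (le_abs_self K) (by positivity))
          _ = |K| * s ^ (-β) * (r i ^ β * r i ^ (-β)) := by
              rw [Real.mul_rpow hs.le hr.le]; ring
          _ = _ := by rw [← Real.rpow_add hr]; simp
      calc _ ≤ |K| * s ^ (-β) * (C * min s 1) :=
            mul_le_mul h4 (hg s hs) (hg0 s) (by positivity)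
        _ = _ := by ring
    · exact (integrableOn_rpow_neg_mul_min h.one_lt h.lt_two).const_mul _
    · refine (ae_restrict_iff' measurableSet_Ioi).2 (Eventually.of_forall fun s hs => ?_)
      exact (h.tail_lim s hs).mul_const _
  refine hlim.congr' ?_
  filter_upwards [h.tendsto_r.eventually_gt_atTop 0] with i hr
  rw [integral_inward (Q i) hr hgm hg0 (fun t _ => hgi 0 t) hGc.measurable, ← integral_const_mul]
  simp_rw [mul_assoc]

/-- Weak convergence of the rescaled inward increments to the measure with tail `c s ^ (-β)`. -/
lemma tendsto_integral_primitive (h : InwardFamily l Q r α β c K M) [l.IsCountablyGenerated]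
    {g : ℝ → ℝ} (hgm : Measurable g) {C : ℝ} (hg : ∀ s > 0, |g s| ≤ C * min s 1) :
    Tendsto (fun i => r i ^ β * ∫ η, (∫ s in (0 : ℝ)..inward (r i) η, g s) ∂(Q i)) l
      (𝓝 (∫ s in Set.Ioi 0, c * s ^ (-β) * g s)) := by
  have := h.prob
  have hC : ∀ s > 0, |g s| ≤ |C| := fun s hs => by
    refine (hg s hs).trans ((le_abs_self _).trans ?_)
    rw [abs_mul, abs_of_nonneg (le_min hs.le zero_le_one)]
    exact mul_le_of_le_one_right (abs_nonneg _) (min_le_right _ _)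
  -- The layer-cake formula needs a nonnegative density, so `g` is split into positive and negative
  -- parts. They are cut off to `s > 0`, since nothing is known of `g` elsewhere and only these
  -- values matter.
  have hpart : ∀ f : ℝ → ℝ, Measurable f → (∀ s > 0, |f s| ≤ |g s|) →
      let f' := (Set.Ioi (0 : ℝ)).indicator fun s => max (f s) 0
      Measurable f' ∧ (∀ s, 0 ≤ f' s) ∧ (∀ s, f' s ≤ |C|) ∧ ∀ s > 0, f' s ≤ C * min s 1 := by
    intro f hf hfg f'
    have h1 : ∀ s > 0, f' s ≤ |g s| := fun s hs => by
      simp only [f']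
      rw [Set.indicator_of_mem (Set.mem_Ioi.2 hs)]
      exact max_le ((le_abs_self _).trans (hfg s hs)) (abs_nonneg _)
    refine ⟨(hf.max measurable_const).indicator measurableSet_Ioi,
      fun s => Set.indicator_nonneg (fun _ _ => le_max_right _ _) s, fun s => ?_,
      fun s hs => (h1 s hs).trans (hg s hs)⟩
    by_cases hs : 0 < s
    · exact (h1 s hs).trans (hC s hs)
    · simp only [f']
      rw [Set.indicator_of_notMem (fun h => hs (Set.mem_Ioi.1 h))]
      exact abs_nonneg _
  obtain ⟨p1, p2, p3, p4⟩ := hpart g hgm fun s _ => le_rfl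
  obtain ⟨n1, n2, n3, n4⟩ := hpart (fun s => -g s) hgm.neg fun s _ => (abs_neg _).le
  have hp := h.tendsto_integral_primitive_of_nonneg p1 p2 p3 p4
  have hn := h.tendsto_integral_primitive_of_nonneg n1 n2 n3 n4
  set gp := (Set.Ioi (0 : ℝ)).indicator fun s => max (g s) 0
  set gn := (Set.Ioi (0 : ℝ)).indicator fun s => max (-g s) 0
  have hsub : ∀ s > 0, g s = gp s - gn s := by
    intro s hs
    simp only [gp, gn]
    rw [Set.indicator_of_mem (Set.mem_Ioi.2 hs), Set.indicator_of_mem (Set.mem_Ioi.2 hs)]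
    rcases le_total 0 (g s) with h0 | h0
    · rw [max_eq_left h0, max_eq_right (by linarith)]; ring
    · rw [max_eq_right h0, max_eq_left (by linarith)]; ring
  have hintp : ∀ f : ℝ → ℝ, Measurable f → (∀ s, 0 ≤ f s) → (∀ s > 0, f s ≤ C * min s 1) →
      IntegrableOn (fun s => c * s ^ (-β) * f s) (Set.Ioi 0) := by
    intro f hf hf0 hfC
    refine Integrable.mono' ((integrableOn_rpow_neg_mul_min h.one_lt h.lt_two).const_mul (c * C))
      (by fun_prop) ((ae_restrict_iff' measurableSet_Ioi).2 (Eventually.of_forall fun s hs => ?_))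
    have hs : 0 < s := hs
    have hc := h.c_pos
    rw [Real.norm_of_nonneg (mul_nonneg (by positivity) (hf0 s))]
    calc _ ≤ c * s ^ (-β) * (C * min s 1) := by gcongr; exact hfC s hs
      _ = _ := by ring
  have hlimit : ∫ s in Set.Ioi 0, c * s ^ (-β) * g s =
      (∫ s in Set.Ioi 0, c * s ^ (-β) * gp s) - ∫ s in Set.Ioi 0, c * s ^ (-β) * gn s := by
    rw [← integral_sub (hintp gp p1 p2 p4) (hintp gn n1 n2 n4)]
    refine setIntegral_congr_fun measurableSet_Ioi fun s hs => ?_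
    rw [hsub s hs]; ring
  rw [hlimit]
  refine (hp.sub hn).congr' ?_
  filter_upwards [h.tendsto_r.eventually_gt_atTop 0, h.integrable] with i hr hint
  have hII : ∀ f : ℝ → ℝ, Measurable f → (∀ s, 0 ≤ f s) → (∀ s, f s ≤ |C|) → ∀ a b,
      IntervalIntegrable f volume a b := by
    intro f hf hf0 hfC a b
    rw [intervalIntegrable_iff]
    refine Measure.integrableOn_of_bounded (M := |C|) (by simp [Set.uIoc])
      hf.aestronglyMeasurable (Eventually.of_forall fun s => ?_)
    rw [Real.norm_of_nonneg (hf0 s)]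
    exact hfC s
  have hinw : Integrable (fun η => |C| * inward (r i) η) (Q i) := by
    refine Integrable.const_mul ?_ _
    refine Integrable.mono' (hint.abs.div_const (r i)) (by fun_prop)
      (Eventually.of_forall fun η => ?_)
    rw [Real.norm_of_nonneg (inward_nonneg hr η), inward]
    gcongr
    exact max_le (neg_le_abs η) (abs_nonneg η)
  have hGI : ∀ f : ℝ → ℝ, Measurable f → (∀ s, 0 ≤ f s) → (∀ s, f s ≤ |C|) →
      (∀ s > 0, f s ≤ C * min s 1) →
      Integrable (fun η => ∫ s in (0 : ℝ)..inward (r i) η, f s) (Q i) := by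
    intro f hf hf0 hfC hfm
    refine Integrable.mono' hinw ?_ (Eventually.of_forall fun η => ?_)
    · exact ((intervalIntegral.continuous_primitive (hII f hf hf0 hfC) 0).measurable.comp
        (measurable_inward _)).aestronglyMeasurable
    · exact abs_integral_le_of_abs_le_min (fun s hs => by rw [abs_of_nonneg (hf0 s)]; exact hfm s hs)
        (inward_nonneg hr η)
  rw [← mul_sub, ← integral_sub (hGI gp p1 p2 p3 p4) (hGI gn n1 n2 n3 n4)]
  congr 1
  refine integral_congr_ae (Eventually.of_forall fun η => ?_)
  dsimp only
  rw [← intervalIntegral.integral_sub (hII gp p1 p2 p3 _ _) (hII gn n1 n2 n3 _ _)]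
  refine intervalIntegral.integral_congr_ae (Eventually.of_forall fun s hs => ?_)
  rw [Set.uIoc_of_le (inward_nonneg hr η)] at hs
  exact (hsub s hs.1).symm

end InwardFamily

end Increments


/-! ### The principal value integral and the cotangent -/

section Cotangent

lemma rpow_neg_sub_one_le {p s : ℝ} (hp0 : 0 ≤ p) (hp1 : p ≤ 1) (hs : 1 / 2 ≤ s) (hs1 : s < 1) :
    s ^ (-p) ≤ 1 + 2 * (1 - s) := by
  have hs0 : 0 < s := by linarith
  have h := rpow_one_add_le_one_add_mul_self (s := s⁻¹ - 1)
    (by have : 0 < s⁻¹ := by positivity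
        linarith) hp0 hp1
  rw [add_sub_cancel, Real.inv_rpow hs0.le, ← Real.rpow_neg hs0.le] at h
  have h1 : s⁻¹ - 1 ≤ 2 * (1 - s) := by
    rw [show s⁻¹ - 1 = (1 - s) / s by field_simp, div_le_iff₀ hs0]
    nlinarith
  have h2 : 0 ≤ s⁻¹ - 1 := by
    have := one_le_inv_iff₀.2 ⟨hs0, hs1.le⟩
    linarith
  nlinarith

/-- The folded form of the principal value integrand `s ^ (1 - β) / (s - 1)`. -/
def foldedKernel (β s : ℝ) : ℝ := (s ^ (β - 2) - s ^ (1 - β)) / (1 - s)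

/-- The numerator vanishes at `s = 1`, by Bernoulli's inequality at rate `2 (1 - s)`, which cancels
the pole. Near `0` both powers are integrable since `1 < β < 2`. -/
lemma abs_foldedKernel_le {β s : ℝ} (h1 : 1 < β) (h2 : β < 2) (hs0 : 0 < s) (hs1 : s < 1) :
    |foldedKernel β s| ≤ 2 * (s ^ (β - 2) + s ^ (1 - β)) + 2 := by
  have ha : 0 < s ^ (β - 2) := by positivity
  have hb : 0 < s ^ (1 - β) := by positivity
  rw [foldedKernel, abs_div, abs_of_pos (by linarith : 0 < 1 - s), div_le_iff₀ (by linarith)]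
  rcases le_total s (1 / 2) with h | h
  · have : |s ^ (β - 2) - s ^ (1 - β)| ≤ s ^ (β - 2) + s ^ (1 - β) :=
      abs_le.2 ⟨by linarith, by linarith⟩
    nlinarith
  · have e1 := rpow_neg_sub_one_le (p := 2 - β) (by linarith) (by linarith) h hs1
    have e2 := rpow_neg_sub_one_le (p := β - 1) (by linarith) (by linarith) h hs1
    rw [neg_sub] at e1 e2
    have e3 : 1 ≤ s ^ (β - 2) := Real.one_le_rpow_of_pos_of_le_one_of_nonpos hs0 hs1.le (by linarith)
    have e4 : 1 ≤ s ^ (1 - β) := Real.one_le_rpow_of_pos_of_le_one_of_nonpos hs0 hs1.le (by linarith)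
    have : |s ^ (β - 2) - s ^ (1 - β)| ≤ 2 * (1 - s) := abs_le.2 ⟨by linarith, by linarith⟩
    nlinarith

lemma integrableOn_rpow_Ioo {p : ℝ} (hp : -1 < p) :
    IntegrableOn (fun s : ℝ => s ^ p) (Set.Ioo 0 1) :=
  ((intervalIntegrable_iff_integrableOn_Ioc_of_le zero_le_one).1
    (intervalIntegral.intervalIntegrable_rpow' hp)).mono_set Set.Ioo_subset_Ioc_self

lemma integral_rpow_Ioo {p : ℝ} (hp : -1 < p) : ∫ s in Set.Ioo (0 : ℝ) 1, s ^ p = 1 / (p + 1) := by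
  rw [← integral_Ioc_eq_integral_Ioo, ← intervalIntegral.integral_of_le zero_le_one,
    integral_rpow (Or.inl hp), Real.one_rpow, Real.zero_rpow (by linarith), sub_zero]

lemma integrableOn_foldedBound {β : ℝ} (h1 : 1 < β) (h2 : β < 2) (C : ℝ) :
    IntegrableOn (fun s : ℝ => 2 * (s ^ (β - 2) + s ^ (1 - β)) + C) (Set.Ioo 0 1) :=
  Integrable.add (((integrableOn_rpow_Ioo (by linarith)).add
    (integrableOn_rpow_Ioo (by linarith))).const_mul 2) (by simp)

/-- The Mittag-Leffler expansion with its terms paired differently: the partial sums of the two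
pairings differ by `1/a - 1/(a + N)`. In this pairing the terms are the integrals of powers that
arise in `integral_foldedKernel`. -/
lemma hasSum_cot {a : ℝ} (ha0 : 0 < a) (ha1 : a < 1) :
    HasSum (fun n : ℕ => 1 / (n + a) - 1 / (n + 1 - a)) (Real.pi * Real.cot (Real.pi * a)) := by
  have hz : (a : ℂ) ∈ Complex.integerComplement := by
    rintro ⟨n, hn⟩
    have hn : (n : ℝ) = a := by exact_mod_cast hn
    rw [← hn] at ha0 ha1
    have : 0 < n := by exact_mod_cast ha0
    have : n < 1 := by exact_mod_cast ha1
    omega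
  have hs := (summable_cotTerm hz).hasSum
  have hval := cot_series_rep' hz
  have hs' : HasSum (fun n : ℕ => 1 / (a - (n + 1)) + 1 / (a + (n + 1)))
      (Real.pi * Real.cot (Real.pi * a) - 1 / a) := by
    have : HasSum (fun n : ℕ => cotTerm (a : ℂ) n)
        ((Real.pi * Real.cot (Real.pi * a) - 1 / a : ℝ) : ℂ) := by
      push_cast
      rw [hval]
      exact hs
    rw [← Complex.hasSum_ofReal]
    convert this using 2 with n
    simp [cotTerm]
  have hsq : Summable fun n : ℕ => 1 / ((n : ℝ) + a) - 1 / (n + 1 - a) := by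
    have hb : Summable fun n : ℕ => (2 / ((1 - a) * a)) * (1 / ((n : ℝ) + 1) ^ 2) := by
      refine Summable.mul_left _ ?_
      have := (summable_nat_add_iff 1).2 (Real.summable_one_div_nat_pow.2 one_lt_two)
      simpa using this
    refine Summable.of_norm_bounded hb fun n => ?_
    have hn : (0 : ℝ) ≤ n := n.cast_nonneg
    have p1 : 0 < (n : ℝ) + a := by linarith
    have p2 : 0 < (n : ℝ) + 1 - a := by linarith
    have q1 : a * (n + 1) ≤ n + a := by nlinarith
    have q2 : (1 - a) * (n + 1) ≤ n + 1 - a := by nlinarith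
    rw [div_sub_div _ _ p1.ne' p2.ne', norm_div, Real.norm_of_nonneg (mul_pos p1 p2).le,
      div_mul_div_comm, div_le_div_iff₀ (mul_pos p1 p2) (by have := sub_pos.2 ha1; positivity)]
    have e1 : ‖1 * ((n : ℝ) + 1 - a) - (n + a) * 1‖ ≤ 2 := by
      rw [Real.norm_eq_abs, abs_le]; constructor <;> linarith
    have e2 : (1 - a) * (n + 1) * (a * (n + 1)) ≤ (n + 1 - a) * (n + a) :=
      mul_le_mul q2 q1 (by positivity) p2.le
    have e3 : 0 ≤ (1 - a) * a * ((n : ℝ) + 1) ^ 2 := by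
      have := sub_pos.2 ha1; positivity
    calc _ ≤ 2 * ((1 - a) * a * ((n : ℝ) + 1) ^ 2) := by gcongr
      _ ≤ _ := by nlinarith
  refine (hsq.hasSum_iff_tendsto_nat).2 ?_
  have hps : ∀ N : ℕ, ∑ n ∈ Finset.range N, (1 / ((n : ℝ) + a) - 1 / (n + 1 - a)) =
      1 / a + ∑ n ∈ Finset.range N, (1 / (a - (n + 1)) + 1 / (a + (n + 1))) - 1 / (a + N) := by
    intro N
    induction N with
    | zero => simp
    | succ N ih =>
      rw [Finset.sum_range_succ, Finset.sum_range_succ, ih]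
      have : 1 / (a - (N + 1)) = - (1 / (N + 1 - a)) := by
        rw [← one_div_neg_eq_neg_one_div, neg_sub]
      rw [this]
      push_cast
      rw [add_comm (N : ℝ) a]
      ring
  simp_rw [hps]
  have ht := hs'.tendsto_sum_nat
  have ht2 : Tendsto (fun N : ℕ => 1 / (a + (N : ℝ))) atTop (𝓝 0) :=
    tendsto_const_nhds.div_atTop (tendsto_atTop_add_const_left _ a tendsto_natCast_atTop_atTop)
  have := (ht.const_add (1 / a)).sub ht2
  convert this using 2
  ring

/-- Expand `1 / (1 - s)` in a geometric series and integrate term by term; the result is the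
cotangent series at `β - 1`. The exchange is legitimate because the partial sums are the kernel
times `1 - s^N`, hence dominated by the kernel. -/
lemma integral_foldedKernel {β : ℝ} (h1 : 1 < β) (h2 : β < 2) :
    ∫ s in Set.Ioo (0 : ℝ) 1, foldedKernel β s = Real.pi * Real.cot (Real.pi * β) := by
  have hcot : Real.cot (Real.pi * β) = Real.cot (Real.pi * (β - 1)) := by
    rw [Real.cot_eq_cos_div_sin, Real.cot_eq_cos_div_sin, mul_sub, mul_one, Real.cos_sub_pi,
      Real.sin_sub_pi, neg_div_neg_eq]
  have hsum := hasSum_cot (a := β - 1) (by linarith) (by linarith)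
  rw [← hcot] at hsum
  let F : ℕ → ℝ → ℝ := fun n s => s ^ (n + (β - 2) : ℝ) - s ^ (n + (1 - β) : ℝ)
  have hp1 : ∀ n : ℕ, -1 < (n + (β - 2) : ℝ) := fun n => by
    have : (0 : ℝ) ≤ n := n.cast_nonneg
    linarith
  have hp2 : ∀ n : ℕ, -1 < (n + (1 - β) : ℝ) := fun n => by
    have : (0 : ℝ) ≤ n := n.cast_nonneg
    linarith
  have hFi : ∀ n, IntegrableOn (F n) (Set.Ioo 0 1) := fun n =>
    (integrableOn_rpow_Ioo (hp1 n)).sub (integrableOn_rpow_Ioo (hp2 n))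
  have hFv : ∀ n, ∫ s in Set.Ioo (0 : ℝ) 1, F n s = 1 / (n + (β - 1)) - 1 / (n + 1 - (β - 1)) := by
    intro n
    rw [integral_sub (integrableOn_rpow_Ioo (hp1 n)) (integrableOn_rpow_Ioo (hp2 n)),
      integral_rpow_Ioo (hp1 n), integral_rpow_Ioo (hp2 n)]
    ring_nf
  have hFs : ∀ s ∈ Set.Ioo (0 : ℝ) 1, HasSum (fun n => F n s) (foldedKernel β s) := by
    intro s hs
    have hg := (hasSum_geometric_of_lt_one hs.1.le hs.2).mul_left (s ^ (β - 2) - s ^ (1 - β))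
    rw [← div_eq_mul_inv] at hg
    refine hg.congr_fun ?_ |> fun h => h
    intro n
    simp only [F]
    rw [Real.rpow_add hs.1, Real.rpow_add hs.1, Real.rpow_natCast]
    ring
  have hpart : ∀ N : ℕ, ∫ s in Set.Ioo (0 : ℝ) 1, ∑ n ∈ Finset.range N, F n s =
      ∑ n ∈ Finset.range N, (1 / ((n : ℝ) + (β - 1)) - 1 / (n + 1 - (β - 1))) := by
    intro N
    rw [integral_finsetSum _ fun n _ => hFi n]
    exact Finset.sum_congr rfl fun n _ => hFv n
  have hlim : Tendsto (fun N : ℕ => ∫ s in Set.Ioo (0 : ℝ) 1, ∑ n ∈ Finset.range N, F n s) atTop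
      (𝓝 (∫ s in Set.Ioo (0 : ℝ) 1, foldedKernel β s)) := by
    refine tendsto_integral_of_dominated_convergence
      (fun s => 2 * (s ^ (β - 2) + s ^ (1 - β)) + 2) (fun N => ?_)
      (integrableOn_foldedBound h1 h2 2) (fun N => ?_) ?_
    · exact Measurable.aestronglyMeasurable (by fun_prop)
    · refine (ae_restrict_iff' measurableSet_Ioo).2 (Eventually.of_forall fun s hs => ?_)
      have : ∑ n ∈ Finset.range N, F n s = foldedKernel β s * (1 - s ^ N) := by
        have hF : ∀ n, F n s = (s ^ (β - 2) - s ^ (1 - β)) * s ^ n := fun n => by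
          simp only [F]
          rw [Real.rpow_add hs.1, Real.rpow_add hs.1, Real.rpow_natCast]
          ring
        simp_rw [hF]
        rw [← Finset.mul_sum, geom_sum_eq hs.2.ne, foldedKernel,
          ← neg_div_neg_eq (s ^ N - 1), neg_sub, neg_sub]
        ring
      rw [this, norm_mul]
      have hsN : s ^ N ≤ 1 := pow_le_one₀ hs.1.le hs.2.le
      have hsN0 : 0 ≤ s ^ N := pow_nonneg hs.1.le N
      refine (mul_le_of_le_one_right (norm_nonneg _) ?_).trans
        (abs_foldedKernel_le h1 h2 hs.1 hs.2)
      rw [Real.norm_of_nonneg (by linarith)]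
      linarith
    · refine (ae_restrict_iff' measurableSet_Ioo).2 (Eventually.of_forall fun s hs => ?_)
      exact (hFs s hs).tendsto_sum_nat
  simp_rw [hpart] at hlim
  exact tendsto_nhds_unique hlim hsum.tendsto_sum_nat

/-- A version of `u ↦ u + log |1 - u|` with the singularity removed. -/
def cutLog (ε u : ℝ) : ℝ := u + Real.log (max |1 - u| (ε * (1 + u)))

/-- The derivative of `cutLog`. -/
def cutLogDeriv (ε s : ℝ) : ℝ := if |1 - s| ≤ ε * (1 + s) then 1 + 1 / (1 + s) else s / (s - 1)

@[fun_prop]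
lemma measurable_cutLog (ε : ℝ) : Measurable (cutLog ε) := by
  unfold cutLog; fun_prop

@[fun_prop]
lemma measurable_cutLogDeriv (ε : ℝ) : Measurable (cutLogDeriv ε) := by
  unfold cutLogDeriv
  refine Measurable.ite (measurableSet_le (by fun_prop) (by fun_prop)) (by fun_prop) (by fun_prop)

lemma half_le_of_abs_le {ε s : ℝ} (hε : ε ≤ 1 / 4) (hs : 0 ≤ s)
    (h : |1 - s| ≤ ε * (1 + s)) : 1 / 2 ≤ s ∧ s ≤ 2 := by
  have h1 := abs_le.1 h
  constructor <;> nlinarith [h1.1, h1.2]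

/-- The derivative of `u + log|1 - u|` vanishes linearly at `0` and is bounded at infinity; the cut
removes the pole at the price of `ε⁻¹`. This places `cutLogDeriv` within reach of
`tendsto_integral_primitive`. -/
lemma abs_cutLogDeriv_le {ε s : ℝ} (hε0 : 0 < ε) (hε : ε ≤ 1 / 4) (hs : 0 < s) :
    |cutLogDeriv ε s| ≤ (4 + ε⁻¹) * min s 1 := by
  have hei : 0 < ε⁻¹ := by positivity
  unfold cutLogDeriv
  split_ifs with h
  · obtain ⟨h1, -⟩ := half_le_of_abs_le hε hs.le h
    have h2 : 1 / 2 ≤ min s 1 := le_min h1 (by norm_num)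
    have h3 : 1 / (1 + s) ≤ 1 := by rw [div_le_one (by linarith)]; linarith
    have h4 : 0 < 1 / (1 + s) := by positivity
    rw [abs_of_pos (by linarith)]
    nlinarith
  · push Not at h
    have hpos : 0 < |1 - s| := lt_of_le_of_lt (by positivity) h
    rw [abs_div, abs_sub_comm, abs_of_pos hs, div_le_iff₀ hpos]
    have h6 : 1 ≤ ε⁻¹ * |1 - s| := by
      have : ε ≤ |1 - s| := by nlinarith
      calc 1 = ε⁻¹ * ε := by field_simp
        _ ≤ _ := by gcongr
    rcases le_total s 1 with h5 | h5
    · rw [min_eq_left h5]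
      nlinarith [mul_nonneg hs.le hpos.le]
    · rw [min_eq_right h5]
      have : |1 - s| = s - 1 := by rw [abs_of_nonpos (by linarith)]; ring
      rw [this] at h6 ⊢
      nlinarith

lemma integral_cutLogDeriv {ε u : ℝ} (hε0 : 0 < ε) (hε : ε ≤ 1 / 4) (hu : 0 ≤ u) :
    ∫ s in (0 : ℝ)..u, cutLogDeriv ε s = cutLog ε u := by
  have h0 : cutLog ε 0 = 0 := by
    simp [cutLog, max_eq_left (show ε ≤ 1 by linarith)]
  have hpos : ∀ s, 0 ≤ s → 0 < max |1 - s| (ε * (1 + s)) := fun s hs =>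
    lt_max_of_lt_right (by positivity)
  rw [show cutLog ε u = cutLog ε u - cutLog ε 0 by rw [h0, sub_zero]]
  rcases hu.eq_or_lt with rfl | hu0
  · simp
  -- The two excluded points are where `|1 - s| = ε (1 + s)`, the kinks of the maximum.
  refine integral_eq_of_hasDerivAt_off_countable_of_le (cutLog ε) (cutLogDeriv ε) hu
    (s := {(1 - ε) / (1 + ε), (1 + ε) / (1 - ε)}) (Set.to_countable _) ?_ ?_
    (intervalIntegrable_of_abs_le_min (measurable_cutLogDeriv ε)
      (fun s hs => abs_cutLogDeriv_le hε0 hε hs) hu0)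
  · refine ContinuousOn.add continuousOn_id (ContinuousOn.log (by fun_prop) ?_)
    intro s hs
    exact (hpos s hs.1).ne'
  · rintro s ⟨hs, hne⟩
    have hs0 : 0 < s := hs.1
    simp only [Set.mem_insert_iff, Set.mem_singleton_iff, not_or] at hne
    have hneq : |1 - s| ≠ ε * (1 + s) := by
      intro heq
      rcases abs_cases (1 - s) with ⟨h, -⟩ | ⟨h, -⟩
      · apply hne.1
        rw [eq_div_iff (by linarith)]
        linarith
      · apply hne.2
        rw [eq_div_iff (by linarith)]
        linarith
    have hc1 : Continuous fun s : ℝ => |1 - s| := by fun_prop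
    have hc2 : Continuous fun s : ℝ => ε * (1 + s) := by fun_prop
    rcases lt_or_gt_of_ne hneq with hlt | hgt
    · rw [cutLogDeriv, if_pos hlt.le]
      have hd : HasDerivAt (fun s : ℝ => s + Real.log (ε * (1 + s))) (1 + 1 / (1 + s)) s := by
        have h1 : HasDerivAt (fun s : ℝ => ε * (1 + s)) ε s := by
          simpa using ((hasDerivAt_id s).const_add 1).const_mul ε
        have h2 := (hasDerivAt_id s).add (h1.log (by positivity))
        refine HasDerivAt.congr_deriv h2 ?_
        field_simp
      refine hd.congr_of_eventuallyEq ?_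
      filter_upwards [(isOpen_lt hc1 hc2).mem_nhds hlt] with y hy
      rw [cutLog, max_eq_right (le_of_lt hy)]
    · rw [cutLogDeriv, if_neg (not_le.2 hgt)]
      have hs1 : 1 - s ≠ 0 := by
        intro h
        rw [h, abs_zero] at hgt
        nlinarith
      have hs1' : s - 1 ≠ 0 := fun h => hs1 (by linarith)
      have hd : HasDerivAt (fun s : ℝ => s + Real.log (1 - s)) (s / (s - 1)) s := by
        have h1 : HasDerivAt (fun s : ℝ => 1 - s) (-1) s := by
          simpa using (hasDerivAt_id s).const_sub 1
        have h2 := (hasDerivAt_id s).add (h1.log hs1)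
        refine HasDerivAt.congr_deriv h2 ?_
        rw [show (1 : ℝ) - s = -(s - 1) by ring]
        field_simp
        ring
      refine hd.congr_of_eventuallyEq ?_
      filter_upwards [(isOpen_lt hc2 hc1).mem_nhds hgt] with y hy
      rw [cutLog, max_eq_left (le_of_lt hy), Real.log_abs]

lemma integrableOn_mul_cutLogDeriv {β ε : ℝ} (h1 : 1 < β) (h2 : β < 2) (hε0 : 0 < ε)
    (hε : ε ≤ 1 / 4) :
    IntegrableOn (fun s : ℝ => s ^ (-β) * cutLogDeriv ε s) (Set.Ioi 0) := by
  refine Integrable.mono' ((integrableOn_rpow_neg_mul_min h1 h2).const_mul (4 + ε⁻¹))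
    (by fun_prop) ((ae_restrict_iff' measurableSet_Ioi).2 (Eventually.of_forall fun s hs => ?_))
  have hs : 0 < s := hs
  rw [norm_mul, Real.norm_of_nonneg (by positivity)]
  calc _ ≤ s ^ (-β) * ((4 + ε⁻¹) * min s 1) := by
        gcongr; exact abs_cutLogDeriv_le hε0 hε hs
    _ = _ := by ring

/-- The substitution `s ↦ s⁻¹` folds the part beyond `1` onto the unit interval, so that the two
sides of the pole face each other. -/
lemma integral_mul_cutLogDeriv_eq {β ε : ℝ} (h1 : 1 < β) (h2 : β < 2) (hε0 : 0 < ε)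
    (hε : ε ≤ 1 / 4) :
    ∫ s in Set.Ioi (0 : ℝ), s ^ (-β) * cutLogDeriv ε s =
      ∫ s in Set.Ioo (0 : ℝ) 1,
        (s ^ (-β) * cutLogDeriv ε s + s ^ (β - 2) * cutLogDeriv ε s⁻¹) := by
  have hi := integrableOn_mul_cutLogDeriv h1 h2 hε0 hε
  have himg : (fun s : ℝ => s⁻¹) '' Set.Ioo 0 1 = Set.Ioi 1 := by
    ext s
    constructor
    · rintro ⟨t, ht, rfl⟩
      exact (one_lt_inv₀ ht.1).2 ht.2
    · intro hs
      have hs : 1 < s := hs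
      exact ⟨s⁻¹, ⟨by positivity, inv_lt_one_of_one_lt₀ hs⟩, inv_inv s⟩
  have hder : ∀ s ∈ Set.Ioo (0 : ℝ) 1,
      HasDerivWithinAt (fun s : ℝ => s⁻¹) (-(s ^ 2)⁻¹) (Set.Ioo 0 1) s := fun s hs =>
    (hasDerivAt_inv hs.1.ne').hasDerivWithinAt
  have hinj : Set.InjOn (fun s : ℝ => s⁻¹) (Set.Ioo 0 1) := inv_injective.injOn
  have hi1 : IntegrableOn (fun s : ℝ => s ^ (-β) * cutLogDeriv ε s) (Set.Ioi 1) :=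
    hi.mono_set (Set.Ioi_subset_Ioi zero_le_one)
  have hcongr : ∀ s ∈ Set.Ioo (0 : ℝ) 1, |-(s ^ 2)⁻¹| • ((s⁻¹) ^ (-β) * cutLogDeriv ε s⁻¹) =
      s ^ (β - 2) * cutLogDeriv ε s⁻¹ := by
    intro s hs
    rw [abs_neg, abs_of_pos (by have := hs.1; positivity), smul_eq_mul, Real.inv_rpow hs.1.le,
      ← Real.rpow_neg hs.1.le, neg_neg, ← mul_assoc, ← Real.rpow_natCast, ← Real.rpow_neg hs.1.le,
      ← Real.rpow_add hs.1]
    congr 2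
    push_cast
    ring
  have hfold : ∫ s in Set.Ioi (1 : ℝ), s ^ (-β) * cutLogDeriv ε s =
      ∫ s in Set.Ioo (0 : ℝ) 1, s ^ (β - 2) * cutLogDeriv ε s⁻¹ := by
    rw [← himg, integral_image_eq_integral_abs_deriv_smul measurableSet_Ioo hder hinj]
    exact setIntegral_congr_fun measurableSet_Ioo hcongr
  have hfi : IntegrableOn (fun s : ℝ => s ^ (β - 2) * cutLogDeriv ε s⁻¹) (Set.Ioo 0 1) := by
    rw [← himg, integrableOn_image_iff_integrableOn_abs_deriv_smul measurableSet_Ioo hder hinj]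
      at hi1
    exact hi1.congr_fun hcongr measurableSet_Ioo
  rw [← Set.Ioc_union_Ioi_eq_Ioi zero_le_one,
    setIntegral_union (Set.Ioc_disjoint_Ioi le_rfl) measurableSet_Ioi
      (hi.mono_set Set.Ioc_subset_Ioi_self) hi1, hfold, integral_Ioc_eq_integral_Ioo,
    integral_add (hi.mono_set Set.Ioo_subset_Ioi_self) hfi]

/-- The cut `|1 - s| ≤ ε (1 + s)` is invariant under `s ↦ s⁻¹`, so `s` and its reciprocal are cut
together. Off the cut the folded integrand is exactly `foldedKernel`; on it both derivatives are at
most `2` and `s ≥ 1/2`, which gives domination. -/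
lemma tendsto_integral_mul_cutLogDeriv {β : ℝ} (h1 : 1 < β) (h2 : β < 2) :
    Tendsto (fun ε => ∫ s in Set.Ioi (0 : ℝ), s ^ (-β) * cutLogDeriv ε s) (𝓝[>] 0)
      (𝓝 (Real.pi * Real.cot (Real.pi * β))) := by
  rw [← integral_foldedKernel h1 h2]
  have hev : ∀ᶠ ε : ℝ in 𝓝[>] 0, 0 < ε ∧ ε ≤ 1 / 4 := by
    filter_upwards [Ioc_mem_nhdsGT (show (0 : ℝ) < 1 / 4 by norm_num)] with ε hε using hε
  have heq : ∀ ε s : ℝ, 0 < s → s < 1 → ε * (1 + s) < 1 - s →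
      s ^ (-β) * cutLogDeriv ε s + s ^ (β - 2) * cutLogDeriv ε s⁻¹ = foldedKernel β s := by
    intro ε s hs0 hs1 hlt
    have c1 : ¬ |1 - s| ≤ ε * (1 + s) := by
      rw [abs_of_pos (by linarith)]; exact not_le.2 hlt
    have c2 : ¬ |1 - s⁻¹| ≤ ε * (1 + s⁻¹) := by
      have : |1 - s⁻¹| = (1 - s) / s := by
        rw [abs_sub_comm, abs_of_nonneg (sub_nonneg.2 (one_le_inv_iff₀.2 ⟨hs0, hs1.le⟩))]
        field_simp
      rw [this, not_le, lt_div_iff₀ hs0]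
      field_simp
      linarith
    rw [cutLogDeriv, if_neg c1, cutLogDeriv, if_neg c2, foldedKernel]
    have e1 : s⁻¹ / (s⁻¹ - 1) = 1 / (1 - s) := by
      have : 1 - s ≠ 0 := by linarith
      rw [div_eq_div_iff (by
        have := (one_lt_inv₀ hs0).2 hs1
        linarith) this]
      field_simp
    have e2 : s ^ (-β) * (s / (s - 1)) = - (s ^ (1 - β) / (1 - s)) := by
      rw [show s ^ (1 - β) = s ^ (-β) * s by
        rw [← Real.rpow_add_one hs0.ne']; congr 1; ring, ← neg_sub 1 s, div_neg]
      ring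
    rw [e1, e2]
    ring
  have hlim : Tendsto (fun ε => ∫ s in Set.Ioo (0 : ℝ) 1,
      (s ^ (-β) * cutLogDeriv ε s + s ^ (β - 2) * cutLogDeriv ε s⁻¹)) (𝓝[>] 0)
      (𝓝 (∫ s in Set.Ioo (0 : ℝ) 1, foldedKernel β s)) := by
    refine tendsto_integral_filter_of_dominated_convergence
      (fun s => 2 * (s ^ (β - 2) + s ^ (1 - β)) + 16) ?_ ?_ (integrableOn_foldedBound h1 h2 16) ?_
    · exact Eventually.of_forall fun ε => Measurable.aestronglyMeasurable (by fun_prop)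
    · filter_upwards [hev] with ε hε
      refine (ae_restrict_iff' measurableSet_Ioo).2 (Eventually.of_forall fun s hs => ?_)
      rcases lt_or_ge (ε * (1 + s)) (1 - s) with hlt | hge
      · rw [heq ε s hs.1 hs.2 hlt]
        exact (abs_foldedKernel_le h1 h2 hs.1 hs.2).trans (by linarith)
      · have c1 : |1 - s| ≤ ε * (1 + s) := by rwa [abs_of_pos (by linarith [hs.2])]
        have c2 : |1 - s⁻¹| ≤ ε * (1 + s⁻¹) := by
          have : |1 - s⁻¹| = (1 - s) / s := by
            rw [abs_sub_comm, abs_of_nonneg (sub_nonneg.2 (one_le_inv_iff₀.2 ⟨hs.1, hs.2.le⟩))]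
            have := hs.1
            field_simp
          rw [this, div_le_iff₀ hs.1]
          have := hs.1
          field_simp
          linarith
        obtain ⟨hs2, -⟩ := half_le_of_abs_le hε.2 hs.1.le c1
        rw [cutLogDeriv, if_pos c1, cutLogDeriv, if_pos c2]
        have hsp := hs.1
        have e1 : s ^ (-β) ≤ 4 := by
          calc s ^ (-β) ≤ (1 / 2 : ℝ) ^ (-β) :=
                Real.rpow_le_rpow_of_nonpos (by norm_num) hs2 (by linarith)
            _ ≤ (1 / 2 : ℝ) ^ (-2 : ℝ) :=
                Real.rpow_le_rpow_of_exponent_ge (by norm_num) (by norm_num) (by linarith)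
            _ = 4 := by
                rw [Real.rpow_neg (by norm_num), Real.rpow_two]; norm_num
        have e2 : 1 / (1 + s) ≤ 1 := by rw [div_le_one (by linarith)]; linarith
        have e3 : 1 / (1 + s⁻¹) ≤ 1 := by
          have : 0 < s⁻¹ := by positivity
          rw [div_le_one (by linarith)]; linarith
        have e0 : 0 < s ^ (-β) := by positivity
        have e4 : 0 < s ^ (β - 2) := by positivity
        have e5 : 0 < s ^ (1 - β) := by positivity
        have e6 : 0 < 1 / (1 + s) := by positivity
        have e7 : 0 < 1 / (1 + s⁻¹) := by positivity
        rw [Real.norm_of_nonneg (by positivity)]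
        nlinarith
    · refine (ae_restrict_iff' measurableSet_Ioo).2 (Eventually.of_forall fun s hs => ?_)
      refine tendsto_const_nhds.congr' ?_
      have hpos : 0 < (1 - s) / 2 := by linarith [hs.2]
      filter_upwards [Ioo_mem_nhdsGT hpos] with ε hε
      refine (heq ε s hs.1 hs.2 ?_).symm
      nlinarith [hε.1, hε.2, hs.1, hs.2]
  refine hlim.congr' ?_
  filter_upwards [hev] with ε hε
  exact (integral_mul_cutLogDeriv_eq h1 h2 hε.1 hε.2).symm

end Cotangent


/-! ### One-step drift estimates for the Lyapunov functions -/

section OneStep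

lemma lintegral_ofReal_le {Q : Measure ℝ} [IsProbabilityMeasure Q] {f h : ℝ → ℝ} {a : ℝ}
    (hf0 : ∀ η, 0 ≤ f η) (hfh : ∀ η, f η ≤ a + h η) (hi : Integrable h Q) :
    ∫⁻ η, ENNReal.ofReal (f η) ∂Q ≤ ENNReal.ofReal (a + ∫ η, h η ∂Q) := by
  have hi' : Integrable (fun η => a + h η) Q := (integrable_const a).add hi
  calc ∫⁻ η, ENNReal.ofReal (f η) ∂Q ≤ ∫⁻ η, ENNReal.ofReal (a + h η) ∂Q :=
        lintegral_mono fun η => ENNReal.ofReal_le_ofReal (hfh η)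
    _ = ENNReal.ofReal (∫ η, (a + h η) ∂Q) :=
        (ofReal_integral_eq_lintegral_ofReal hi'
          (Eventually.of_forall fun η => (hf0 η).trans (hfh η))).symm
    _ = _ := by rw [integral_add (integrable_const a) hi]; simp

lemma posLog_add_eq {r : ℝ} (hr : 0 < r) (η : ℝ) :
    Real.posLog (r + η) = Real.log r + Real.log (max |1 + η / r| (1 / r)) := by
  have h1 : r * max |1 + η / r| (1 / r) = max 1 |r + η| := by
    rw [mul_max_of_nonneg _ _ hr.le, max_comm, mul_one_div_cancel hr.ne']
    congr 1
    rw [show r + η = r * (1 + η / r) by field_simp, abs_mul, abs_of_pos hr]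
  rw [← Real.log_mul hr.ne' (lt_max_of_lt_right (by positivity)).ne', h1,
    ← Real.posLog_abs, Real.posLog_eq_log_max_one (abs_nonneg _)]

lemma posLog_eq_log {r : ℝ} (hr : 1 ≤ r) : Real.posLog r = Real.log r :=
  Real.posLog_eq_log (by rwa [abs_of_nonneg (by linarith)])

lemma neg_inward {r η : ℝ} (hη : η ≤ 0) : η / r + inward r η = 0 := by
  rw [inward_of_nonpos hη, neg_div, add_neg_cancel]

lemma cutLog_zero {ε : ℝ} (hε : ε ≤ 1) : cutLog ε 0 = 0 := by
  simp [cutLog, max_eq_left hε]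

/-- Outwards this is `log (1 + t) ≤ t`. Inwards the linear part of `cutLog` cancels `η / r`, and
raising the floor from `1 / r` to `ε (1 + u)` only increases the logarithm. The mean of `η / r` is
thus exactly the drift, and the rest has a scaling limit. -/
lemma posLog_add_le {r ε : ℝ} (hr1 : 1 ≤ r) (hε0 : 0 < ε) (hε : ε ≤ 1) (hr : 1 / r ≤ ε) (η : ℝ) :
    Real.posLog (r + η) ≤ Real.posLog r + (η / r + cutLog ε (inward r η)) := by
  have hr0 : 0 < r := by linarith
  rw [posLog_add_eq hr0, posLog_eq_log hr1]
  gcongr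
  rcases le_total 0 η with hη | hη
  · rw [inward_of_nonneg hη, cutLog_zero hε, add_zero]
    have ht : 0 ≤ η / r := by positivity
    rw [abs_of_nonneg (by linarith), max_eq_left (by linarith)]
    linarith [Real.log_le_sub_one_of_pos (show 0 < 1 + η / r by linarith)]
  · rw [cutLog, ← add_assoc, neg_inward hη, zero_add]
    have hu := inward_nonneg hr0 η
    have h1 : 1 + η / r = 1 - inward r η := by linarith [neg_inward (r := r) hη]
    rw [h1]
    refine Real.log_le_log (lt_max_of_lt_right (by positivity)) (max_le_max le_rfl ?_)
    nlinarith

/-- For `|t| ≤ 1/2`, apply Bernoulli's inequality to `(1 + t)^(p-1)` and use `t² ≤ |t|^q`. For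
larger `|t|` crude bounds do: `9 |t|^p + 2 |t| ≤ 44 |t|^q`. -/
lemma abs_one_add_rpow_le {p q t : ℝ} (hp1 : 1 ≤ p) (hpq : p ≤ q) (hq : q ≤ 2) :
    |1 + t| ^ p ≤ 1 + p * t + 50 * |t| ^ q := by
  rcases le_total |t| (1 / 2) with h | h
  · have ht := abs_le.1 h
    have h1 : 0 < 1 + t := by linarith [ht.1]
    rw [abs_of_pos h1]
    have h2 : (1 + t) ^ p ≤ (1 + t) * (1 + (p - 1) * t) := by
      have := rpow_one_add_le_one_add_mul_self (s := t) (by linarith) (p := p - 1)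
        (by linarith) (by linarith)
      calc (1 + t) ^ p = (1 + t) * (1 + t) ^ (p - 1) := by
            rw [mul_comm, ← Real.rpow_add_one h1.ne']; congr 1; ring
        _ ≤ _ := by gcongr
    have h3 : t ^ 2 ≤ |t| ^ q := by
      rcases (abs_nonneg t).eq_or_lt with h0 | h0
      · have : t = 0 := abs_eq_zero.1 h0.symm
        rw [this]; simp; positivity
      · rw [← sq_abs, ← Real.rpow_two]
        exact Real.rpow_le_rpow_of_exponent_ge h0 (by linarith) hq
    have h4 : 0 ≤ |t| ^ q := by positivity
    nlinarith [sq_nonneg t]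
  · have ht0 : 0 < |t| := by linarith
    have key : ∀ a : ℝ, 1 ≤ a → a ≤ q → |t| ^ a ≤ 4 * |t| ^ q := by
      intro a ha haq
      have h5 : (1 / 2 : ℝ) ^ (q - a) ≤ |t| ^ (q - a) :=
        Real.rpow_le_rpow (by norm_num) h (by linarith)
      have h6 : (1 / 4 : ℝ) ≤ (1 / 2 : ℝ) ^ (q - a) := by
        calc (1 / 4 : ℝ) = (1 / 2 : ℝ) ^ (2 : ℝ) := by rw [Real.rpow_two]; norm_num
          _ ≤ _ := Real.rpow_le_rpow_of_exponent_ge (by norm_num) (by norm_num) (by linarith)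
      have h7 : |t| ^ q = |t| ^ a * |t| ^ (q - a) := by
        rw [← Real.rpow_add ht0]; congr 1; ring
      have h8 : 0 < |t| ^ a := by positivity
      rw [h7]
      nlinarith
    have h1 : |1 + t| ≤ 3 * |t| := by
      have := abs_add_le 1 t
      rw [abs_one] at this
      linarith
    have h2 : |1 + t| ^ p ≤ 9 * |t| ^ p := by
      calc |1 + t| ^ p ≤ (3 * |t|) ^ p := Real.rpow_le_rpow (abs_nonneg _) h1 (by linarith)
        _ = 3 ^ p * |t| ^ p := Real.mul_rpow (by norm_num) (abs_nonneg _)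
        _ ≤ (3 : ℝ) ^ (2 : ℝ) * |t| ^ p := by
            gcongr
            · norm_num
            · linarith
        _ = _ := by rw [Real.rpow_two]; norm_num
    have h3 := key p hp1 hpq
    have h4 := key 1 le_rfl (hp1.trans hpq)
    rw [Real.rpow_one] at h4
    have h5 : -(2 * |t|) ≤ p * t := by
      have := neg_abs_le t
      have := le_abs_self t
      nlinarith
    have h6 : |t| ^ q ≥ 0 := by positivity
    have h7 : 1 + p * t + 50 * |t| ^ q ≥ 1 - 2 * |t| + 50 * |t| ^ q := by linarith
    nlinarith [h4, h3, h2]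

/-- Bernoulli's inequality applied to `(1 + t)⁻¹ = 1 - t + t² / (1 + t)`, whose last term is at most
`2 |t|^q` for `t ≥ -1/2`. -/
lemma one_add_rpow_neg_le {p q t : ℝ} (hp0 : 0 ≤ p) (hp1 : p ≤ 1) (hq1 : 1 ≤ q) (hq2 : q ≤ 2)
    (ht : -(1 / 2) ≤ t) : (1 + t) ^ (-p) ≤ 1 - p * t + 2 * |t| ^ q := by
  have h0 : 0 < 1 + t := by linarith
  have h := rpow_one_add_le_one_add_mul_self (s := (1 + t)⁻¹ - 1)
    (by have : 0 < (1 + t)⁻¹ := by positivity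
        linarith) hp0 hp1
  rw [add_sub_cancel, Real.inv_rpow h0.le, ← Real.rpow_neg h0.le] at h
  have h1 : (1 + t)⁻¹ - 1 = - t + t ^ 2 / (1 + t) := by field_simp; ring
  rw [h1] at h
  have h2 : t ^ 2 / (1 + t) ≤ 2 * |t| ^ q := by
    rw [div_le_iff₀ h0]
    have hpow : 0 ≤ |t| ^ q := by positivity
    rcases le_total |t| 1 with h3 | h3
    · have h4 : t ^ 2 ≤ |t| ^ q := by
        rcases (abs_nonneg t).eq_or_lt with h0 | h0
        · have : t = 0 := abs_eq_zero.1 h0.symm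
          rw [this]; simp; positivity
        · rw [← sq_abs, ← Real.rpow_two]
          exact Real.rpow_le_rpow_of_exponent_ge h0 h3 hq2
      nlinarith
    · have ht0 : 0 ≤ t := by
        by_contra hneg
        rw [abs_of_neg (not_le.1 hneg)] at h3
        linarith
      have h4 : |t| ≤ |t| ^ q := Real.self_le_rpow_of_one_le h3 hq1
      rw [abs_of_nonneg ht0] at h4 ⊢
      nlinarith
  have h3 : 0 ≤ t ^ 2 / (1 + t) := by positivity
  nlinarith

/-- Two bounds are needed because `sqMin` is a minimum: the quadratic one is Taylor's formula made
explicit, the linear one holds because the bump is Lipschitz with constant `1`. -/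
lemma inv_one_add_sq_le (v t : ℝ) :
    1 / (1 + (v + t) ^ 2) ≤
      1 / (1 + v ^ 2) + (-(2 * v / (1 + v ^ 2) ^ 2) * t + 2 * sqMin t) := by
  have hv : 0 < 1 + v ^ 2 := by positivity
  have hw : 0 < 1 + (v + t) ^ 2 := by positivity
  have h1 : 1 / (1 + (v + t) ^ 2) ≤ 1 / (1 + v ^ 2) + (-(2 * v / (1 + v ^ 2) ^ 2) * t + 2 * t ^ 2) := by
    have : 1 / (1 + v ^ 2) + (-(2 * v / (1 + v ^ 2) ^ 2) * t + 2 * t ^ 2) - 1 / (1 + (v + t) ^ 2) =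
        t ^ 2 * (2 * ((1 + v ^ 2) ^ 2 * (1 + (v + t) ^ 2)) - (3 * v ^ 2 + 2 * v * t - 1)) /
          ((1 + v ^ 2) ^ 2 * (1 + (v + t) ^ 2)) := by
      field_simp
      ring
    have h2 : 0 ≤ 2 * ((1 + v ^ 2) ^ 2 * (1 + (v + t) ^ 2)) - (3 * v ^ 2 + 2 * v * t - 1) := by
      have e1 : 1 + v ^ 2 + (v + t) ^ 2 ≤ (1 + v ^ 2) ^ 2 * (1 + (v + t) ^ 2) := by
        nlinarith [sq_nonneg v, sq_nonneg (v + t), mul_nonneg (sq_nonneg v) (sq_nonneg (v + t)),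
          mul_nonneg (sq_nonneg (v ^ 2)) (sq_nonneg (v + t)), sq_nonneg (v ^ 2)]
      nlinarith [sq_nonneg (v - (v + t)), sq_nonneg v, sq_nonneg (v + t)]
    have h3 : 0 ≤ 1 / (1 + v ^ 2) + (-(2 * v / (1 + v ^ 2) ^ 2) * t + 2 * t ^ 2) -
        1 / (1 + (v + t) ^ 2) := by
      rw [this]; positivity
    linarith
  have hd : |2 * v / (1 + v ^ 2) ^ 2| ≤ 1 := by
    rw [abs_div, abs_of_pos (by positivity : 0 < (1 + v ^ 2) ^ 2), div_le_one (by positivity),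
      abs_mul, abs_two]
    nlinarith [sq_abs v, abs_nonneg v, sq_nonneg (|v| - 1), sq_nonneg (v ^ 2)]
  have h2 : 1 / (1 + (v + t) ^ 2) ≤
      1 / (1 + v ^ 2) + (-(2 * v / (1 + v ^ 2) ^ 2) * t + 2 * |t|) := by
    have e1 : 1 / (1 + (v + t) ^ 2) - 1 / (1 + v ^ 2) =
        -t * ((v + (v + t)) / ((1 + v ^ 2) * (1 + (v + t) ^ 2))) := by
      field_simp
      ring
    have e2 : |(v + (v + t)) / ((1 + v ^ 2) * (1 + (v + t) ^ 2))| ≤ 1 := by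
      rw [abs_div, abs_of_pos (by positivity : 0 < (1 + v ^ 2) * (1 + (v + t) ^ 2)),
        div_le_one (by positivity)]
      have := abs_add_le v (v + t)
      nlinarith [sq_abs v, sq_abs (v + t), sq_nonneg (|v| - 1), sq_nonneg (|v + t| - 1),
        mul_nonneg (sq_nonneg v) (sq_nonneg (v + t))]
    have e3 : -t * ((v + (v + t)) / ((1 + v ^ 2) * (1 + (v + t) ^ 2))) ≤ |t| := by
      refine (le_abs_self _).trans ?_
      rw [abs_mul, abs_neg]
      exact mul_le_of_le_one_right (abs_nonneg t) e2
    have e4 : 2 * v / (1 + v ^ 2) ^ 2 * t ≤ |t| := by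
      refine (le_abs_self _).trans ?_
      rw [abs_mul]
      exact mul_le_of_le_one_left (abs_nonneg t) hd
    linarith
  rcases min_choice (t ^ 2) |t| with h | h
  · rw [sqMin, h]; exact h1
  · rw [sqMin, h]; exact h2

namespace InwardFamily

variable {ι : Type*} {l : Filter ι} {Q : ι → Measure ℝ} {r : ι → ℝ} {α β c K M : ℝ}

lemma integrable_cutLog (h : InwardFamily l Q r α β c K M) {ε : ℝ} (hε0 : 0 < ε)
    (hε : ε ≤ 1 / 4) :
    ∀ᶠ i in l, Integrable (fun η => cutLog ε (inward (r i) η)) (Q i) := by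
  filter_upwards [h.integrable, h.tendsto_r.eventually_gt_atTop 0] with i hi hr
  refine Integrable.mono' ((hi.abs.div_const (r i)).const_mul |4 + ε⁻¹|)
    (by fun_prop : Measurable _).aestronglyMeasurable (Eventually.of_forall fun η => ?_)
  have hu := inward_nonneg hr η
  rw [← integral_cutLogDeriv hε0 hε hu]
  refine (abs_integral_le_of_abs_le_min (fun s hs => abs_cutLogDeriv_le hε0 hε hs) hu).trans ?_
  gcongr
  rw [inward]
  gcongr
  exact max_le (neg_le_abs η) (abs_nonneg η)

lemma tendsto_integral_cutLog (h : InwardFamily l Q r α β c K M) [l.IsCountablyGenerated] {ε : ℝ}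
    (hε0 : 0 < ε) (hε : ε ≤ 1 / 4) :
    Tendsto (fun i => r i ^ β * ∫ η, cutLog ε (inward (r i) η) ∂(Q i)) l
      (𝓝 (c * ∫ s in Set.Ioi 0, s ^ (-β) * cutLogDeriv ε s)) := by
  have h1 := h.tendsto_integral_primitive (measurable_cutLogDeriv ε)
    (fun s hs => abs_cutLogDeriv_le hε0 hε hs)
  simp_rw [mul_assoc, integral_const_mul] at h1
  refine h1.congr' ?_
  filter_upwards [h.tendsto_r.eventually_gt_atTop 0] with i hr
  simp_rw [fun η => integral_cutLogDeriv hε0 hε (inward_nonneg hr η)]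

lemma tendsto_drift (h : InwardFamily l Q r α β c K M) {b : ℝ}
    (hd : Tendsto (fun i => r i ^ (β - 1) * ∫ η, η ∂(Q i)) l (𝓝 b)) :
    Tendsto (fun i => r i ^ β * ∫ η, η / r i ∂(Q i)) l (𝓝 b) := by
  refine hd.congr' ?_
  filter_upwards [h.tendsto_r.eventually_gt_atTop 0] with i hr
  rw [integral_div, Real.rpow_sub_one hr.ne']
  ring

/-- In the recurrent regime the logarithm is superharmonic far from the origin. -/
lemma posLog_superharmonic (h : InwardFamily l Q r α β c K M) [l.IsCountablyGenerated] {b : ℝ}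
    (hd : Tendsto (fun i => r i ^ (β - 1) * ∫ η, η ∂(Q i)) l (𝓝 b))
    (hneg : b + c * Real.pi * Real.cot (Real.pi * β) < 0) :
    ∀ᶠ i in l, ∫⁻ η, ENNReal.ofReal (Real.posLog (r i + η)) ∂(Q i) ≤
      ENNReal.ofReal (Real.posLog (r i)) := by
  have := h.prob
  -- The strict inequality survives replacing the cotangent by its `ε`-approximation, and `ε` is
  -- then fixed before `r` grows.
  have hε : ∀ᶠ ε : ℝ in 𝓝[>] 0,
      b + c * (∫ s in Set.Ioi (0 : ℝ), s ^ (-β) * cutLogDeriv ε s) < 0 ∧ 0 < ε ∧ ε ≤ 1 / 4 := by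
    have h1 := ((tendsto_integral_mul_cutLogDeriv h.one_lt h.lt_two).const_mul c).const_add b
    rw [← mul_assoc] at h1
    filter_upwards [h1.eventually_lt_const hneg,
      Ioc_mem_nhdsGT (show (0 : ℝ) < 1 / 4 by norm_num)] with ε h2 h3
    exact ⟨h2, h3.1, h3.2⟩
  obtain ⟨ε, hε1, hε0, hε⟩ := hε.exists
  have hlim := (h.tendsto_drift hd).add (h.tendsto_integral_cutLog hε0 hε)
  filter_upwards [hlim.eventually_lt_const hε1, h.integrable, h.integrable_cutLog hε0 hε,
    h.tendsto_r.eventually_ge_atTop (max 1 (1 / ε))] with i hi hint hcut hr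
  have hr1 : 1 ≤ r i := (le_max_left _ _).trans hr
  have hr0 : 0 < r i := by linarith
  have hrε : 1 / r i ≤ ε := by
    rw [div_le_iff₀ hr0, mul_comm]
    exact (div_le_iff₀ hε0).1 ((le_max_right _ _).trans hr)
  have hi1 : Integrable (fun η => η / r i) (Q i) := hint.div_const _
  refine (lintegral_ofReal_le (fun η => Real.posLog_nonneg)
    (posLog_add_le hr1 hε0 (by linarith) hrε) (hi1.add hcut)).trans
    (ENNReal.ofReal_le_ofReal ?_)
  rw [integral_add hi1 hcut]
  rw [← mul_add] at hi
  have : 0 < r i ^ β := by positivity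
  have := neg_of_mul_neg_right hi this.le
  linarith

lemma sqMin_ge {t : ℝ} (ht : t ≤ -(1 / 2)) : 0 ≤ t + 2 * sqMin t := by
  rw [sqMin, abs_of_nonpos (by linarith)]
  rcases min_choice (t ^ 2) (-t) with h | h
  · rw [h]; nlinarith
  · rw [h]; linarith

/-- The one-sided logarithm is superharmonic far out on its side, because jumps over the origin
outweigh everything else. -/
lemma posLog_max_superharmonic (h : InwardFamily l Q r α β c K M) {b : ℝ}
    (hd : Tendsto (fun i => r i ^ (β - 1) * ∫ η, η ∂(Q i)) l (𝓝 b)) :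
    ∀ᶠ i in l, ∫⁻ η, ENNReal.ofReal (Real.posLog (max (r i + η) 0)) ∂(Q i) ≤
      ENNReal.ofReal (Real.posLog (max (r i) 0)) := by
  have := h.prob
  obtain ⟨C, hC, hsq⟩ := h.sqMin_bound
  have hlog : Tendsto (fun i => Real.log (r i)) l atTop := Real.tendsto_log_atTop.comp h.tendsto_r
  have htail := h.tail_lim 1 one_pos
  simp only [one_mul, Real.one_rpow, mul_one] at htail
  -- Rescaled by `r^β`, the drift and the second order term stay bounded, whereas jumps over the
  -- origin contribute about `-c log r`.
  have hbot : Tendsto (fun i => r i ^ β * (∫ η, η / r i ∂(Q i)) + 2 * C -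
      Real.log (r i) * (r i ^ β * (Q i).real (Set.Iio (-r i)))) l atBot := by
    have h1 := (h.tendsto_drift hd).add_const (2 * C)
    have h2 := tendsto_neg_atTop_atBot.comp (hlog.atTop_mul_pos h.c_pos htail)
    simpa [sub_eq_add_neg] using h1.add_atBot h2
  filter_upwards [hbot.eventually_le_atBot 0, h.integrable, h.integrable_sqMin, hsq,
    h.tendsto_r.eventually_ge_atTop 2] with i hi hint hsm hsqi hr
  have hr0 : 0 < r i := by linarith
  have hi1 : Integrable (fun η => η / r i) (Q i) := hint.div_const _
  have hi2 : Integrable (fun η => 2 * sqMin (η / r i)) (Q i) := (hsm (r i) (by linarith)).const_mul 2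
  have hi3 : Integrable (fun η => Real.log (r i) * (Set.Iio (-r i)).indicator 1 η) (Q i) :=
    ((integrable_const (1 : ℝ)).indicator measurableSet_Iio).const_mul _
  have hlog0 : 0 ≤ Real.log (r i) := Real.log_nonneg (by linarith)
  have hi4 : Integrable (fun η => η / r i + 2 * sqMin (η / r i)) (Q i) := hi1.add hi2
  refine (lintegral_ofReal_le (a := Real.posLog (max (r i) 0))
    (h := fun η => η / r i + 2 * sqMin (η / r i) -
      Real.log (r i) * (Set.Iio (-r i)).indicator 1 η) (fun η => Real.posLog_nonneg)
    (fun η => ?_) (hi4.sub hi3)).trans (ENNReal.ofReal_le_ofReal ?_)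
  · rw [max_eq_left hr0.le, posLog_eq_log (by linarith : 1 ≤ r i)]
    have hs0 := sqMin_nonneg (η / r i)
    rcases le_or_gt 1 (r i + η) with h1 | h1
    · rw [max_eq_left (by linarith), posLog_eq_log h1, Set.indicator_of_notMem (by simp; linarith)]
      have h2 : 0 < 1 + η / r i := by
        rw [show 1 + η / r i = (r i + η) / r i by field_simp]
        positivity
      rw [show r i + η = r i * (1 + η / r i) by field_simp, Real.log_mul hr0.ne' h2.ne']
      linarith [Real.log_le_sub_one_of_pos h2]
    · have h0 : Real.posLog (max (r i + η) 0) = 0 := by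
        rw [Real.posLog_eq_zero_iff, abs_of_nonneg (le_max_right _ _)]
        exact max_le h1.le zero_le_one
      rw [h0]
      have h2 : η / r i ≤ -(1 / 2) := by
        rw [div_le_iff₀ hr0]; linarith
      have h3 := sqMin_ge h2
      have h4 : Real.log (r i) * (Set.Iio (-r i)).indicator (1 : ℝ → ℝ) η ≤ Real.log (r i) := by
        refine mul_le_of_le_one_right hlog0 ?_
        exact Set.indicator_le_self' (fun _ _ => zero_le_one) η
      linarith
  · rw [integral_sub hi4 hi3, integral_add hi1 hi2, integral_const_mul, integral_const_mul,
      integral_indicator_one measurableSet_Iio]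
    have hp : 0 < r i ^ β := by positivity
    have h5 := hsqi (r i) (by linarith)
    have h6 : r i ^ β * (2 * ∫ η, sqMin (η / r i) ∂(Q i)) ≤ 2 * C := by
      calc _ ≤ r i ^ β * (2 * (C * r i ^ (-β))) := by gcongr
        _ = 2 * C * (r i ^ β * r i ^ (-β)) := by ring
        _ = _ := by rw [← Real.rpow_add hr0]; simp
    have h7 : r i ^ β * ((∫ η, η / r i ∂(Q i)) + 2 * (∫ η, sqMin (η / r i) ∂(Q i)) -
        Real.log (r i) * (Q i).real (Set.Iio (-r i))) ≤ 0 := by linarith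
    have := nonpos_of_mul_nonpos_right h7 hp
    linarith

/-- Strong inward drift: a power of the modulus has drift at most `-1` far from the origin. -/
lemma rpow_drift_le (h : InwardFamily l Q r α β c K M) {γ b : ℝ} (hγ0 : 0 ≤ γ) (hγ : γ < β - 1)
    (hd : Tendsto (fun i => r i ^ γ * ∫ η, η ∂(Q i)) l (𝓝 b)) (hb : b < 0) :
    ∀ᶠ i in l, ∫⁻ η, ENNReal.ofReal (2 / ((1 + γ) * -b) * |r i + η| ^ (1 + γ)) ∂(Q i) + 1 ≤
      ENNReal.ofReal (2 / ((1 + γ) * -b) * r i ^ (1 + γ)) := by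
  have := h.prob
  have hβ2 := h.lt_two
  set p := 1 + γ with hp
  -- This makes the leading term `κ p b = -2`, which leaves room for the error before `-1`.
  set κ := 2 / (p * -b) with hκ
  have hp0 : 0 < p := by linarith
  have hκ0 : 0 < κ := by
    have : 0 < -b := by linarith
    positivity
  obtain ⟨q, hpq, hqβ⟩ := exists_between (show p < β by linarith)
  obtain ⟨B, hB0, hB⟩ := h.moment_bound (q := q) (by linarith) hqβ
  have hlim : Tendsto (fun i => κ * (p * (r i ^ γ * ∫ η, η ∂(Q i)) + 50 * B * r i ^ (-(q - p)))) l
      (𝓝 (κ * (p * b + 50 * B * 0))) :=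
    ((hd.const_mul p).add (((tendsto_rpow_neg_atTop (by linarith)).comp
      h.tendsto_r).const_mul _)).const_mul κ
  have hval : κ * (p * b + 50 * B * 0) < -1 := by
    have hb0 : b ≠ 0 := hb.ne
    have : κ * (p * b) = -2 := by rw [hκ]; field_simp
    linarith
  -- Keeps `κ r^p - 1` nonnegative, so that subtracting `1` is not lost under `ENNReal.ofReal`.
  have hbig : Tendsto (fun i => κ * r i ^ p) l atTop :=
    ((tendsto_rpow_atTop hp0).comp h.tendsto_r).const_mul_atTop hκ0
  filter_upwards [hlim.eventually_lt_const hval, h.integrable, hB, hbig.eventually_ge_atTop 1,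
    h.tendsto_r.eventually_gt_atTop 0] with i hi hint hBi hone hr
  have hi1 : Integrable (fun η => κ * r i ^ p * (p * (η / r i))) (Q i) :=
    ((hint.div_const _).const_mul p).const_mul _
  have hi2 : Integrable (fun η => κ * r i ^ p * (50 * (|η| ^ q / r i ^ q))) (Q i) :=
    ((hBi.1.div_const _).const_mul 50).const_mul _
  have hmain := lintegral_ofReal_le (Q := Q i) (f := fun η => κ * |r i + η| ^ p)
    (a := κ * r i ^ p)
    (h := fun η => κ * r i ^ p * (p * (η / r i)) + κ * r i ^ p * (50 * (|η| ^ q / r i ^ q)))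
    (fun η => by positivity) (fun η => ?_) (hi1.add hi2)
  · have hle : κ * r i ^ p + ∫ η, (κ * r i ^ p * (p * (η / r i)) +
        κ * r i ^ p * (50 * (|η| ^ q / r i ^ q))) ∂(Q i) ≤ κ * r i ^ p - 1 := by
      rw [integral_add hi1 hi2]
      simp_rw [integral_const_mul, integral_div]
      have e1 : κ * r i ^ p * (p * ((∫ η, η ∂(Q i)) / r i)) =
          κ * (p * (r i ^ γ * ∫ η, η ∂(Q i))) := by
        rw [hp, add_comm 1 γ, Real.rpow_add_one hr.ne']; field_simp
      have e2 : κ * r i ^ p * (50 * ((∫ η, |η| ^ q ∂(Q i)) / r i ^ q)) ≤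
          κ * (50 * B * r i ^ (-(q - p))) := by
        have : r i ^ (-(q - p)) = r i ^ p / r i ^ q := by
          rw [neg_sub, Real.rpow_sub hr]
        rw [this]
        calc κ * r i ^ p * (50 * ((∫ η, |η| ^ q ∂(Q i)) / r i ^ q))
            ≤ κ * r i ^ p * (50 * (B / r i ^ q)) := by gcongr; exact hBi.2
          _ = _ := by ring
      rw [e1]
      have : κ * (p * (r i ^ γ * ∫ η, η ∂(Q i)) + 50 * B * r i ^ (-(q - p))) =
        κ * (p * (r i ^ γ * ∫ η, η ∂(Q i))) + κ * (50 * B * r i ^ (-(q - p))) := by ring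
      linarith
    calc _ ≤ ENNReal.ofReal (κ * r i ^ p - 1) + 1 := by
          gcongr
          exact hmain.trans (ENNReal.ofReal_le_ofReal hle)
      _ = ENNReal.ofReal (κ * r i ^ p) := by
          rw [← ENNReal.ofReal_one, ← ENNReal.ofReal_add (by linarith) zero_le_one]
          congr 1; ring
  · have e1 := abs_one_add_rpow_le (p := p) (q := q) (t := η / r i) (by linarith) hpq.le
      (by linarith)
    have e2 : |r i + η| ^ p = r i ^ p * |1 + η / r i| ^ p := by
      rw [← Real.mul_rpow hr.le (abs_nonneg _), ← abs_of_pos hr, ← abs_mul, abs_of_pos hr]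
      congr 2
      field_simp
    rw [e2]
    rw [abs_div, abs_of_pos hr, Real.div_rpow (abs_nonneg _) hr.le] at e1
    have : 0 < κ * r i ^ p := by positivity
    calc κ * (r i ^ p * |1 + η / r i| ^ p) = κ * r i ^ p * |1 + η / r i| ^ p := by ring
      _ ≤ κ * r i ^ p * (1 + p * (η / r i) + 50 * (|η| ^ q / r i ^ q)) := by gcongr
      _ = _ := by ring

/-- Strong outward drift: a small negative power of the one-sided position is superharmonic. -/
lemma rpow_neg_superharmonic (h : InwardFamily l Q r α β c K M) {γ b p q : ℝ} (hγ0 : 0 ≤ γ)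
    (hp0 : 0 < p) (hpq : p + 1 + γ < q) (hqβ : q < β)
    (hd : Tendsto (fun i => r i ^ γ * ∫ η, η ∂(Q i)) l (𝓝 b)) (hb : 0 < b) :
    ∀ᶠ i in l, ∫⁻ η, ENNReal.ofReal (max (r i + η) 1 ^ (-p)) ∂(Q i) ≤
      ENNReal.ofReal (max (r i) 1 ^ (-p)) := by
  have := h.prob
  have hβ2 := h.lt_two
  obtain ⟨B, hB0, hB⟩ := h.moment_bound (q := q) (by linarith) hqβ
  have hlim : Tendsto (fun i => -p * (r i ^ γ * ∫ η, η ∂(Q i)) +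
      4 * B * r i ^ (-(q - (p + 1 + γ)))) l (𝓝 (-p * b + 4 * B * 0)) :=
    (hd.const_mul (-p)).add (((tendsto_rpow_neg_atTop (by linarith)).comp
      h.tendsto_r).const_mul _)
  have hval : -p * b + 4 * B * 0 < 0 := by nlinarith
  filter_upwards [hlim.eventually_lt_const hval, h.integrable, hB,
    h.tendsto_r.eventually_ge_atTop 2] with i hi hint hBi hr2
  have hr : 0 < r i := by linarith
  have hrp : 1 ≤ r i ^ p := Real.one_le_rpow (by linarith) hp0.le
  have hi1 : Integrable (fun η => r i ^ (-p) * (-p * (η / r i))) (Q i) :=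
    ((hint.div_const _).const_mul _).const_mul _
  have hi2 : Integrable (fun η => r i ^ (-p) * (4 * r i ^ p * (|η| ^ q / r i ^ q))) (Q i) :=
    ((hBi.1.div_const _).const_mul _).const_mul _
  refine (lintegral_ofReal_le (a := max (r i) 1 ^ (-p))
    (h := fun η => r i ^ (-p) * (-p * (η / r i)) + r i ^ (-p) * (4 * r i ^ p * (|η| ^ q / r i ^ q)))
    (fun η => Real.rpow_nonneg (zero_le_one.trans (le_max_right _ _)) _) (fun η => ?_)
    (hi1.add hi2)).trans (ENNReal.ofReal_le_ofReal ?_)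
  · rw [max_eq_left (by linarith : 1 ≤ r i)]
    have hq0 : 0 ≤ |η / r i| ^ q := by positivity
    have habs : |η| ^ q / r i ^ q = |η / r i| ^ q := by
      rw [abs_div, abs_of_pos hr, Real.div_rpow (abs_nonneg _) hr.le]
    rw [habs]
    -- After a large inward jump the function may rise from `r^(-p)` to `1`; the extra factor `r^p`
    -- in the error term pays for this. The error is then of order `r^(-q)`, still below the drift
    -- term of order `r^(-p-1-γ)` because `p + 1 + γ < q`.
    rcases le_total (-(1 / 2)) (η / r i) with ht | ht
    · have e1 := one_add_rpow_neg_le (p := p) (q := q) hp0.le (by linarith) (by linarith)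
        (by linarith) ht
      have e2 : r i + η = r i * (1 + η / r i) := by field_simp
      have e3 : 1 ≤ r i * (1 + η / r i) := by nlinarith
      rw [e2, max_eq_left e3, Real.mul_rpow hr.le (by linarith)]
      calc r i ^ (-p) * (1 + η / r i) ^ (-p)
          ≤ r i ^ (-p) * (1 - p * (η / r i) + 2 * |η / r i| ^ q) := by gcongr
        _ ≤ r i ^ (-p) * (1 - p * (η / r i) + 4 * r i ^ p * |η / r i| ^ q) := by
            gcongr; linarith
        _ = _ := by ring
    · have e1 : max (r i + η) 1 ^ (-p) ≤ 1 :=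
        Real.rpow_le_one_of_one_le_of_nonpos (le_max_right _ _) (by linarith)
      have e2 : (1 / 4 : ℝ) ≤ |η / r i| ^ q := by
        have ha : 1 / 2 ≤ |η / r i| := by rw [abs_of_nonpos (by linarith)]; linarith
        calc (1 / 4 : ℝ) = (1 / 2 : ℝ) ^ (2 : ℝ) := by rw [Real.rpow_two]; norm_num
          _ ≤ (1 / 2 : ℝ) ^ q :=
              Real.rpow_le_rpow_of_exponent_ge (by norm_num) (by norm_num) (by linarith)
          _ ≤ _ := Real.rpow_le_rpow (by norm_num) ha (by linarith)
      have e3 : r i ^ (-p) * r i ^ p = 1 := by rw [← Real.rpow_add hr]; simp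
      have e4 : 0 < r i ^ (-p) := by positivity
      have e5 : 0 ≤ r i ^ (-p) * (-p * (η / r i)) := by
        refine mul_nonneg e4.le ?_
        nlinarith
      have e6 : r i ^ (-p) * (4 * r i ^ p * |η / r i| ^ q) = 4 * |η / r i| ^ q := by
        calc _ = (r i ^ (-p) * r i ^ p) * (4 * |η / r i| ^ q) := by ring
          _ = _ := by rw [e3, one_mul]
      rw [e6]
      linarith
  · rw [integral_add hi1 hi2]
    simp_rw [integral_const_mul, integral_div]
    have e1 : r i ^ (-p) * (-p * ((∫ η, η ∂(Q i)) / r i)) =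
        r i ^ (-p - γ - 1) * (-p * (r i ^ γ * ∫ η, η ∂(Q i))) := by
      have : r i ^ (-p) = r i ^ (-p - γ - 1) * r i ^ γ * r i := by
        rw [← Real.rpow_add hr, ← Real.rpow_add_one hr.ne']; congr 1; ring
      rw [this]; field_simp
    have e2 : r i ^ (-p) * (4 * r i ^ p * ((∫ η, |η| ^ q ∂(Q i)) / r i ^ q)) ≤
        r i ^ (-p - γ - 1) * (4 * B * r i ^ (-(q - (p + 1 + γ)))) := by
      calc _ ≤ r i ^ (-p) * (4 * r i ^ p * (B / r i ^ q)) := by gcongr; exact hBi.2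
        _ = 4 * B * (r i ^ (-p) * r i ^ p * r i ^ (-q)) := by
            rw [Real.rpow_neg hr.le q]; ring
        _ = 4 * B * (r i ^ (-p - γ - 1) * r i ^ (-(q - (p + 1 + γ)))) := by
            rw [← Real.rpow_add hr, ← Real.rpow_add hr, ← Real.rpow_add hr]
            congr 2; ring
        _ = _ := by ring
    have e3 : 0 < r i ^ (-p - γ - 1) := by positivity
    have e4 := mul_neg_of_pos_of_neg e3 hi
    rw [mul_add] at e4
    rw [e1]
    linarith

/-- A smooth bump of width `Y` changes its mean by at most `O(Y ^ (-β))` in one step. -/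
lemma bump_drift_le (h : InwardFamily l Q r α β c K M) {b : ℝ}
    (hd : Tendsto (fun i => r i ^ (β - 1) * ∫ η, η ∂(Q i)) l (𝓝 b)) :
    ∃ C : ℝ, 0 < C ∧ ∀ᶠ i in l, ∀ Y, 1 ≤ Y → Y ≤ r i →
      ∫⁻ η, ENNReal.ofReal (1 / (1 + ((r i + η) / Y) ^ 2)) ∂(Q i) ≤
        ENNReal.ofReal (1 / (1 + (r i / Y) ^ 2) + C * Y ^ (-β)) := by
  have := h.prob
  have hβ1 := h.one_lt
  obtain ⟨C, hC, hsq⟩ := h.sqMin_bound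
  refine ⟨|b| + 1 + 2 * C, by positivity, ?_⟩
  have hB : ∀ᶠ i in l, |r i ^ (β - 1) * ∫ η, η ∂(Q i)| < |b| + 1 :=
    hd.abs.eventually_lt_const (by linarith)
  filter_upwards [hB, hsq, h.integrable, h.integrable_sqMin] with i hBi hsqi hint hsm Y hY hYr
  have hY0 : 0 < Y := by linarith
  have hr : 0 < r i := by linarith
  set v := r i / Y with hv
  have hi1 : Integrable (fun η => -(2 * v / (1 + v ^ 2) ^ 2) * (η / Y)) (Q i) :=
    (hint.div_const _).const_mul _
  have hi2 : Integrable (fun η => 2 * sqMin (η / Y)) (Q i) := (hsm Y hY).const_mul 2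
  refine (lintegral_ofReal_le (a := 1 / (1 + v ^ 2))
    (h := fun η => -(2 * v / (1 + v ^ 2) ^ 2) * (η / Y) + 2 * sqMin (η / Y))
    (fun η => by positivity) (fun η => ?_) (hi1.add hi2)).trans (ENNReal.ofReal_le_ofReal ?_)
  · rw [add_div]
    exact inv_one_add_sq_le _ _
  · rw [integral_add hi1 hi2]
    simp_rw [integral_const_mul, integral_div]
    have e1 : |2 * v / (1 + v ^ 2) ^ 2| ≤ 1 := by
      rw [abs_div, abs_of_pos (by positivity : 0 < (1 + v ^ 2) ^ 2), div_le_one (by positivity),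
        abs_mul, abs_two]
      nlinarith [sq_abs v, abs_nonneg v, sq_nonneg (|v| - 1), sq_nonneg (v ^ 2)]
    -- The drift is of order `r^(1-β)`, and `Y ≤ r` turns this into `Y^(1-β)`.
    have e2 : |∫ η, η ∂(Q i)| / Y ≤ (|b| + 1) * Y ^ (-β) := by
      rw [abs_mul, abs_of_pos (by positivity : 0 < r i ^ (β - 1))] at hBi
      have e3 : Y ^ (β - 1) ≤ r i ^ (β - 1) := Real.rpow_le_rpow hY0.le hYr (by linarith)
      have e4 : Y ^ (β - 1) * |∫ η, η ∂(Q i)| ≤ |b| + 1 :=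
        (mul_le_mul_of_nonneg_right e3 (abs_nonneg _)).trans hBi.le
      have e5 : Y ^ (-β) * (Y ^ (β - 1) * Y) = 1 := by
        rw [← Real.rpow_add_one hY0.ne', ← Real.rpow_add hY0]; simp
      have e6 : 0 < Y ^ (-β) := by positivity
      calc |∫ η, η ∂(Q i)| / Y = (Y ^ (-β) * (Y ^ (β - 1) * Y)) * |∫ η, η ∂(Q i)| / Y := by
            rw [e5, one_mul]
        _ = Y ^ (-β) * (Y ^ (β - 1) * |∫ η, η ∂(Q i)|) := by field_simp
        _ ≤ Y ^ (-β) * (|b| + 1) := by gcongr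
        _ = _ := mul_comm _ _
    have e7 : -(2 * v / (1 + v ^ 2) ^ 2) * ((∫ η, η ∂(Q i)) / Y) ≤ (|b| + 1) * Y ^ (-β) := by
      refine (le_abs_self _).trans (le_trans ?_ e2)
      rw [abs_mul, abs_neg, abs_div _ Y, abs_of_pos hY0]
      exact mul_le_of_le_one_left (by positivity) e1
    have e8 := hsqi Y hY
    linarith

end InwardFamily

end OneStep


/-! ### The transient regime: control of landings near the origin -/

section Transience

/-- The amount by which a step of size `η` from `r` reduces the logarithm of the modulus, in
excess of `log 2`. -/
def logDrop (r η : ℝ) : ℝ := max 0 (Real.log (1 / 2) - (Real.posLog (r + η) - Real.posLog r))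

lemma measurable_posLog : Measurable Real.posLog :=
  measurable_const.max Real.measurable_log

@[fun_prop]
lemma measurable_logDrop (r : ℝ) : Measurable (logDrop r) := by
  unfold logDrop
  have := measurable_posLog
  fun_prop

lemma logDrop_nonneg (r η : ℝ) : 0 ≤ logDrop r η := le_max_left _ _

/-- The change of the logarithm of the modulus is the logarithm truncated from below, minus
`logDrop`. -/
lemma posLog_sub_eq {r : ℝ} (hr : 2 ≤ r) (η : ℝ) :
    Real.posLog (r + η) - Real.posLog r =
      Real.log (max |1 + η / r| (1 / 2)) - logDrop r η := by
  have hr0 : 0 < r := by linarith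
  have h0 : Real.posLog (r + η) - Real.posLog r = Real.log (max |1 + η / r| (1 / r)) := by
    rw [posLog_add_eq hr0, posLog_eq_log (by linarith : 1 ≤ r)]; ring
  have hr2 : 1 / r ≤ 1 / 2 := one_div_le_one_div_of_le (by norm_num) hr
  rw [logDrop, h0]
  rcases le_total (1 / 2) |1 + η / r| with h | h
  · rw [max_eq_left h, max_eq_left (hr2.trans h)]
    have := Real.log_le_log (by norm_num) h
    rw [max_eq_left (by linarith), sub_zero]
  · rw [max_eq_right h]
    have := Real.log_le_log (lt_max_of_lt_right (by positivity)) (max_le h hr2)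
    set L := Real.log (max |1 + η / r| (1 / r))
    have hmax : max 0 (Real.log (1 / 2) - L) = Real.log (1 / 2) - L :=
      max_eq_right (by linarith)
    rw [hmax]
    ring

/-- The floor `1/2` gives `|log x| ≤ 2 |t|`. For the linear bound with `x ≥ 1`, write `log x = 2 log
√x` and use `(√x - 1)² ≤ x - 1`. -/
lemma sq_log_max_le (t : ℝ) : Real.log (max |1 + t| (1 / 2)) ^ 2 ≤ 4 * sqMin t := by
  set x := max |1 + t| (1 / 2) with hx
  have hx2 : 1 / 2 ≤ x := le_max_right _ _
  have hx0 : 0 < x := by linarith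
  have hup : x ≤ 1 + |t| := by
    refine max_le ((abs_add_le 1 t).trans (by simp)) ?_
    linarith [abs_nonneg t]
  have hlow : 1 - |t| ≤ x := by
    refine le_trans ?_ (le_max_left _ _)
    have := abs_sub_abs_le_abs_sub 1 (-t)
    rw [abs_one, abs_neg, sub_neg_eq_add] at this
    exact this
  have h1 : Real.log x ≤ |t| := by linarith [Real.log_le_sub_one_of_pos hx0]
  have h2 : -(2 * |t|) ≤ Real.log x := by
    have h3 := Real.one_sub_inv_le_log_of_pos hx0
    have h4 : x⁻¹ - 1 ≤ 2 * |t| := by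
      rw [show x⁻¹ - 1 = (1 - x) / x by field_simp, div_le_iff₀ hx0]
      nlinarith [abs_nonneg t]
    linarith
  have hA : Real.log x ^ 2 ≤ 4 * t ^ 2 := by
    rw [← sq_abs t]
    nlinarith [abs_nonneg t]
  have hB : Real.log x ^ 2 ≤ 4 * |t| := by
    rcases le_total 1 x with h5 | h5
    · have h6 : 0 ≤ Real.log x := Real.log_nonneg h5
      have hs : 0 < Real.sqrt x := Real.sqrt_pos.2 hx0
      have h7 : Real.log x = 2 * Real.log (Real.sqrt x) := by
        rw [Real.log_sqrt hx0.le]; ring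
      have h8 := Real.log_le_sub_one_of_pos hs
      have h9 : Real.sqrt x ^ 2 = x := Real.sq_sqrt hx0.le
      have h10 : 1 ≤ Real.sqrt x := Real.one_le_sqrt.2 h5
      nlinarith
    · have h6 : Real.log x ≤ 0 := Real.log_nonpos hx0.le h5
      have h7 : -1 ≤ Real.log x := by
        have h3 := Real.one_sub_inv_le_log_of_pos hx0
        have h4 : x⁻¹ ≤ 2 := by
          rw [inv_le_comm₀ hx0 (by norm_num)]; linarith
        linarith
      rcases le_total |t| 1 with h8 | h8
      · rw [← sq_abs t] at hA
        nlinarith [abs_nonneg t]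
      · nlinarith
  rw [sqMin, mul_min_of_nonneg _ _ (by norm_num)]
  exact le_min hA hB

lemma log_one_add_ge {p t : ℝ} (hp1 : 1 ≤ p) (hp2 : p ≤ 2) (ht : 0 ≤ t) :
    t - t ^ p ≤ Real.log (1 + t) := by
  rcases ht.eq_or_lt with rfl | ht0
  · simp [Real.zero_rpow (by linarith : p ≠ 0)]
  rcases le_total t 1 with h | h
  · have h1 : t ^ 2 ≤ t ^ p := by
      rw [← Real.rpow_two]
      exact Real.rpow_le_rpow_of_exponent_ge ht0 h hp2
    have h2 := Real.one_sub_inv_le_log_of_pos (show 0 < 1 + t by linarith)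
    have h3 : t - t ^ 2 ≤ 1 - (1 + t)⁻¹ := by
      rw [show 1 - (1 + t)⁻¹ = t / (1 + t) by field_simp; ring, le_div_iff₀ (by linarith)]
      nlinarith [pow_pos ht0 3]
    linarith
  · have h1 := Real.self_le_rpow_of_one_le h hp1
    have h2 := Real.log_nonneg (show 1 ≤ 1 + t by linarith)
    linarith

/-- The lower counterpart of `posLog_add_le`. `cutLog` can overestimate only near `u = 1`, where the
cut contributes at most `log (3 ε)`. If the true change is below that, then `logDrop` is at least
`log (1 / (6 ε))`, so it is bounded by its square divided by this number; the loss becomes small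
with `ε` once the second moment of `logDrop` is controlled. -/
lemma posLog_sub_ge {r ε α : ℝ} (hr : 2 ≤ r) (hε0 : 0 < ε) (hε : ε < 1 / 6) (hα1 : 1 ≤ α)
    (hα2 : α ≤ 2) (η : ℝ) :
    η / r + cutLog ε (inward r η) - max η 0 ^ α / r ^ α -
        logDrop r η ^ 2 / Real.log (1 / (6 * ε)) ≤
      Real.posLog (r + η) - Real.posLog r := by
  have hr0 : 0 < r := by linarith
  have hΛ : 0 < Real.log (1 / (6 * ε)) := Real.log_pos (by
    rw [one_lt_div (by positivity)]; linarith)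
  have hw := logDrop_nonneg r η
  have hsq : 0 ≤ logDrop r η ^ 2 / Real.log (1 / (6 * ε)) := by positivity
  have hΔ : Real.posLog (r + η) - Real.posLog r = Real.log (max |1 + η / r| (1 / r)) := by
    rw [posLog_add_eq hr0, posLog_eq_log (by linarith : 1 ≤ r)]; ring
  rcases le_total 0 η with hη | hη
  · rw [inward_of_nonneg hη, cutLog_zero (by linarith), max_eq_left hη, ← Real.div_rpow hη hr0.le]
    have ht : 0 ≤ η / r := by positivity
    have h1 := log_one_add_ge hα1 hα2 ht
    have h2 : Real.log (1 + η / r) ≤ Real.log (max |1 + η / r| (1 / r)) :=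
      Real.log_le_log (by linarith) ((le_abs_self _).trans (le_max_left _ _))
    linarith
  · rw [max_eq_right hη, Real.zero_rpow (by linarith), zero_div, sub_zero, cutLog, ← add_assoc,
      neg_inward hη, zero_add]
    have hu := inward_nonneg hr0 η
    have h1 : 1 + η / r = 1 - inward r η := by linarith [neg_inward (r := r) hη]
    have h1r : 0 < max |1 + η / r| (1 / r) := lt_max_of_lt_right (by positivity)
    rcases le_total (ε * (1 + inward r η)) |1 - inward r η| with h2 | h2
    · rw [max_eq_left h2]
      have h3 : Real.log |1 - inward r η| ≤ Real.log (max |1 + η / r| (1 / r)) := by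
        refine Real.log_le_log (lt_of_lt_of_le (by positivity) h2) ?_
        rw [h1]; exact le_max_left _ _
      linarith
    · rw [max_eq_right h2]
      obtain ⟨-, h3⟩ := half_le_of_abs_le (by linarith) hu h2
      have h4 : Real.log (ε * (1 + inward r η)) ≤ Real.log (3 * ε) :=
        Real.log_le_log (by positivity) (by nlinarith)
      have h5 := posLog_sub_eq hr η
      have h6 : |1 + η / r| ≤ 1 / 2 := by rw [h1]; nlinarith
      rw [max_eq_right h6] at h5
      rcases le_total (Real.log (3 * ε)) (Real.posLog (r + η) - Real.posLog r) with h7 | h7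
      · linarith
      · have h8 : Real.log (1 / (6 * ε)) = Real.log (1 / 2) - Real.log (3 * ε) := by
          rw [← Real.log_div (by norm_num) (by positivity)]
          congr 1
          field_simp
          norm_num
        have h9 : logDrop r η ≤ logDrop r η ^ 2 / Real.log (1 / (6 * ε)) := by
          rw [le_div_iff₀ hΛ]
          nlinarith
        linarith

namespace InwardFamily

variable {ι : Type*} {l : Filter ι} {Q : ι → Measure ℝ} {r : ι → ℝ} {α β c K M : ℝ}

lemma rpow_neg_one_sub_le {β ρ : ℝ} (hβ : β ≤ 2) (hρ0 : 0 ≤ ρ) (hρ : ρ ≤ 1 / 2) :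
    (1 - ρ) ^ (-β) ≤ 1 + 6 * ρ ∧ 1 - 2 * ρ ≤ (1 + ρ) ^ (-β) := by
  have h1 : 0 < 1 - ρ := by linarith
  constructor
  · calc (1 - ρ) ^ (-β) ≤ (1 - ρ) ^ (-2 : ℝ) :=
          Real.rpow_le_rpow_of_exponent_ge h1 (by linarith) (by linarith)
      _ = ((1 - ρ) ^ 2)⁻¹ := by rw [Real.rpow_neg h1.le, Real.rpow_two]
      _ ≤ 1 + 6 * ρ := by
          rw [inv_le_iff_one_le_mul₀ (by positivity)]
          have : (1 + 6 * ρ) * (1 - ρ) ^ 2 = 1 + ρ * (1 - 2 * ρ) * (4 - 3 * ρ) := by ring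
          rw [this]
          have h2 : 0 ≤ ρ * (1 - 2 * ρ) * (4 - 3 * ρ) :=
            mul_nonneg (mul_nonneg hρ0 (by linarith)) (by linarith)
          linarith
  · calc 1 - 2 * ρ ≤ ((1 + ρ) ^ 2)⁻¹ := by
          rw [← one_div, le_div_iff₀ (by positivity)]
          nlinarith [mul_nonneg hρ0 hρ0, mul_nonneg hρ0 (mul_nonneg hρ0 hρ0)]
      _ = (1 + ρ) ^ (-2 : ℝ) := by rw [Real.rpow_neg (by linarith), Real.rpow_two]
      _ ≤ (1 + ρ) ^ (-β) := Real.rpow_le_rpow_of_exponent_le (by linarith) (by linarith)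

/-- Landing near the origin is unlikely when the tails converge at a polynomial rate. -/
lemma near_origin_le (h : InwardFamily l Q r α β c K M) {δ C : ℝ} (hδ : 0 < δ) (hC : 0 ≤ C)
    (hrate : ∀ᶠ i in l, ∀ y, r i / 2 ≤ y →
      |y ^ β * (Q i).real (Set.Iio (-y)) - c| ≤ C * y ^ (-δ)) :
    ∃ D : ℝ, 0 < D ∧ ∀ᶠ i in l, ∀ ρ, 0 < ρ → ρ ≤ 1 / 2 →
      (Q i).real {η | |r i + η| < ρ * r i} ≤ D * (ρ + r i ^ (-δ)) * r i ^ (-β) := by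
  have := h.prob
  have hc := h.c_pos
  have hβ1 := h.one_lt
  have hβ2 := h.lt_two
  refine ⟨8 * c + 5 * (C * 2 ^ δ), by positivity, ?_⟩
  filter_upwards [hrate, h.tendsto_r.eventually_gt_atTop 0] with i hi hr ρ hρ0 hρ
  have hrβ : 0 < r i ^ (-β) := by positivity
  have hrδ : 0 < r i ^ (-δ) := by positivity
  have htail : ∀ m : ℝ, 1 / 2 ≤ m → |(Q i).real (Set.Iio (-(m * r i))) - c * (m ^ (-β) * r i ^ (-β))|
      ≤ C * 2 ^ δ * r i ^ (-δ) * (m ^ (-β) * r i ^ (-β)) := by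
    intro m hm
    have hm0 : 0 < m := by linarith
    have h1 := hi (m * r i) (by nlinarith)
    have hy : 0 < m * r i := by positivity
    have h2 : (m * r i) ^ (-β) * (m * r i) ^ β = 1 := by rw [← Real.rpow_add hy]; simp
    have h3 : (m * r i) ^ (-δ) ≤ 2 ^ δ * r i ^ (-δ) := by
      rw [Real.mul_rpow hm0.le hr.le]
      gcongr
      calc m ^ (-δ) ≤ (1 / 2 : ℝ) ^ (-δ) :=
            Real.rpow_le_rpow_of_nonpos (by norm_num) hm (by linarith)
        _ = 2 ^ δ := by rw [one_div, Real.inv_rpow (by norm_num), ← Real.rpow_neg (by norm_num), neg_neg]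
    rw [← Real.mul_rpow hm0.le hr.le]
    have h4 : (Q i).real (Set.Iio (-(m * r i))) - c * (m * r i) ^ (-β) =
        (m * r i) ^ (-β) * ((m * r i) ^ β * (Q i).real (Set.Iio (-(m * r i))) - c) := by
      rw [mul_sub, ← mul_assoc, h2]; ring
    rw [h4, abs_mul, abs_of_pos (by positivity), mul_comm]
    have h5 : 0 < (m * r i) ^ (-β) := by positivity
    refine mul_le_mul_of_nonneg_right (h1.trans ?_) h5.le
    rw [mul_assoc]
    gcongr
  obtain ⟨p1, p2⟩ := rpow_neg_one_sub_le (β := β) hβ2.le hρ0.le hρ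
  have t1 := htail (1 - ρ) (by linarith)
  have t2 := htail (1 + ρ) (by linarith)
  -- The landing zone is a difference of two tails at levels near `r`. Their main terms differ by
  -- `O(ρ) r^(-β)`, and the errors of the two tails add `O(r^(-δ)) r^(-β)`.
  have hsub : {η | |r i + η| < ρ * r i} ⊆
      Set.Iio (-((1 - ρ) * r i)) \ Set.Iio (-((1 + ρ) * r i)) := by
    intro η hη
    have hη : |r i + η| < ρ * r i := hη
    have := abs_lt.1 hη
    exact ⟨by simp only [Set.mem_Iio]; nlinarith [this.2],
      by simp only [Set.mem_Iio, not_lt]; nlinarith [this.1]⟩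
  have hmeas : (Q i).real {η | |r i + η| < ρ * r i} ≤
      (Q i).real (Set.Iio (-((1 - ρ) * r i))) - (Q i).real (Set.Iio (-((1 + ρ) * r i))) := by
    rw [← measureReal_sdiff (Set.Iio_subset_Iio (by nlinarith)) measurableSet_Iio]
    exact measureReal_mono hsub
  have s1 := (abs_le.1 t1).2
  have s2 := (abs_le.1 t2).1
  have p3 : (1 - ρ) ^ (-β) ≤ 4 := by linarith
  have p4 : (1 + ρ) ^ (-β) ≤ 1 := Real.rpow_le_one_of_one_le_of_nonpos (by linarith) (by linarith)
  set E := C * 2 ^ δ * r i ^ (-δ) with hE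
  have hE0 : 0 ≤ E := by positivity
  have q1 : E * ((1 - ρ) ^ (-β) * r i ^ (-β)) ≤ E * (4 * r i ^ (-β)) := by gcongr
  have q2 : E * ((1 + ρ) ^ (-β) * r i ^ (-β)) ≤ E * (1 * r i ^ (-β)) := by gcongr
  have q3 : c * ((1 - ρ) ^ (-β) * r i ^ (-β)) ≤ c * ((1 + 6 * ρ) * r i ^ (-β)) := by gcongr
  have q4 : c * ((1 - 2 * ρ) * r i ^ (-β)) ≤ c * ((1 + ρ) ^ (-β) * r i ^ (-β)) := by gcongr
  calc (Q i).real {η | |r i + η| < ρ * r i}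
      ≤ c * ((1 + 6 * ρ) * r i ^ (-β)) - c * ((1 - 2 * ρ) * r i ^ (-β)) +
        E * (4 * r i ^ (-β)) + E * (1 * r i ^ (-β)) := by linarith
    _ = (8 * c * ρ + 5 * (C * 2 ^ δ) * r i ^ (-δ)) * r i ^ (-β) := by rw [hE]; ring
    _ ≤ (8 * c + 5 * (C * 2 ^ δ)) * (ρ + r i ^ (-δ)) * r i ^ (-β) := by
        gcongr
        have z1 : 0 ≤ 8 * c * r i ^ (-δ) := by positivity
        have z2 : 0 ≤ 5 * (C * 2 ^ δ) * ρ := by positivity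
        linarith

/-- A drop larger than `s` means landing within `e^(-s) r / 2` of the origin, and `log⁺ ≥ 0` makes
it impossible for `s > log r`. For `s ≤ log r` both `e^(-s)` and `r^(-δ)` are at most `e^(-δ s)`,
the former as `δ ≤ 1`. So the tail of the drop is exponential, with prefactor `r^(-β)`. -/
lemma logDrop_sq_bound (h : InwardFamily l Q r α β c K M) {δ D : ℝ} (hδ0 : 0 < δ) (hδ1 : δ ≤ 1)
    (hD : 0 < D) (hnear : ∀ᶠ i in l, ∀ ρ, 0 < ρ → ρ ≤ 1 / 2 →
      (Q i).real {η | |r i + η| < ρ * r i} ≤ D * (ρ + r i ^ (-δ)) * r i ^ (-β)) :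
    ∃ B : ℝ, 0 ≤ B ∧ ∀ᶠ i in l, Integrable (fun η => logDrop (r i) η ^ 2) (Q i) ∧
      ∫ η, logDrop (r i) η ^ 2 ∂(Q i) ≤ B * r i ^ (-β) := by
  have := h.prob
  have hJi : IntegrableOn (fun s : ℝ => s * Real.exp (-δ * s)) (Set.Ioi 0) := by
    have := integrableOn_rpow_mul_exp_neg_mul_rpow (s := 1) (p := 1) (b := δ) (by norm_num) one_pos hδ0
    simpa using this
  set J := ∫ s in Set.Ioi (0 : ℝ), s * Real.exp (-δ * s) with hJ
  have hJ0 : 0 ≤ J := setIntegral_nonneg measurableSet_Ioi fun s hs =>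
    mul_nonneg (le_of_lt hs) (Real.exp_pos _).le
  refine ⟨4 * D * J, by positivity, ?_⟩
  filter_upwards [hnear, h.tendsto_r.eventually_ge_atTop 2] with i hi hr2
  have hr : 0 < r i := by linarith
  have htail : ∀ s > 0, Q i {η | s < logDrop (r i) η} ≤
      ENNReal.ofReal (2 * D * Real.exp (-δ * s) * r i ^ (-β)) := by
    intro s hs
    have hsub : {η | s < logDrop (r i) η} ⊆
        {η | |r i + η| < (Real.exp (-s) / 2) * r i ∧ s ≤ Real.log (r i)} := by
      intro η hη
      have h1 : s < Real.log (1 / 2) - (Real.posLog (r i + η) - Real.posLog (r i)) := by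
        rcases lt_max_iff.1 (show s < max 0 _ from hη) with h0 | h0
        · linarith
        · exact h0
      rw [posLog_eq_log (by linarith : 1 ≤ r i)] at h1
      have h2 : Real.log (1 / 2) < 0 := Real.log_neg (by norm_num) (by norm_num)
      have h3 := Real.posLog_nonneg (x := r i + η)
      refine ⟨?_, by linarith⟩
      have h4 : Real.posLog (r i + η) < Real.log (Real.exp (-s) / 2 * r i) := by
        rw [Real.log_mul (by positivity) hr.ne', div_eq_mul_one_div, Real.log_mul (by positivity)
          (by norm_num), Real.log_exp]
        linarith
      rcases eq_or_ne (r i + η) 0 with h5 | h5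
      · rw [h5, abs_zero]; positivity
      · have h6 : Real.log |r i + η| ≤ Real.posLog (r i + η) := by
          rw [Real.log_abs]; exact le_max_right _ _
        exact (Real.log_lt_log_iff (abs_pos.2 h5) (by positivity)).1 (h6.trans_lt h4)
    by_cases hs2 : s ≤ Real.log (r i)
    · have hexp : Real.exp (-s) ≤ 1 := Real.exp_le_one_iff.2 (by linarith)
      have h1 := hi (Real.exp (-s) / 2) (by positivity) (by linarith)
      have h2 : r i ^ (-δ) ≤ Real.exp (-δ * s) := by
        rw [Real.rpow_def_of_pos hr]
        exact Real.exp_le_exp.2 (by nlinarith)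
      have h3 : Real.exp (-s) ≤ Real.exp (-δ * s) := Real.exp_le_exp.2 (by nlinarith)
      have h0 := Real.exp_pos (-s)
      calc Q i {η | s < logDrop (r i) η}
          ≤ Q i {η | |r i + η| < (Real.exp (-s) / 2) * r i} :=
            measure_mono fun η hη => (hsub hη).1
        _ = ENNReal.ofReal ((Q i).real {η | |r i + η| < (Real.exp (-s) / 2) * r i}) :=
            by rw [ofReal_measureReal]
        _ ≤ _ := by
            refine ENNReal.ofReal_le_ofReal (h1.trans ?_)
            gcongr ?_ * _
            calc D * (Real.exp (-s) / 2 + r i ^ (-δ)) ≤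
                  D * (Real.exp (-δ * s) + Real.exp (-δ * s)) := by gcongr; linarith
              _ = _ := by ring
    · have : {η | s < logDrop (r i) η} = ∅ :=
        Set.eq_empty_of_forall_notMem fun η hη => hs2 (hsub hη).2
      rw [this, measure_empty]
      exact zero_le
  have hlin : ∫⁻ η, ENNReal.ofReal (logDrop (r i) η ^ 2) ∂(Q i) ≤
      ENNReal.ofReal (4 * D * J * r i ^ (-β)) := by
    have h1 : ∀ η, logDrop (r i) η ^ 2 = ∫ s in (0 : ℝ)..logDrop (r i) η, 2 * s := by
      intro η
      rw [intervalIntegral.integral_const_mul, integral_id]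
      ring
    simp_rw [h1]
    rw [lintegral_comp_eq_lintegral_meas_lt_mul (Q i) (Eventually.of_forall (logDrop_nonneg (r i)))
      (measurable_logDrop _).aemeasurable
      (fun t _ => (by fun_prop : Continuous fun s : ℝ => 2 * s).intervalIntegrable _ _)
      ((ae_restrict_iff' measurableSet_Ioi).2 (Eventually.of_forall fun s hs =>
        mul_nonneg zero_le_two (le_of_lt hs)))]
    calc _ ≤ ∫⁻ s in Set.Ioi (0 : ℝ),
            ENNReal.ofReal (4 * D * r i ^ (-β) * (s * Real.exp (-δ * s))) := by
          refine setLIntegral_mono' measurableSet_Ioi fun s hs => ?_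
          have hs : 0 < s := hs
          calc _ ≤ ENNReal.ofReal (2 * D * Real.exp (-δ * s) * r i ^ (-β)) *
                ENNReal.ofReal (2 * s) := by gcongr; exact htail s hs
            _ = _ := by
                rw [← ENNReal.ofReal_mul (by positivity)]
                congr 1; ring
      _ = ENNReal.ofReal (∫ s in Set.Ioi (0 : ℝ),
            4 * D * r i ^ (-β) * (s * Real.exp (-δ * s))) := by
          refine (ofReal_integral_eq_lintegral_ofReal (hJi.const_mul _) ?_).symm
          refine (ae_restrict_iff' measurableSet_Ioi).2 (Eventually.of_forall fun s hs => ?_)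
          have hs : 0 < s := hs
          positivity
      _ = _ := by
          rw [integral_const_mul]
          congr 1; ring
  have hmeas : AEStronglyMeasurable (fun η => logDrop (r i) η ^ 2) (Q i) :=
    ((measurable_logDrop (r i)).pow_const 2).aestronglyMeasurable
  have hnn : 0 ≤ᵐ[Q i] fun η => logDrop (r i) η ^ 2 := Eventually.of_forall fun η => sq_nonneg _
  refine ⟨⟨hmeas, ?_⟩, ?_⟩
  · rw [hasFiniteIntegral_iff_ofReal hnn]
    exact hlin.trans_lt ENNReal.ofReal_lt_top
  · rw [integral_eq_lintegral_of_nonneg_ae hnn hmeas]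
    refine (ENNReal.toReal_mono ENNReal.ofReal_ne_top hlin).trans_eq ?_
    rw [ENNReal.toReal_ofReal (by positivity)]

end InwardFamily

/-- Second order expansion of the reciprocal of `1 + log⁺`. -/
lemma inv_one_add_posLog_le {r : ℝ} (hr : 2 ≤ r) {η : ℝ} :
    1 / (1 + Real.posLog (r + η)) ≤ 1 / (1 + Real.posLog r) +
      1 / (1 + Real.posLog r) ^ 2 * (-(Real.posLog (r + η) - Real.posLog r) +
        4 / (1 + Real.posLog r) * (4 * sqMin (η / r) + logDrop r η ^ 2) +
        (1 + Real.posLog r) ^ 2 * {y : ℝ | |r + y| < Real.sqrt r}.indicator 1 η) := by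
  have hr0 : 0 < r := by linarith
  set m := 1 + Real.posLog r with hm
  set m' := 1 + Real.posLog (r + η) with hm'
  have hm0 : 1 ≤ m := by have := Real.posLog_nonneg (x := r); linarith
  have hm'0 : 1 ≤ m' := by have := Real.posLog_nonneg (x := r + η); linarith
  have hΔ : Real.posLog (r + η) - Real.posLog r = m' - m := by rw [hm, hm']; ring
  -- Exact second order expansion of `1 / m'` around `m`; the remainder keeps the denominator `m'`,
  -- which must be bounded below.
  have hid : 1 / m' = 1 / m + 1 / m ^ 2 * (-(m' - m) + (m' - m) ^ 2 / m') := by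
    field_simp
    ring
  rw [hΔ, hid]
  set S : Set ℝ := {y : ℝ | |r + y| < Real.sqrt r}
  have hind : 0 ≤ m ^ 2 * S.indicator (1 : ℝ → ℝ) η :=
    mul_nonneg (sq_nonneg m) (Set.indicator_nonneg (fun _ _ => zero_le_one) η)
  have hq : 0 ≤ 4 * sqMin (η / r) + logDrop r η ^ 2 := by
    have := sqMin_nonneg (η / r)
    positivity
  have hkey : (m' - m) ^ 2 / m' ≤ 4 / m * (4 * sqMin (η / r) + logDrop r η ^ 2) +
      m ^ 2 * S.indicator (1 : ℝ → ℝ) η := by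
    -- If `m' ≥ m / 2`, the remainder gains a factor `1 / m`. Otherwise the landing point lies
    -- within `√r` of the origin, and the crude bound `m²` is used there.
    rcases le_or_gt (m / 2) m' with h | h
    · have h1 : (m' - m) ^ 2 ≤ 2 * (4 * sqMin (η / r) + logDrop r η ^ 2) := by
        rw [← hΔ, posLog_sub_eq hr η]
        have := sq_log_max_le (η / r)
        nlinarith [sq_nonneg (Real.log (max |1 + η / r| (1 / 2)) + logDrop r η)]
      have h2 : (m' - m) ^ 2 / m' ≤ 4 / m * (4 * sqMin (η / r) + logDrop r η ^ 2) := by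
        rw [div_le_iff₀ (by linarith)]
        calc (m' - m) ^ 2 ≤ 2 * (4 * sqMin (η / r) + logDrop r η ^ 2) := h1
          _ = 4 / m * (4 * sqMin (η / r) + logDrop r η ^ 2) * (m / 2) := by field_simp; ring
          _ ≤ _ := by gcongr
      linarith
    · have hmem : η ∈ S := by
        change |r + η| < Real.sqrt r
        rcases eq_or_ne (r + η) 0 with h5 | h5
        · rw [h5, abs_zero]; exact Real.sqrt_pos.2 hr0
        · have h6 : Real.log |r + η| ≤ Real.posLog (r + η) := by
            rw [Real.log_abs]; exact le_max_right _ _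
          refine (Real.log_lt_log_iff (abs_pos.2 h5) (Real.sqrt_pos.2 hr0)).1 ?_
          rw [Real.log_sqrt hr0.le]
          have h7 : m = 1 + Real.log r := by rw [hm, posLog_eq_log (by linarith : 1 ≤ r)]
          linarith
      rw [Set.indicator_of_mem hmem, Pi.one_apply, mul_one]
      have h8 : (m' - m) ^ 2 / m' ≤ m ^ 2 := by
        refine (div_le_self (sq_nonneg _) hm'0).trans ?_
        nlinarith
      have : 0 ≤ 4 / m * (4 * sqMin (η / r) + logDrop r η ^ 2) := by positivity
      linarith
  have hlin : -(m' - m) + (m' - m) ^ 2 / m' ≤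
      -(m' - m) + 4 / m * (4 * sqMin (η / r) + logDrop r η ^ 2) +
        m ^ 2 * S.indicator (1 : ℝ → ℝ) η := by linarith
  exact add_le_add_right (mul_le_mul_of_nonneg_left hlin (by positivity)) _

end Transience


lemma tendsto_sq_one_add_posLog_mul_rpow_neg {a : ℝ} (ha : 0 < a) :
    Tendsto (fun x : ℝ => (1 + Real.posLog x) ^ 2 * x ^ (-a)) atTop (𝓝 0) := by
  have h1 : Tendsto (fun x : ℝ => x ^ (-(a / 2)) + Real.log x / x ^ (a / 2)) atTop (𝓝 (0 + 0)) :=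
    (tendsto_rpow_neg_atTop (by positivity)).add
      (isLittleO_log_rpow_atTop (by positivity)).tendsto_div_nhds_zero
  have h2 := h1.pow 2
  rw [add_zero, zero_pow two_ne_zero] at h2
  refine h2.congr' ?_
  filter_upwards [eventually_ge_atTop 1] with x hx
  have hx0 : 0 < x := by linarith
  have hsq : x ^ (-a) = (x ^ (-(a / 2))) ^ 2 := by
    rw [← Real.rpow_mul_natCast hx0.le]
    congr 1
    push_cast
    ring
  have hdiv : Real.log x / x ^ (a / 2) = Real.log x * x ^ (-(a / 2)) := by
    rw [Real.rpow_neg hx0.le, div_eq_mul_inv]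
  rw [posLog_eq_log hx, hdiv, hsq]
  ring

namespace InwardFamily

variable {ι : Type*} {l : Filter ι} {Q : ι → Measure ℝ} {r : ι → ℝ} {α β c K M : ℝ}

/-- In the transient regime the reciprocal of the logarithm is superharmonic far from the
origin. -/
lemma inv_posLog_superharmonic (h : InwardFamily l Q r α β c K M) [l.IsCountablyGenerated]
    {b δ C : ℝ} (hd : Tendsto (fun i => r i ^ (β - 1) * ∫ η, η ∂(Q i)) l (𝓝 b)) (hδ0 : 0 < δ)
    (hδ1 : δ ≤ 1) (hC : 0 ≤ C)
    (hrate : ∀ᶠ i in l, ∀ y, r i / 2 ≤ y →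
      |y ^ β * (Q i).real (Set.Iio (-y)) - c| ≤ C * y ^ (-δ))
    (hpos : 0 < b + c * Real.pi * Real.cot (Real.pi * β)) :
    ∀ᶠ i in l, ∫⁻ η, ENNReal.ofReal (1 / (1 + Real.posLog (r i + η))) ∂(Q i) ≤
      ENNReal.ofReal (1 / (1 + Real.posLog (r i))) := by
  have := h.prob
  have hβ1 := h.one_lt
  obtain ⟨D, hD, hnear⟩ := h.near_origin_le hδ0 hC hrate
  obtain ⟨B, hB0, hdrop⟩ := h.logDrop_sq_bound hδ0 hδ1 hD hnear
  obtain ⟨S, hS0, hsq⟩ := h.sqMin_bound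
  -- As `ε → 0` the loss `B / log (1 / (6 ε))` vanishes as well, so it fits under the strict
  -- inequality.
  have hε : ∀ᶠ ε : ℝ in 𝓝[>] 0,
      0 < b + c * (∫ s in Set.Ioi (0 : ℝ), s ^ (-β) * cutLogDeriv ε s) -
        B / Real.log (1 / (6 * ε)) ∧ 0 < ε ∧ ε < 1 / 6 := by
    have h1 := ((tendsto_integral_mul_cutLogDeriv h.one_lt h.lt_two).const_mul c).const_add b
    rw [← mul_assoc] at h1
    have h2 : Tendsto (fun ε : ℝ => Real.log (1 / (6 * ε))) (𝓝[>] 0) atTop := by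
      refine Real.tendsto_log_atTop.comp ?_
      refine (tendsto_inv_nhdsGT_zero.const_mul_atTop (show (0 : ℝ) < 1 / 6 by norm_num)).congr
        fun ε => ?_
      rw [one_div, one_div, mul_inv]
    have h3 := h1.sub (h2.const_div_atTop B)
    rw [sub_zero] at h3
    filter_upwards [h3.eventually_const_lt hpos,
      Ioo_mem_nhdsGT (show (0 : ℝ) < 1 / 6 by norm_num)] with ε h4 h5
    exact ⟨h4, h5.1, h5.2⟩
  obtain ⟨ε, hε1, hε0, hε⟩ := hε.exists
  set Λ := Real.log (1 / (6 * ε)) with hΛ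
  have hΛ0 : 0 < Λ := Real.log_pos (by
    rw [one_lt_div (by positivity)]; linarith)
  have hmain := ((h.tendsto_drift hd).add
    (h.tendsto_integral_cutLog hε0 (by linarith : ε ≤ 1 / 4))).neg
  have hm : Tendsto (fun i => 1 + Real.posLog (r i)) l atTop := by
    refine tendsto_atTop_add_const_left _ _ ?_
    refine (Real.tendsto_log_atTop.comp h.tendsto_r).congr' ?_
    filter_upwards [h.tendsto_r.eventually_ge_atTop 1] with i hi
    exact (posLog_eq_log hi).symm
  have hpow : Tendsto (fun i => max M 0 * r i ^ (-(α - β))) l (𝓝 (max M 0 * 0)) :=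
    ((tendsto_rpow_neg_atTop (sub_pos.2 h.beta_lt)).comp h.tendsto_r).const_mul _
  have hquad : Tendsto (fun i => (4 / (1 + Real.posLog (r i))) * (4 * S + B)) l
      (𝓝 (0 * (4 * S + B))) := (hm.const_div_atTop 4).mul_const _
  -- Landings within `√r = r^(-1/2) r` cost `(1 + log r)²`, but their probability carries `r^(-1/2)
  -- + r^(-δ)` beyond `r^(-β)`.
  have hnr : Tendsto (fun i => D * ((1 + Real.posLog (r i)) ^ 2 * r i ^ (-(1 / 2) : ℝ) +
      (1 + Real.posLog (r i)) ^ 2 * r i ^ (-δ))) l (𝓝 (D * (0 + 0))) :=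
    (((tendsto_sq_one_add_posLog_mul_rpow_neg (by norm_num)).comp h.tendsto_r).add
      ((tendsto_sq_one_add_posLog_mul_rpow_neg hδ0).comp h.tendsto_r)).const_mul D
  have hlim := (((hmain.add hpow).add_const (B / Λ)).add hquad).add hnr
  have hlt : -(b + c * ∫ s in Set.Ioi (0 : ℝ), s ^ (-β) * cutLogDeriv ε s) + max M 0 * 0 + B / Λ +
      0 * (4 * S + B) + D * (0 + 0) < 0 := by linarith
  filter_upwards [hlim.eventually_lt_const hlt, h.integrable, h.integrable_cutLog hε0
    (by linarith : ε ≤ 1 / 4), h.integrable_outward, h.integrable_sqMin, hsq, hdrop, hnear,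
    h.tendsto_r.eventually_ge_atTop 4] with i hi hint hcut hout hsm hsqi hdr hnri hr
  have hr0 : 0 < r i := by linarith
  set m := 1 + Real.posLog (r i) with hmdef
  have hm0 : 1 ≤ m := by have := Real.posLog_nonneg (x := r i); linarith
  set N : Set ℝ := {y : ℝ | |r i + y| < Real.sqrt (r i)} with hN
  have hNm : MeasurableSet N := measurableSet_lt (by fun_prop) measurable_const
  have hi1 : Integrable (fun η => η / r i) (Q i) := hint.div_const _
  have hi2 : Integrable (fun η => max η 0 ^ α / r i ^ α) (Q i) := hout.1.div_const _
  have hi3 : Integrable (fun η => logDrop (r i) η ^ 2 / Λ) (Q i) := hdr.1.div_const _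
  have hi4 : Integrable (fun η => 4 * sqMin (η / r i)) (Q i) :=
    (hsm (r i) (by linarith)).const_mul 4
  have hi5 : Integrable (fun η => m ^ 2 * N.indicator 1 η) (Q i) :=
    ((integrable_const (1 : ℝ)).indicator hNm).const_mul _
  have hi6 : Integrable (fun η => η / r i + cutLog ε (inward (r i) η)) (Q i) := hi1.add hcut
  have hi7 : Integrable (fun η => η / r i + cutLog ε (inward (r i) η) -
      max η 0 ^ α / r i ^ α) (Q i) := hi6.sub hi2
  have hi8 : Integrable (fun η => η / r i + cutLog ε (inward (r i) η) -
      max η 0 ^ α / r i ^ α - logDrop (r i) η ^ 2 / Λ) (Q i) := hi7.sub hi3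
  have hi8' : Integrable (fun η => -(η / r i + cutLog ε (inward (r i) η) -
      max η 0 ^ α / r i ^ α - logDrop (r i) η ^ 2 / Λ)) (Q i) := hi8.neg
  have hi9 : Integrable (fun η => 4 * sqMin (η / r i) + logDrop (r i) η ^ 2) (Q i) :=
    hi4.add hdr.1
  have hi10 : Integrable (fun η => 4 / m * (4 * sqMin (η / r i) + logDrop (r i) η ^ 2)) (Q i) :=
    hi9.const_mul _
  have hi11 : Integrable (fun η => -(η / r i + cutLog ε (inward (r i) η) -
      max η 0 ^ α / r i ^ α - logDrop (r i) η ^ 2 / Λ) +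
      4 / m * (4 * sqMin (η / r i) + logDrop (r i) η ^ 2)) (Q i) := hi8'.add hi10
  refine (lintegral_ofReal_le (a := 1 / m)
    (h := fun η => 1 / m ^ 2 * (-(η / r i + cutLog ε (inward (r i) η) -
      max η 0 ^ α / r i ^ α - logDrop (r i) η ^ 2 / Λ) +
      4 / m * (4 * sqMin (η / r i) + logDrop (r i) η ^ 2) + m ^ 2 * N.indicator 1 η))
    (fun η => ?_) (fun η => ?_) ((hi11.add hi5).const_mul _)).trans (ENNReal.ofReal_le_ofReal ?_)
  · have := Real.posLog_nonneg (x := r i + η)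
    positivity
  · refine (inv_one_add_posLog_le (by linarith : 2 ≤ r i)).trans ?_
    have h1 := posLog_sub_ge (by linarith : 2 ≤ r i) hε0 hε (by linarith [h.beta_lt] : 1 ≤ α)
      h.alpha_le η
    refine add_le_add_right (mul_le_mul_of_nonneg_left ?_ (by positivity)) _
    linarith
  · rw [integral_const_mul, integral_add hi11 hi5, integral_add hi8' hi10, integral_neg,
      integral_sub hi7 hi3, integral_sub hi6 hi2, integral_add hi1 hcut, integral_const_mul,
      integral_const_mul, integral_add hi4 hdr.1, integral_const_mul,
      integral_indicator_one hNm, integral_div (r i ^ α), integral_div Λ]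
    have hp : 0 < r i ^ β := by positivity
    have hinv : r i ^ β * r i ^ (-β) = 1 := by rw [← Real.rpow_add hr0]; simp
    have e1 : r i ^ β * ((∫ η, max η 0 ^ α ∂(Q i)) / r i ^ α) ≤ max M 0 * r i ^ (-(α - β)) := by
      rw [show -(α - β) = β - α by ring, Real.rpow_sub hr0, ← mul_div_assoc, ← mul_div_assoc,
        mul_comm]
      gcongr
      exact hout.2
    have e2 : r i ^ β * ∫ η, logDrop (r i) η ^ 2 ∂(Q i) ≤ B := by
      calc _ ≤ r i ^ β * (B * r i ^ (-β)) := by gcongr; exact hdr.2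
        _ = B * (r i ^ β * r i ^ (-β)) := by ring
        _ = B := by rw [hinv, mul_one]
    have e3 : r i ^ β * ∫ η, sqMin (η / r i) ∂(Q i) ≤ S := by
      calc _ ≤ r i ^ β * (S * r i ^ (-β)) := by gcongr; exact hsqi (r i) (by linarith)
        _ = S * (r i ^ β * r i ^ (-β)) := by ring
        _ = S := by rw [hinv, mul_one]
    have hhalf : r i ^ (-(1 / 2) : ℝ) ≤ 1 / 2 := by
      have h4 : (4 : ℝ) ^ (-(1 / 2) : ℝ) = 1 / 2 := by
        rw [show (4 : ℝ) = 2 ^ (2 : ℝ) by norm_num, ← Real.rpow_mul (by norm_num)]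
        norm_num
      exact (Real.rpow_le_rpow_of_nonpos (by norm_num) hr (by norm_num)).trans_eq h4
    have hNeq : N = {η | |r i + η| < r i ^ (-(1 / 2) : ℝ) * r i} := by
      rw [hN]
      congr! 3
      nth_rw 3 [← Real.rpow_one (r i)]
      rw [← Real.rpow_add hr0, Real.sqrt_eq_rpow]
      norm_num
    have e4 : r i ^ β * (Q i).real N ≤ D * (r i ^ (-(1 / 2) : ℝ) + r i ^ (-δ)) := by
      have h5 := hnri _ (by positivity) hhalf
      rw [← hNeq] at h5
      calc _ ≤ r i ^ β * (D * (r i ^ (-(1 / 2) : ℝ) + r i ^ (-δ)) * r i ^ (-β)) := by gcongr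
        _ = D * (r i ^ (-(1 / 2) : ℝ) + r i ^ (-δ)) * (r i ^ β * r i ^ (-β)) := by ring
        _ = _ := by rw [hinv, mul_one]
    have f2 : r i ^ β * ((∫ η, logDrop (r i) η ^ 2 ∂(Q i)) / Λ) ≤ B / Λ := by
      rw [← mul_div_assoc]; gcongr
    have f3 : 4 / m * (4 * (r i ^ β * ∫ η, sqMin (η / r i) ∂(Q i)) +
        r i ^ β * ∫ η, logDrop (r i) η ^ 2 ∂(Q i)) ≤ 4 / m * (4 * S + B) := by gcongr
    have f4 : m ^ 2 * (r i ^ β * (Q i).real N) ≤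
        m ^ 2 * (D * (r i ^ (-(1 / 2) : ℝ) + r i ^ (-δ))) := by gcongr
    have hle : ∀ w : ℝ, r i ^ β * w ≤ 0 → 1 / m + 1 / m ^ 2 * w ≤ 1 / m := by
      intro w hw
      have h6 := nonpos_of_mul_nonpos_right hw hp
      have h7 : 1 / m ^ 2 * w ≤ 0 := mul_nonpos_of_nonneg_of_nonpos (by positivity) h6
      linarith
    refine hle _ ?_
    linear_combination e1 + f2 + f3 + f4 + hi.le

end InwardFamily


/-! ### From uniform assumptions to inward families -/

section Families

variable {ι : Type*} {Q : ι → Measure ℝ} {r : ι → ℝ} {α β c x₀ : ℝ}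

lemma eventually_comap_atTop {p : ι → Prop} :
    (∀ᶠ i in comap r atTop, p i) ↔ ∃ R : ℝ, ∀ i, R < r i → p i := by
  rw [eventually_comap]
  constructor
  · intro h
    obtain ⟨R, hR⟩ := eventually_atTop.1 h
    exact ⟨R, fun i hi => hR _ hi.le i rfl⟩
  · rintro ⟨R, hR⟩
    filter_upwards [eventually_gt_atTop R] with y hy i hi
    exact hR i (hi ▸ hy)

/-- Uniform inward tail asymptotics and uniform outward moments give an inward family. -/
lemma InwardFamily.of_tendstoUniformlyOn (h1 : 1 < β) (h2 : β < 2) (h3 : β < α) (hc : 0 < c)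
    (hQ : ∀ i, IsProbabilityMeasure (Q i))
    (htail : TendstoUniformlyOn (fun (y : ℝ) i => y ^ β * (Q i).real (Set.Iio (-y))) (fun _ => c)
      atTop {i | x₀ ≤ r i})
    (hmom : (⨆ i ∈ {i | x₀ ≤ r i}, ∫⁻ η, ENNReal.ofReal (max η 0 ^ α) ∂(Q i)) < ∞) :
    ∃ K M, InwardFamily (comap r atTop) Q r (min α 2) β c K M := by
  have hev : ∀ᶠ i in comap r atTop, x₀ ≤ r i :=
    tendsto_comap.eventually (eventually_ge_atTop x₀)
  rw [Metric.tendstoUniformlyOn_iff] at htail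
  obtain ⟨y₀, hy₀⟩ := eventually_atTop.1 (htail 1 one_pos)
  set y₁ := max y₀ 1 with hy₁
  have hy₁1 : 1 ≤ y₁ := le_max_right _ _
  set M := ⨆ i ∈ {i | x₀ ≤ r i}, ∫⁻ η, ENNReal.ofReal (max η 0 ^ α) ∂(Q i) with hM
  -- For `y ≤ y₁` the tail is at most `1 ≤ y₁^β y^(-β)`; beyond, uniform convergence gives `c + 1`.
  -- The moment of order `min α 2` is at most `1 + M`.
  refine ⟨max (c + 1) (y₁ ^ β), (1 + M).toReal,
    { one_lt := h1, lt_two := h2, beta_lt := lt_min h3 h2, alpha_le := min_le_right _ _,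
      c_pos := hc, prob := hQ, tendsto_r := tendsto_comap, tail_le := ?_, tail_lim := ?_,
      moment := ?_ }⟩
  · filter_upwards [hev] with i hi y hy
    have hone : y ^ β * y ^ (-β) = 1 := by rw [← Real.rpow_add hy]; simp
    have hyn : 0 < y ^ (-β) := by positivity
    rcases le_total y₁ y with h | h
    · have h4 := hy₀ y ((le_max_left _ _).trans h) i hi
      rw [Real.dist_eq, abs_sub_comm] at h4
      have h5 := (abs_lt.1 h4).2
      calc (Q i).real (Set.Iio (-y))
          = (y ^ β * (Q i).real (Set.Iio (-y))) * y ^ (-β) := by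
            rw [mul_right_comm, hone, one_mul]
        _ ≤ max (c + 1) (y₁ ^ β) * y ^ (-β) := by
            gcongr
            exact (by linarith : _ ≤ c + 1).trans (le_max_left _ _)
    · calc (Q i).real (Set.Iio (-y)) ≤ 1 := measureReal_le_one
        _ = y ^ β * y ^ (-β) := hone.symm
        _ ≤ max (c + 1) (y₁ ^ β) * y ^ (-β) := by
            gcongr
            exact (Real.rpow_le_rpow hy.le h (by linarith)).trans (le_max_right _ _)
  · intro s hs
    have hlim : Tendsto (fun i => (s * r i) ^ β * (Q i).real (Set.Iio (-(s * r i))))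
        (comap r atTop) (𝓝 c) := by
      rw [Metric.tendsto_nhds]
      intro e he
      filter_upwards [hev, (tendsto_comap.const_mul_atTop hs).eventually (htail e he)] with i h4 h5
      rw [dist_comm]
      exact h5 i h4
    have hlim' := hlim.mul_const (s ^ (-β))
    refine hlim'.congr' ?_
    filter_upwards [tendsto_comap.eventually (eventually_gt_atTop 0)] with i hi
    rw [Real.mul_rpow hs.le (le_of_lt hi)]
    have : s ^ β * s ^ (-β) = 1 := by rw [← Real.rpow_add hs]; simp
    linear_combination (r i ^ β * (Q i).real (Set.Iio (-(s * r i)))) * this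
  · filter_upwards [hev] with i hi
    have := hQ i
    have h4 : 1 + M ≠ ∞ := ENNReal.add_ne_top.2 ⟨ENNReal.one_ne_top, hmom.ne⟩
    rw [ENNReal.ofReal_toReal h4]
    calc ∫⁻ η, ENNReal.ofReal (max η 0 ^ min α 2) ∂(Q i)
        ≤ ∫⁻ η, (1 + ENNReal.ofReal (max η 0 ^ α)) ∂(Q i) := by
          refine lintegral_mono fun η => ?_
          have h5 : 0 ≤ max η 0 := le_max_right _ _
          rw [← ENNReal.ofReal_one, ← ENNReal.ofReal_add zero_le_one (by positivity)]
          refine ENNReal.ofReal_le_ofReal ?_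
          have hmin : 0 < min α 2 := lt_min (by linarith) two_pos
          rcases le_total (max η 0) 1 with h6 | h6
          · have := Real.rpow_le_one h5 h6 hmin.le
            have := Real.rpow_nonneg h5 α
            linarith
          · have := Real.rpow_le_rpow_of_exponent_le h6 (min_le_left α 2)
            linarith
      _ = 1 + ∫⁻ η, ENNReal.ofReal (max η 0 ^ α) ∂(Q i) := by
          rw [lintegral_add_left measurable_const]; simp
      _ ≤ 1 + M := by
          gcongr
          exact le_iSup₂ (f := fun i (_ : i ∈ {i | x₀ ≤ r i}) =>
            ∫⁻ η, ENNReal.ofReal (max η 0 ^ α) ∂(Q i)) i hi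

lemma eventually_rate {T : ι → ℝ → ℝ} {C δ : ℝ}
    (h : ∀ᶠ y : ℝ in atTop, ∀ i, x₀ ≤ r i → |y ^ β * T i y - c| ≤ C * y ^ (-δ)) :
    ∀ᶠ i in comap r atTop, ∀ y, r i / 2 ≤ y → |y ^ β * T i y - c| ≤ |C| * y ^ (-min δ 1) := by
  obtain ⟨y₀, hy₀⟩ := eventually_atTop.1 h
  filter_upwards [tendsto_comap.eventually (eventually_ge_atTop x₀),
    tendsto_comap.eventually (eventually_ge_atTop (2 * max y₀ 1))] with i h1 h2 y hy
  have h3 : max y₀ 1 ≤ y := by linarith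
  have h4 : 1 ≤ y := (le_max_right _ _).trans h3
  refine (hy₀ y ((le_max_left _ _).trans h3) i h1).trans ?_
  gcongr
  · exact le_abs_self C
  · exact min_le_left _ _

/-- When `γ > β - 1` the drift is negligible at the critical scale, which reduces this regime to the
balanced one with constant `0`. -/
lemma tendsto_rpow_mul_of_lt {F : ι → ℝ} {γ b : ℝ} (hγ : β - 1 < γ)
    (h : Tendsto (fun i => r i ^ γ * F i) (comap r atTop) (𝓝 b)) :
    Tendsto (fun i => r i ^ (β - 1) * F i) (comap r atTop) (𝓝 0) := by
  have h1 := (((tendsto_rpow_neg_atTop (sub_pos.2 hγ)).comp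
    (tendsto_comap : Tendsto r (comap r atTop) atTop))).mul h
  rw [zero_mul] at h1
  refine h1.congr' ?_
  filter_upwards [tendsto_comap.eventually (eventually_gt_atTop 0)] with i hi
  rw [Function.comp_apply, ← mul_assoc, ← Real.rpow_add hi]
  congr 2
  ring

end Families

/-! ### Increments of the chain on the two half-lines, matched by reflection -/

section Increments

variable {X : Set ℝ} (P : Kernel X X)

/-- The law of the increment from `x`. -/
def rightIncrement (x : X) : Measure ℝ := (P x).map fun z : X => (z : ℝ) - x

/-- The law of the reflected increment from `x`. -/
def leftIncrement (x : X) : Measure ℝ := (P x).map fun z : X => (x : ℝ) - z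

variable {P}

lemma measurable_sub_coe (x : X) : Measurable fun z : X => (z : ℝ) - x :=
  measurable_subtype_coe.sub_const _

lemma measurable_coe_sub (x : X) : Measurable fun z : X => (x : ℝ) - z :=
  measurable_subtype_coe.const_sub _

lemma lintegral_rightIncrement {F : ℝ → ℝ≥0∞} (hF : Measurable F) (x : X) :
    ∫⁻ η, F ((x : ℝ) + η) ∂(rightIncrement P x) = ∫⁻ z : X, F z ∂(P x) := by
  rw [rightIncrement, lintegral_map (by fun_prop) (measurable_sub_coe x)]
  simp

lemma lintegral_leftIncrement {F : ℝ → ℝ≥0∞} (hF : Measurable F) (x : X) :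
    ∫⁻ η, F (-(x : ℝ) + η) ∂(leftIncrement P x) = ∫⁻ z : X, F (-(z : ℝ)) ∂(P x) := by
  rw [leftIncrement, lintegral_map (by fun_prop) (measurable_coe_sub x)]
  congr! 2 with z
  ring_nf

lemma integral_rightIncrement (x : X) : ∫ η, η ∂(rightIncrement P x) = drift P x :=
  integral_map (measurable_sub_coe x).aemeasurable measurable_id.aestronglyMeasurable

lemma integral_leftIncrement (x : X) : ∫ η, η ∂(leftIncrement P x) = -drift P x := by
  rw [leftIncrement, drift, ← integral_neg]
  refine (integral_map (f := fun η : ℝ => η) (measurable_coe_sub x).aemeasurable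
    measurable_id.aestronglyMeasurable).trans ?_
  simp

lemma rightIncrement_Iio {y : ℝ} (hy : 0 ≤ y) (x : X) :
    (rightIncrement P x).real (Set.Iio (-y)) = negTail P x y := by
  rw [rightIncrement, map_measureReal_apply (measurable_sub_coe x) measurableSet_Iio, negTail]
  congr 1
  ext z
  simp only [Set.mem_preimage, Set.mem_Iio, Set.mem_ofPred_eq, lt_max_iff, not_lt.2 hy, or_false]
  constructor <;> intro h <;> linarith

lemma leftIncrement_Iio {y : ℝ} (hy : 0 ≤ y) (x : X) :
    (leftIncrement P x).real (Set.Iio (-y)) = posTail P x y := by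
  rw [leftIncrement, map_measureReal_apply (measurable_coe_sub x) measurableSet_Iio, posTail]
  congr 1
  ext z
  simp only [Set.mem_preimage, Set.mem_Iio, Set.mem_ofPred_eq, lt_max_iff, not_lt.2 hy, or_false]
  constructor <;> intro h <;> linarith

variable {α β c x₀ γ b : ℝ}

lemma DriftAsymptotics.tendsto_right (hD : DriftAsymptotics P γ b) :
    Tendsto (fun x : X => (x : ℝ) ^ γ * ∫ η, η ∂(rightIncrement P x))
      (comap (fun x : X => (x : ℝ)) atTop) (𝓝 b) := by
  simpa only [integral_rightIncrement] using hD.right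

lemma DriftAsymptotics.tendsto_left (hD : DriftAsymptotics P γ b) :
    Tendsto (fun x : X => (-(x : ℝ)) ^ γ * ∫ η, η ∂(leftIncrement P x))
      (comap (fun x : X => -(x : ℝ)) atTop) (𝓝 b) := by
  have h1 : comap (fun x : X => -(x : ℝ)) atTop = comap (fun x : X => (x : ℝ)) atBot := by
    rw [← comap_neg_atTop, comap_comap]
    rfl
  have h2 := hD.left
  rw [← h1] at h2
  refine h2.congr' ?_
  filter_upwards [tendsto_comap.eventually (eventually_gt_atTop 0)] with x hx
  rw [integral_leftIncrement, abs_of_neg (by linarith)]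
  ring

lemma eventually_abs {q : X → Prop} (hR : ∀ᶠ x in comap (fun x : X => (x : ℝ)) atTop, q x)
    (hL : ∀ᶠ x in comap (fun x : X => -(x : ℝ)) atTop, q x) :
    ∃ R : ℝ, 0 ≤ R ∧ ∀ x : X, R < |(x : ℝ)| → q x := by
  obtain ⟨R₁, h1⟩ := eventually_comap_atTop.1 hR
  obtain ⟨R₂, h2⟩ := eventually_comap_atTop.1 hL
  refine ⟨max 0 (max R₁ R₂), le_max_left _ _, fun x hx => ?_⟩
  simp only [max_lt_iff] at hx
  rcases abs_choice (x : ℝ) with h | h <;> rw [h] at hx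
  · exact h1 x hx.2.1
  · exact h2 x hx.2.2

/-- A one-step estimate for an even function holds on both sides of the line as soon as it holds
for the increments and the reflected increments. -/
lemma eventually_abs_lintegral {q : ℝ≥0∞ → ℝ → Prop} {F : ℝ → ℝ≥0∞} (hF : Measurable F)
    (hFe : ∀ y, F (-y) = F y)
    (hR : ∀ᶠ x : X in comap (fun x : X => (x : ℝ)) atTop,
      q (∫⁻ η, F ((x : ℝ) + η) ∂(rightIncrement P x)) x)
    (hL : ∀ᶠ x : X in comap (fun x : X => -(x : ℝ)) atTop,
      q (∫⁻ η, F (-(x : ℝ) + η) ∂(leftIncrement P x)) (-(x : ℝ))) :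
    ∃ R : ℝ, 0 ≤ R ∧ ∀ x : X, R < |(x : ℝ)| → q (∫⁻ z : X, F z ∂(P x)) |(x : ℝ)| := by
  refine eventually_abs ?_ ?_
  · filter_upwards [hR, tendsto_comap.eventually (eventually_gt_atTop 0)] with x hx h0
    rwa [lintegral_rightIncrement hF, ← abs_of_pos h0] at hx
  · filter_upwards [hL, tendsto_comap.eventually (eventually_gt_atTop 0)] with x hx h0
    rw [lintegral_leftIncrement hF, ← abs_of_pos h0, abs_neg] at hx
    simpa only [hFe] using hx

/-- A one-step estimate for a one-sided function, on each side of the line. -/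
lemma exists_forall_lintegral_le {f : ℝ → ℝ} (hf : Measurable f)
    (hR : ∀ᶠ x : X in comap (fun x : X => (x : ℝ)) atTop,
      ∫⁻ η, ENNReal.ofReal (f ((x : ℝ) + η)) ∂(rightIncrement P x) ≤ ENNReal.ofReal (f x))
    (hL : ∀ᶠ x : X in comap (fun x : X => -(x : ℝ)) atTop,
      ∫⁻ η, ENNReal.ofReal (f (-(x : ℝ) + η)) ∂(leftIncrement P x) ≤
        ENNReal.ofReal (f (-(x : ℝ)))) :
    ∃ R : ℝ, (∀ x : X, R < (x : ℝ) →
        ∫⁻ z : X, ENNReal.ofReal (f z) ∂(P x) ≤ ENNReal.ofReal (f x)) ∧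
      ∀ x : X, R < -(x : ℝ) →
        ∫⁻ z : X, ENNReal.ofReal (f (-(z : ℝ))) ∂(P x) ≤ ENNReal.ofReal (f (-(x : ℝ))) := by
  obtain ⟨R₁, h1⟩ := eventually_comap_atTop.1 hR
  obtain ⟨R₂, h2⟩ := eventually_comap_atTop.1 hL
  refine ⟨max R₁ R₂, fun x hx => ?_, fun x hx => ?_⟩
  · have h3 := h1 x ((le_max_left _ _).trans_lt hx)
    rwa [lintegral_rightIncrement (F := fun y => ENNReal.ofReal (f y)) hf.ennreal_ofReal] at h3
  · have h3 := h2 x ((le_max_right _ _).trans_lt hx)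
    rwa [lintegral_leftIncrement (F := fun y => ENNReal.ofReal (f y)) hf.ennreal_ofReal] at h3

variable [IsMarkovKernel P]

lemma InwardTails.right_family (hT : InwardTails P α β c x₀) :
    ∃ K M, InwardFamily (comap (fun x : X => (x : ℝ)) atTop) (rightIncrement P)
      (fun x : X => (x : ℝ)) (min α 2) β c K M := by
  refine InwardFamily.of_tendstoUniformlyOn (x₀ := x₀) hT.one_lt_beta hT.beta_lt_two
    hT.beta_lt_alpha hT.c_pos
    (fun x => Measure.isProbabilityMeasure_map (measurable_sub_coe x).aemeasurable)
    (hT.right_inward.congr ?_) (lt_of_eq_of_lt ?_ hT.right_outward)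
  · filter_upwards [eventually_ge_atTop 0] with y hy x _
    simp only [rightIncrement_Iio hy]
  · congr! 4 with x hx
    rw [rightIncrement, posMoment, lintegral_map (by fun_prop) (measurable_sub_coe x)]

lemma InwardTails.left_family (hT : InwardTails P α β c x₀) :
    ∃ K M, InwardFamily (comap (fun x : X => -(x : ℝ)) atTop) (leftIncrement P)
      (fun x : X => -(x : ℝ)) (min α 2) β c K M := by
  have hset : {x : X | x₀ ≤ -(x : ℝ)} = {x : X | (x : ℝ) ≤ -x₀} := by
    ext x; simp only [Set.mem_ofPred_eq, le_neg]
  refine InwardFamily.of_tendstoUniformlyOn (x₀ := x₀) hT.one_lt_beta hT.beta_lt_two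
    hT.beta_lt_alpha hT.c_pos
    (fun x => Measure.isProbabilityMeasure_map (measurable_coe_sub x).aemeasurable)
    (hset ▸ hT.left_inward.congr ?_) (lt_of_eq_of_lt ?_ hT.left_outward)
  · filter_upwards [eventually_ge_atTop 0] with y hy x _
    simp only [leftIncrement_Iio hy]
  · rw [hset]
    congr! 4 with x hx
    rw [leftIncrement, negMoment, lintegral_map (by fun_prop) (measurable_coe_sub x)]

end Increments


/-! ### Assembly of the regimes -/

section Classification

lemma cot_pi_mul_neg {β : ℝ} (h1 : 3 / 2 < β) (h2 : β < 2) : Real.cot (Real.pi * β) < 0 := by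
  have hπ := Real.pi_pos
  rw [Real.cot_eq_cos_div_sin]
  have hc : 0 < Real.cos (Real.pi * β) := by
    rw [← Real.cos_sub_two_pi]
    exact Real.cos_pos_of_mem_Ioo ⟨by nlinarith, by nlinarith⟩
  have hs : Real.sin (Real.pi * β) < 0 := by
    rw [← Real.sin_sub_two_pi]
    exact Real.sin_neg_of_neg_of_neg_pi_lt (by nlinarith) (by nlinarith)
  exact div_neg_of_pos_of_neg hc hs

lemma cot_pi_mul_pos {β : ℝ} (h1 : 1 < β) (h2 : β < 3 / 2) : 0 < Real.cot (Real.pi * β) := by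
  have hπ := Real.pi_pos
  rw [Real.cot_eq_cos_div_sin]
  have hc : Real.cos (Real.pi * β) < 0 :=
    Real.cos_neg_of_pi_div_two_lt_of_lt (by nlinarith) (by nlinarith)
  have hs : Real.sin (Real.pi * β) < 0 := by
    rw [← Real.sin_sub_two_pi]
    exact Real.sin_neg_of_neg_of_neg_pi_lt (by nlinarith) (by nlinarith)
  exact div_pos_of_neg_of_neg hc hs

variable {X : Set ℝ} {P : Kernel X X} [IsMarkovKernel P] {I : Set (ProbabilityMeasure X)}
  {α β c x₀ γ b : ℝ}

lemma exists_natCast_le_ofReal {g : ℝ → ℝ} (hg : Tendsto g atTop atTop) (K : ℕ) :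
    ∃ R : ℝ, ∀ x : X, R < |(x : ℝ)| → (K : ℝ≥0∞) ≤ ENNReal.ofReal (g |(x : ℝ)|) := by
  obtain ⟨R, hR⟩ := eventually_atTop.1 (hg.eventually_ge_atTop (K : ℝ))
  refine ⟨R, fun x hx => ?_⟩
  rw [← ENNReal.ofReal_natCast]
  exact ENNReal.ofReal_le_ofReal (hR _ hx.le)

lemma tendsto_posLog_atTop : Tendsto Real.posLog atTop atTop :=
  tendsto_atTop_mono (fun _ => le_max_right _ _) Real.tendsto_log_atTop

lemma jump_tail_ge (hβ : 0 < β) (hc : 0 < c) {p t : ℝ → ℝ} {s : ℝ}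
    (ht : Tendsto (fun y => y ^ β * t y) atTop (𝓝 c)) (hp : ∀ y, s ≤ y → t (y + s) ≤ p y) :
    ∀ᶠ Y : ℝ in atTop, c / 2 * 2 ^ (-β) * Y ^ (-β) ≤ p Y := by
  have hev := (tendsto_atTop_add_const_right atTop s tendsto_id).eventually
    (ht.eventually_const_lt (show c / 2 < c by linarith))
  filter_upwards [hev, eventually_ge_atTop s, eventually_gt_atTop 0,
    eventually_gt_atTop (-s)] with Y h1 h2 h3 h4
  have hY : 0 < Y + s := by linarith
  simp only [id] at h1
  calc c / 2 * 2 ^ (-β) * Y ^ (-β) = c / 2 * (2 * Y) ^ (-β) := by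
        rw [Real.mul_rpow two_pos.le h3.le]; ring
    _ ≤ c / 2 * (Y + s) ^ (-β) := by
        have := Real.rpow_le_rpow_of_nonpos hY (by linarith : Y + s ≤ 2 * Y)
          (by linarith : -β ≤ 0)
        gcongr
    _ ≤ ((Y + s) ^ β * t (Y + s)) * (Y + s) ^ (-β) := by gcongr
    _ = t (Y + s) := by
        rw [mul_right_comm, ← Real.rpow_add hY]; simp
    _ ≤ p Y := hp Y h2

/-- An inward jump longer than `Y + |x|` crosses the origin and lands beyond `Y`. For `Y ≥ |x|` the
length is at most `2 Y`, whence the factor `2^(-β)`; halving `c` absorbs the convergence of the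
tail. -/
lemma InwardTails.jump (hT : InwardTails P α β c x₀) {x : X} (hx : x₀ ≤ |(x : ℝ)|) :
    ∀ᶠ Y : ℝ in atTop, c / 2 * 2 ^ (-β) * Y ^ (-β) ≤ (P x).real {z : X | Y ≤ |(z : ℝ)|} := by
  have hβ : 0 < β := by linarith [hT.one_lt_beta]
  rcases le_total 0 (x : ℝ) with h | h
  · rw [abs_of_nonneg h] at hx
    refine jump_tail_ge hβ hT.c_pos (s := (x : ℝ)) (hT.right_inward.tendsto_at hx) fun y hy => ?_
    refine measureReal_mono fun z hz => ?_
    rcases lt_max_iff.1 (show y + (x : ℝ) < max ((x : ℝ) - z) 0 from hz) with h1 | h1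
    · exact le_trans (by linarith) (neg_le_abs (z : ℝ))
    · linarith
  · rw [abs_of_nonpos h] at hx
    refine jump_tail_ge hβ hT.c_pos (s := -(x : ℝ))
      (hT.left_inward.tendsto_at (le_neg.1 hx)) fun y hy => ?_
    refine measureReal_mono fun z hz => ?_
    rcases lt_max_iff.1 (show y + -(x : ℝ) < max ((z : ℝ) - x) 0 from hz) with h1 | h1
    · exact le_trans (by linarith) (le_abs_self (z : ℝ))
    · linarith

/-- The sign condition serves recurrence only. Infinite mean passage times use just that the drift
is at most of critical order, together with the lower bound on long jumps. -/
lemma nullRecurrent_of_drift (hN : NonConfined P I) (hT : InwardTails P α β c x₀)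
    (hR : Tendsto (fun x : X => (x : ℝ) ^ (β - 1) * ∫ η, η ∂(rightIncrement P x))
      (comap (fun x : X => (x : ℝ)) atTop) (𝓝 b))
    (hL : Tendsto (fun x : X => (-(x : ℝ)) ^ (β - 1) * ∫ η, η ∂(leftIncrement P x))
      (comap (fun x : X => -(x : ℝ)) atTop) (𝓝 b))
    (hneg : b + c * Real.pi * Real.cot (Real.pi * β) < 0) : NullRecurrent P I := by
  obtain ⟨K₁, M₁, h₁⟩ := hT.right_family
  obtain ⟨K₂, M₂, h₂⟩ := hT.left_family
  constructor
  · obtain ⟨R, hR0, hV⟩ := eventually_abs_lintegral (P := P)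
      (q := fun m y => m ≤ ENNReal.ofReal (Real.posLog y))
      (F := fun y => ENNReal.ofReal (Real.posLog y)) measurable_posLog.ennreal_ofReal
      (fun y => by rw [← Real.posLog_abs, abs_neg, Real.posLog_abs])
      (h₁.posLog_superharmonic hR hneg) (h₂.posLog_superharmonic hL hneg)
    refine recurrent_of_superharmonic hN (V := fun x => ENNReal.ofReal (Real.posLog (x : ℝ)))
      (measurable_posLog.comp measurable_subtype_coe).ennreal_ofReal
      (fun x => ENNReal.ofReal_ne_top) hR0 (fun x hx => ?_) fun K => ?_
    · simpa only [Real.posLog_abs] using hV x hx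
    · simpa only [Real.posLog_abs] using exists_natCast_le_ofReal (X := X) tendsto_posLog_atTop K
  · obtain ⟨C₁, hC₁, hb₁⟩ := h₁.bump_drift_le hR
    obtain ⟨C₂, hC₂, hb₂⟩ := h₂.bump_drift_le hL
    have hmeas : ∀ Y : ℝ, Measurable fun y : ℝ => ENNReal.ofReal (1 / (1 + (y / Y) ^ 2)) :=
      fun Y => by fun_prop
    obtain ⟨R, -, hφ⟩ := eventually_abs (q := fun x : X => ∀ Y : ℝ, 1 ≤ Y → Y ≤ |(x : ℝ)| →
        ∫⁻ z : X, ENNReal.ofReal (1 / (1 + ((z : ℝ) / Y) ^ 2)) ∂(P x) ≤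
          ENNReal.ofReal (1 / (1 + ((x : ℝ) / Y) ^ 2) + max C₁ C₂ * Y ^ (-β)))
      (by
        filter_upwards [hb₁, tendsto_comap.eventually (eventually_gt_atTop 0)] with x hx h0 Y h1 h2
        rw [abs_of_pos h0] at h2
        have h3 := hx Y h1 h2
        rw [lintegral_rightIncrement (hmeas Y)] at h3
        refine h3.trans (ENNReal.ofReal_le_ofReal ?_)
        gcongr
        exact le_max_left _ _)
      (by
        filter_upwards [hb₂, tendsto_comap.eventually (eventually_gt_atTop 0)] with x hx h0 Y h1 h2
        rw [← abs_neg, abs_of_pos h0] at h2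
        have h3 := hx Y h1 h2
        rw [lintegral_leftIncrement (hmeas Y)] at h3
        simp only [neg_div, neg_sq] at h3
        refine h3.trans (ENNReal.ofReal_le_ofReal ?_)
        gcongr
        exact le_max_right _ _)
    have hc := hT.c_pos
    filter_upwards [eventually_ge_atTop R, eventually_ge_atTop x₀] with a ha1 ha2 x hx
    exact meanPassageTime_eq_top (by linarith [hT.one_lt_beta]) (lt_max_of_lt_left hC₁) hφ ha1 hx
      (by positivity) (hT.jump (ha2.trans hx.le))

lemma positiveRecurrent_of_drift (hN : NonConfined P I) (hT : InwardTails P α β c x₀)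
    (hD : DriftAsymptotics P γ b) (hγ : γ < β - 1) (hb : b < 0) : PositiveRecurrent P I := by
  obtain ⟨K₁, M₁, h₁⟩ := hT.right_family
  obtain ⟨K₂, M₂, h₂⟩ := hT.left_family
  have hγ0 := hD.gamma_nonneg
  have hp : 0 < 1 + γ := by linarith
  have hκ : 0 < 2 / ((1 + γ) * -b) := by
    have : 0 < -b := by linarith
    positivity
  have hmeas : Measurable fun y : ℝ => ENNReal.ofReal (2 / ((1 + γ) * -b) * |y| ^ (1 + γ)) := by
    fun_prop
  obtain ⟨R, -, hV⟩ := eventually_abs_lintegral (P := P)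
    (q := fun m y => m + 1 ≤ ENNReal.ofReal (2 / ((1 + γ) * -b) * y ^ (1 + γ))) hmeas
    (fun y => by rw [abs_neg])
    (h₁.rpow_drift_le hγ0 hγ hD.tendsto_right hb) (h₂.rpow_drift_le hγ0 hγ hD.tendsto_left hb)
  exact positiveRecurrent_of_lyapunov hN
    (V := fun x => ENNReal.ofReal (2 / ((1 + γ) * -b) * |(x : ℝ)| ^ (1 + γ)))
    (hmeas.comp measurable_subtype_coe) (fun x => ENNReal.ofReal_ne_top) hV fun K =>
      exists_natCast_le_ofReal ((tendsto_rpow_atTop hp).const_mul_atTop hκ) K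

lemma directionalTransient_of_drift (hN : NonConfined P I) (hT : InwardTails P α β c x₀)
    (hD : DriftAsymptotics P γ b) (hγ : γ < β - 1) (hb : 0 < b) : DirectionalTransient P I := by
  obtain ⟨K₁, M₁, h₁⟩ := hT.right_family
  obtain ⟨K₂, M₂, h₂⟩ := hT.left_family
  have hγ0 := hD.gamma_nonneg
  obtain ⟨q, hq1, hq2⟩ := exists_between (show 1 + γ < β by linarith)
  -- The power `p` must be small enough that the error, of order `r^(-q)` for a finite moment `q <
  -- β`, stays below the drift term.
  obtain ⟨p, hp0, hp⟩ := exists_between (show 0 < q - (1 + γ) by linarith)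
  have hpq : p + 1 + γ < q := by linarith
  have hmax : ∀ y : ℝ, 0 < max y 1 := fun y => lt_max_of_lt_right one_pos
  obtain ⟨R, hpos, hneg⟩ := exists_forall_lintegral_le (P := P) (f := fun y => max y 1 ^ (-p))
    (by fun_prop) (h₁.rpow_neg_superharmonic hγ0 hp0 hpq hq2 hD.tendsto_right hb)
    (h₂.rpow_neg_superharmonic hγ0 hp0 hpq hq2 hD.tendsto_left hb)
  refine directionalTransient_of_lyapunov hN (f := fun y => max y 1 ^ (-p)) (fun y z hyz => ?_)
    (fun y => Real.rpow_pos_of_pos (hmax y) _) ?_ hpos hneg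
  · exact Real.rpow_le_rpow_of_nonpos (hmax y) (max_le_max_right 1 hyz) (by linarith)
  · exact (tendsto_rpow_neg_atTop hp0).comp
      (tendsto_atTop_mono (fun y => le_max_left y 1) tendsto_id)

lemma monotone_posLog_max : Monotone fun y : ℝ => Real.posLog (max y 0) := fun _ _ hyz =>
  Real.posLog_le_posLog (le_max_right _ _) (max_le_max_right 0 hyz)

lemma tendsto_posLog_max : Tendsto (fun y : ℝ => Real.posLog (max y 0)) atTop atTop :=
  tendsto_posLog_atTop.comp (tendsto_atTop_mono (fun y => le_max_left y 0) tendsto_id)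

lemma oscillatoryTransient_of_drift {δ : ℝ} (hN : NonConfined P I)
    (hT : InwardTails P α β c x₀) (hrate : InwardTailRate P β c x₀ δ)
    (hR : Tendsto (fun x : X => (x : ℝ) ^ (β - 1) * ∫ η, η ∂(rightIncrement P x))
      (comap (fun x : X => (x : ℝ)) atTop) (𝓝 b))
    (hL : Tendsto (fun x : X => (-(x : ℝ)) ^ (β - 1) * ∫ η, η ∂(leftIncrement P x))
      (comap (fun x : X => -(x : ℝ)) atTop) (𝓝 b))
    (hpos : 0 < b + c * Real.pi * Real.cot (Real.pi * β)) : OscillatoryTransient P I := by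
  obtain ⟨K₁, M₁, h₁⟩ := hT.right_family
  obtain ⟨K₂, M₂, h₂⟩ := hT.left_family
  obtain ⟨C₁, hC₁⟩ := hrate.right_rate
  obtain ⟨C₂, hC₂⟩ := hrate.left_rate
  have hδ : 0 < min δ 1 := lt_min hrate.delta_pos one_pos
  have r₁ := eventually_rate (r := fun x : X => (x : ℝ)) (β := β) (c := c) (x₀ := x₀)
    (T := fun x y => (rightIncrement P x).real (Set.Iio (-y))) (C := C₁) (δ := δ) (by
      filter_upwards [hC₁, eventually_ge_atTop 0] with y hy h0 x hx
      rw [rightIncrement_Iio h0]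
      exact hy x hx)
  have r₂ := eventually_rate (r := fun x : X => -(x : ℝ)) (β := β) (c := c) (x₀ := x₀)
    (T := fun x y => (leftIncrement P x).real (Set.Iio (-y))) (C := C₂) (δ := δ) (by
      filter_upwards [hC₂, eventually_ge_atTop 0] with y hy h0 x hx
      rw [leftIncrement_Iio h0]
      exact hy x (le_neg.1 hx))
  have hmeas : Measurable fun y : ℝ => ENNReal.ofReal (1 / (1 + Real.posLog y)) := by
    have := measurable_posLog
    fun_prop
  obtain ⟨R, -, habs⟩ := eventually_abs_lintegral (P := P)
    (q := fun m y => m ≤ ENNReal.ofReal (1 / (1 + Real.posLog y))) hmeas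
    (fun y => by rw [← Real.posLog_abs, abs_neg, Real.posLog_abs])
    (h₁.inv_posLog_superharmonic hR hδ (min_le_right _ _) (abs_nonneg _) r₁ hpos)
    (h₂.inv_posLog_superharmonic hL hδ (min_le_right _ _) (abs_nonneg _) r₂ hpos)
  obtain ⟨R', hp, hn⟩ := exists_forall_lintegral_le (P := P)
    (f := fun y => Real.posLog (max y 0)) monotone_posLog_max.measurable
    (h₁.posLog_max_superharmonic hR) (h₂.posLog_max_superharmonic hL)
  have hden : ∀ y : ℝ, 0 < 1 + Real.posLog (max y 0) := fun y => by
    linarith [Real.posLog_nonneg (x := max y 0)]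
  -- `log⁺` is even and so not monotone; composing with `max · 0` makes both functions monotone on
  -- the whole line and changes nothing at a modulus.
  refine oscillatoryTransient_of_lyapunov hN (f := fun y => 1 / (1 + Real.posLog (max y 0)))
    (g := fun y => Real.posLog (max y 0)) (R₀ := max R R') (fun y z hyz => ?_)
    (fun y => one_div_pos.2 (hden y)) ?_ monotone_posLog_max tendsto_posLog_max (fun x hx => ?_)
    (fun x hx => hp x ((le_max_right _ _).trans_lt hx))
    (fun x hx => hn x ((le_max_right _ _).trans_lt hx))
  · exact one_div_le_one_div_of_le (hden y) (by linarith [monotone_posLog_max hyz])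
  · exact (tendsto_atTop_add_const_left _ _ tendsto_posLog_max).const_div_atTop 1
  · simp only [max_eq_left (abs_nonneg (_ : ℝ))]
    simpa only [Real.posLog_abs] using habs x ((le_max_left _ _).trans_lt hx)

end Classification

end HeavyTailChain

end

theorem theorem2p5 {X : Set ℝ} (hX : MeasurableSet X)
    (P : Kernel X X) [IsMarkovKernel P] (I : Set (ProbabilityMeasure X))
    (α β c x₀ γ b : ℝ)
    (hN : HeavyTailChain.NonConfined P I)
    (hT : HeavyTailChain.InwardTails P α β c x₀)
    (hD : HeavyTailChain.DriftAsymptotics P γ b) :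
    (β - 1 < γ → 3 / 2 < β → HeavyTailChain.NullRecurrent P I) ∧
    (γ < β - 1 → b < 0 → HeavyTailChain.PositiveRecurrent P I) ∧
    (γ < β - 1 → 0 < b → HeavyTailChain.DirectionalTransient P I) ∧
    (γ = β - 1 → b + c * Real.pi * Real.cot (Real.pi * β) < 0 →
      HeavyTailChain.NullRecurrent P I) ∧
    (∀ δ : ℝ, HeavyTailChain.InwardTailRate P β c x₀ δ →
      (β - 1 < γ → β < 3 / 2 → HeavyTailChain.OscillatoryTransient P I) ∧
      (γ = β - 1 → 0 < b + c * Real.pi * Real.cot (Real.pi * β) →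
        HeavyTailChain.OscillatoryTransient P I)) := by
  have hcπ : 0 < c * Real.pi := mul_pos hT.c_pos Real.pi_pos
  refine ⟨fun hγ hβ => ?_, HeavyTailChain.positiveRecurrent_of_drift hN hT hD,
    HeavyTailChain.directionalTransient_of_drift hN hT hD, fun hγ hneg => ?_, fun δ hrate =>
      ⟨fun hγ hβ => ?_, fun hγ hpos => ?_⟩⟩
  -- Here the drift constant at the critical scale is `0`, so only the sign of the cotangent
  -- remains.
  · refine HeavyTailChain.nullRecurrent_of_drift hN hT
      (HeavyTailChain.tendsto_rpow_mul_of_lt hγ hD.tendsto_right)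
      (HeavyTailChain.tendsto_rpow_mul_of_lt hγ hD.tendsto_left) ?_
    rw [zero_add]
    exact mul_neg_of_pos_of_neg hcπ (HeavyTailChain.cot_pi_mul_neg hβ hT.beta_lt_two)
  · subst hγ
    exact HeavyTailChain.nullRecurrent_of_drift hN hT hD.tendsto_right hD.tendsto_left hneg
  · refine HeavyTailChain.oscillatoryTransient_of_drift hN hT hrate
      (HeavyTailChain.tendsto_rpow_mul_of_lt hγ hD.tendsto_right)
      (HeavyTailChain.tendsto_rpow_mul_of_lt hγ hD.tendsto_left) ?_
    rw [zero_add]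
    exact mul_pos hcπ (HeavyTailChain.cot_pi_mul_pos hT.one_lt_beta hβ)
  · subst hγ
    exact HeavyTailChain.oscillatoryTransient_of_drift hN hT hrate hD.tendsto_right
      hD.tendsto_left hpos
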